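/- **Setting.** Let $n\ge 1$ and $y,r_0>0$. Let $(\mathcal S,\mathring\gamma)$ be a smooth $(n-1)$-dimensional Riemannian manifold covered by a collection of smooth coordinate systems $(x^A)$, called *bounded*, in which $|\partial_{A_1}\cdots\partial_{A_m}\mathring\gamma_{BC}|\le B_{0,m}$ $(m\ge0)$ and $|\mathring\gamma^{BC}|\le B_{0,0}$. Put $\mathcal I=(0,\pi/y)\times\mathcal S\ni(t,\cdot)$, $\mathring g=-dt^2+\mathring\gamma$, $\mathcal M=(r_0,\infty)\times\mathcal I\ni(r,t,\cdot)$, $\rho=1/r$; indices $a,b$ refer to coordinates $(t,x^A)$. For functions $\xi$ and $\omega>0$ on a region, $\xi=\mathcal O(\omega)$ means that $\xi$ is smooth and, in every bounded coordinate system, $|\partial_r^k\partial_{a_1}\cdots\partial_{a_m}\xi|\le C_{k,m}\,r^{m-k}\omega$ for all $k,m\ge0$ (constants not depending on the coordinate system). Let $g$ be an *admissible* Lorentzian metric on $\mathcal M$: in bounded coordinates $$g_{rr}=r^{-2}-r^{-4}+\mathcal O(r^{-5}),\qquad g_{ra}=\mathcal O(r^{-3}),\qquad r^{-2}g_{ab}=\mathring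 g_{ab}+r^{-2}\bar g_{ab}+\mathcal O(r^{-3}),$$ with constants $B_{k,m}$, where $\bar g$ is a smooth symmetric $2$-tensor on $\mathcal I$ with $|\partial_{a_1}\cdots\partial_{a_m}\bar g_{bc}|\le B_{0,m}$. Let $$f=\frac{\rho}{\sin(yt)},\qquad w_\zeta=f+f\rho^2+f\rho^2\zeta,\qquad \Pi_\zeta=-(\bar g+y^2dt^2+\zeta\mathring g)\qquad(\zeta\in C^\infty(\mathcal M)),$$ and let $\nabla$ be the Levi-Civita connection of $g$. Let $E_1,\dots,E_{n-1}$ be a $g$-orthonormal frame of the level sets of $(r,t)$, and let $$\bar T=\partial_t+yf\cos(yt)\,\partial_\rho,\qquad \tilde T=\bar T-\sum_Ag(\bar T,E_A)E_A,\qquad T=|g(\tilde T,\tilde T)|^{-1/2}\tilde T ,$$ so that $T,E_1,\dots,E_{n-1}$ is tangent to the level sets of $f$ (here $\partial_\rho=-r^2\partial_r$). For a tensor on $\mathcal I$, the indices $A,B$ below denote evaluation on $\rho^{-1}E_A,\rho^{-1}E_B$, and the index $t$ evaluation on $\partial_t$. A level set $\{f=\varepsilon\}$ is *pseudoconvex*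 (with respect to $\Box_g$ and the direction of increasing $f$) at a point if $\nabla^2f(X,X)<0$ for every nonzero $g$-null vector $X$ tangent to it there. **Theorem.** There are $\delta>0$, constants in the bounds below, and $\varepsilon_0(K)>0$ for each $K>0$, depending only on $n$, $y$ and the constants $B_{k,m}$, such that for all $\mathcal S,r_0,\bar g,g$ as above and all $\zeta\in C^\infty(\mathcal M)$ the following holds. 1. On $\{f<\delta\}$, for every such frame $(E_A)$ whose components in bounded coordinates are $\mathcal O(\rho)$, $$\begin{aligned}-(\nabla^2f+w_\zeta g)(E_A,E_B)&=-f\rho^2(\bar g_{AB}+\zeta\mathring g_{AB})+\mathcal O(f\rho^3)\quad\text{if }\zeta=\mathcal O(1),\\-(\nabla^2f+w_\zeta g)(T,E_A)&=-f\rho^2(\bar g_{tA}+\zeta\mathring g_{tA})+\mathcal O(f^2\rho^2),\\-(\nabla^2f+w_\zeta g)(T,T)&=-f\rho^2(\bar g_{tt}+y^2+\zeta\mathring g_{tt})+\mathcal O(f\rho^3+f^3\rho^2),\end{aligned}$$ where the constants of the $\mathcal O$'s depend in addition only on those for the components of $E_A$ and, in the first line, on those in $\zeta=\mathcal O(1)$.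 Moreover, at every point of $\{f<\delta\}$ and for every $g$-orthonormal frame $E_A$ there, the three error terms are bounded in absolute value by $c\,f\rho^3(1+\rho|\zeta|)$, $c\,f^2\rho^2$ and $c\,(f\rho^3+f^3\rho^2)$ respectively, with $c$ depending only on $n$, $y$ and $(B_{k,m})$. 2. If $\Pi_\zeta$ is uniformly positive-definite on a set $Q\subseteq\mathcal M$ (for instance $Q=\mathcal M$), that is, if for some $K>0$ one has $\Pi_\zeta(X,X)\ge K[(X^t)^2+\mathring\gamma(X',X')]$ for all $X=X^t\partial_t+X'$ ($X'$ tangent to $\mathcal S$) at the points of $Q$, then for all $0<\varepsilon<\varepsilon_0(K)$ the level set $\{f=\varepsilon\}$ is pseudoconvex at each of its points in $Q$. 3. If $\zeta$ does not depend on $r$ and $\Pi_\zeta$ is positive-definite at each point, then for every compact $Q\subset\mathcal I$ there is $\varepsilon_1>0$ such that for all $0<\varepsilon<\varepsilon_1$ the level set $\{f=\varepsilon\}$ is pseudoconvex at each of its points over $Q$. -/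

import Mathlib

open Set
open scoped Manifold ContDiff

noncomputable section

namespace AAdS

/-! ### Calculus in coordinates -/

/-- The coordinate derivative `∂_i h`. -/
def pd {m : ℕ} (i : Fin m) (h : (Fin m → ℝ) → ℝ) : (Fin m → ℝ) → ℝ :=
  fun z => fderiv ℝ h z (Pi.single i 1)

/-- The iterated coordinate derivative `∂_{i₁} ⋯ ∂_{i_k} h` along the list `[i₁, …, i_k]`. -/
def pds {m : ℕ} (l : List (Fin m)) (h : (Fin m → ℝ) → ℝ) : (Fin m → ℝ) → ℝ :=
  l.foldr pd h

/-- The value `M(u, v) = ∑ M_{ij} u^i v^j` of a bilinear form given by its components. -/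
def bil {m : ℕ} (M : Matrix (Fin m) (Fin m) ℝ) (u v : Fin m → ℝ) : ℝ :=
  ∑ i, ∑ j, M i j * u i * v j

/-- The Christoffel symbols `Γ^k_{ij}` of the metric with components `G`. -/
def christoffel {m : ℕ} (G : (Fin m → ℝ) → Matrix (Fin m) (Fin m) ℝ) (z : Fin m → ℝ)
    (k i j : Fin m) : ℝ :=
  (1 / 2) * ∑ l, (G z)⁻¹ k l *
    (pd i (fun x => G x l j) z + pd j (fun x => G x l i) z - pd l (fun x => G x i j) z)

/-- The components `∂_i ∂_j F - Γ^k_{ij} ∂_k F` of the Hessian `∇²F`, where `∇` is the Levi-Civita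
connection of the metric with components `G`. -/
def hessian {m : ℕ} (G : (Fin m → ℝ) → Matrix (Fin m) (Fin m) ℝ) (F : (Fin m → ℝ) → ℝ)
    (z : Fin m → ℝ) : Matrix (Fin m) (Fin m) ℝ :=
  Matrix.of fun i j => pd i (pd j F) z - ∑ k, christoffel G z k i j * pd k F z

/-- `h` is smooth on `U`, and its coordinate derivatives of order `m` are bounded by `b m`. -/
def BddDerivs {m : ℕ} (b : ℕ → ℝ) (U : Set (Fin m → ℝ)) (h : (Fin m → ℝ) → ℝ) : Prop :=
  ContDiffOn ℝ ∞ h U ∧ ∀ (l : List (Fin m)), ∀ z ∈ U, |pds l h z| ≤ b l.length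

/-- `ξ = 𝒪(wt)` on `U`, with constants `C`: in coordinates `z = (r, t, x¹, …, x^d)`,
`|∂_r^k ∂_{a₁} ⋯ ∂_{a_m} ξ| ≤ C k m * r^(m - k) * wt` for all `k, m`, where the `a_i` run over
the coordinates `t, x¹, …, x^d`. -/
def IsO {d : ℕ} (C : ℕ → ℕ → ℝ) (U : Set (Fin (d + 2) → ℝ)) (wt ξ : (Fin (d + 2) → ℝ) → ℝ) :
    Prop :=
  ContDiffOn ℝ ∞ ξ U ∧
    ∀ (k : ℕ) (l : List (Fin (d + 1))), ∀ z ∈ U,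
      |pds (List.replicate k 0 ++ l.map Fin.succ) ξ z|
        ≤ C k l.length * (z 0) ^ ((l.length : ℤ) - (k : ℤ)) * wt z

/-! ### aAdS segments -/

/-- The data on `M = (r₀, ∞) × (0, π/y) × S`, `dim S = d = n - 1`: a Riemannian metric `γ` on `S`,
a distinguished collection of coordinate systems covering `S`, a symmetric `2`-tensor `gbar` on
`(0, π/y) × S`, and a Lorentzian metric `g` on `M`. A point of `M` is a triple `p = (r, t, s)`,
`T_p M = ℝ × ℝ × T_s S`, and values of `gbar` and `g` at points with `r ∉ (r₀, ∞)` or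
`t ∉ (0, π/y)` are irrelevant. -/
structure Segment (d : ℕ) (y r₀ : ℝ) (S : Type*) [TopologicalSpace S]
    [ChartedSpace (EuclideanSpace ℝ (Fin d)) S]
    [IsManifold 𝓘(ℝ, EuclideanSpace ℝ (Fin d)) ∞ S] where
  γ : Bundle.ContMDiffRiemannianMetric 𝓘(ℝ, EuclideanSpace ℝ (Fin d)) ∞
    (EuclideanSpace ℝ (Fin d)) (fun s : S => TangentSpace 𝓘(ℝ, EuclideanSpace ℝ (Fin d)) s)
  charts : Set (OpenPartialHomeomorph S (EuclideanSpace ℝ (Fin d)))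
  charts_smooth : charts ⊆ IsManifold.maximalAtlas 𝓘(ℝ, EuclideanSpace ℝ (Fin d)) ∞ S
  charts_cover : ∀ s : S, ∃ e ∈ charts, s ∈ e.source
  gbar : ∀ q : ℝ × S,
    LinearMap.BilinForm ℝ (ℝ × TangentSpace 𝓘(ℝ, EuclideanSpace ℝ (Fin d)) q.2)
  gbar_symm : ∀ q : ℝ × S, q.1 ∈ Ioo 0 (Real.pi / y) → ∀ u v, gbar q u v = gbar q v u
  g : ∀ p : ℝ × ℝ × S,
    LinearMap.BilinForm ℝ (ℝ × ℝ × TangentSpace 𝓘(ℝ, EuclideanSpace ℝ (Fin d)) p.2.2)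
  g_symm : ∀ p : ℝ × ℝ × S, p.1 ∈ Ioi r₀ → p.2.1 ∈ Ioo 0 (Real.pi / y) →
    ∀ u v, g p u v = g p v u
  g_lorentzian : ∀ p : ℝ × ℝ × S, p.1 ∈ Ioi r₀ → p.2.1 ∈ Ioo 0 (Real.pi / y) →
    ∃ b : Module.Basis (Fin (d + 2)) ℝ
        (ℝ × ℝ × TangentSpace 𝓘(ℝ, EuclideanSpace ℝ (Fin d)) p.2.2),
      ∀ i j, g p (b i) (b j) = if i = j then (if i = 0 then -1 else 1) else 0

namespace Segment

variable {d : ℕ} {y r₀ : ℝ} {S : Type*} [TopologicalSpace S]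
  [ChartedSpace (EuclideanSpace ℝ (Fin d)) S]
  [IsManifold 𝓘(ℝ, EuclideanSpace ℝ (Fin d)) ∞ S]

/-- The manifold `M = (r₀, ∞) × (0, π/y) × S`. -/
def M (_A : Segment d y r₀ S) : Set (ℝ × ℝ × S) :=
  Ioi r₀ ×ˢ (Ioo 0 (Real.pi / y) ×ˢ univ)

/-- The metric at infinity, `-dt² + γ`, at a point of `(0, π/y) × S` over `s`. -/
def gring (A : Segment d y r₀ S) (s : S)
    (u v : ℝ × TangentSpace 𝓘(ℝ, EuclideanSpace ℝ (Fin d)) s) : ℝ :=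
  -(u.1 * v.1) + A.γ.inner s u.2 v.2

/-- The tensor `Π_ζ = -(ḡ + y² dt² + ζ g̊)`. -/
def Pi (A : Segment d y r₀ S) (ζ : ℝ × ℝ × S → ℝ) (p : ℝ × ℝ × S)
    (u v : ℝ × TangentSpace 𝓘(ℝ, EuclideanSpace ℝ (Fin d)) p.2.2) : ℝ :=
  -(A.gbar p.2 u v + y ^ 2 * (u.1 * v.1) + ζ p * A.gring p.2.2 u v)

/-- The `ζ`-pseudoconvex property with constant `K` at the points of `Q ⊆ M`:
`Π_ζ(X, X) ≥ K ((X^t)² + γ(X', X'))` for every `X = (X^t, X')`. -/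
def PseudoconvexProperty (A : Segment d y r₀ S) (ζ : ℝ × ℝ × S → ℝ) (K : ℝ)
    (Q : Set (ℝ × ℝ × S)) : Prop :=
  ∀ p ∈ Q, ∀ X : ℝ × TangentSpace 𝓘(ℝ, EuclideanSpace ℝ (Fin d)) p.2.2,
    K * (X.1 ^ 2 + A.γ.inner p.2.2 X.2 X.2) ≤ A.Pi ζ p X X

/-- The inverted radius `ρ = 1/r`. -/
def rho (_A : Segment d y r₀ S) (p : ℝ × ℝ × S) : ℝ := p.1⁻¹

/-- The function `f = ρ / sin(y t)`. -/
def f (A : Segment d y r₀ S) (p : ℝ × ℝ × S) : ℝ := A.rho p / Real.sin (y * p.2.1)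

/-- The function `w_ζ = f + f ρ² + f ρ² ζ`. -/
def w (A : Segment d y r₀ S) (ζ : ℝ × ℝ × S → ℝ) (p : ℝ × ℝ × S) : ℝ :=
  A.f p + A.f p * A.rho p ^ 2 + A.f p * A.rho p ^ 2 * ζ p

section Coordinates

variable (A : Segment d y r₀ S) (e : OpenPartialHomeomorph S (EuclideanSpace ℝ (Fin d)))

/-! A coordinate system `e` on `S` gives coordinates `x = (x¹, …, x^d)` on `S`,
`q = (t, x¹, …, x^d)` on `(0, π/y) × S`, and `z = (r, t, x¹, …, x^d)` on `M`. -/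

/-- The range of the coordinates `x`. -/
def xDom : Set (Fin d → ℝ) := {x | WithLp.toLp 2 x ∈ e.target}

/-- The range of the coordinates `q = (t, x)`. -/
def qDom : Set (Fin (d + 1) → ℝ) :=
  {q | q 0 ∈ Ioo 0 (Real.pi / y) ∧ Fin.tail q ∈ xDom e}

/-- The range of the coordinates `z = (r, t, x)`. -/
def zDom : Set (Fin (d + 2) → ℝ) :=
  {z | z 0 ∈ Ioi r₀ ∧ Fin.tail z ∈ qDom (y := y) e}

/-- The point of `S` with coordinates `x`. -/
def xPt (x : Fin d → ℝ) : S := e.symm (WithLp.toLp 2 x)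

/-- The point of `(0, π/y) × S` with coordinates `q`. -/
def qPt (q : Fin (d + 1) → ℝ) : ℝ × S := (q 0, xPt e (Fin.tail q))

/-- The point of `M` with coordinates `z`. -/
def zPt (z : Fin (d + 2) → ℝ) : ℝ × ℝ × S := (z 0, qPt e (Fin.tail z))

/-- The coordinate vector field `∂_{x^i}` on `S`. -/
def xVec (x : Fin d → ℝ) (i : Fin d) :
    TangentSpace 𝓘(ℝ, EuclideanSpace ℝ (Fin d)) (xPt e x) :=
  mfderiv 𝓘(ℝ, EuclideanSpace ℝ (Fin d)) 𝓘(ℝ, EuclideanSpace ℝ (Fin d)) e.symm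
    (WithLp.toLp 2 x) (EuclideanSpace.single i (1 : ℝ))

/-- The coordinate vector fields `∂_t, ∂_{x^i}` on `(0, π/y) × S`. -/
def qVec (q : Fin (d + 1) → ℝ) :
    Fin (d + 1) → ℝ × TangentSpace 𝓘(ℝ, EuclideanSpace ℝ (Fin d)) (qPt e q).2 :=
  Fin.cons (1, 0) fun i => (0, xVec e (Fin.tail q) i)

/-- The coordinate vector fields `∂_r, ∂_t, ∂_{x^i}` on `M`. -/
def zVec (z : Fin (d + 2) → ℝ) :
    Fin (d + 2) → ℝ × ℝ × TangentSpace 𝓘(ℝ, EuclideanSpace ℝ (Fin d)) (zPt e z).2.2 :=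
  Fin.cons (1, 0) fun a => (0, qVec e (Fin.tail z) a)

/-- The components `γ_{ij}`. -/
def γC (x : Fin d → ℝ) : Matrix (Fin d) (Fin d) ℝ :=
  Matrix.of fun i j => A.γ.inner (xPt e x) (xVec e x i) (xVec e x j)

/-- The components of `-dt² + γ`. -/
def gringC (q : Fin (d + 1) → ℝ) : Matrix (Fin (d + 1)) (Fin (d + 1)) ℝ :=
  Matrix.of fun a b => A.gring (qPt e q).2 (qVec e q a) (qVec e q b)

/-- The components `ḡ_{ab}`. -/
def gbarC (q : Fin (d + 1) → ℝ) : Matrix (Fin (d + 1)) (Fin (d + 1)) ℝ :=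
  Matrix.of fun a b => A.gbar (qPt e q) (qVec e q a) (qVec e q b)

/-- The components `g_{αβ}` in the coordinates `(r, t, x)`. -/
def gC (z : Fin (d + 2) → ℝ) : Matrix (Fin (d + 2)) (Fin (d + 2)) ℝ :=
  Matrix.of fun α β => A.g (zPt e z) (zVec e z α) (zVec e z β)

/-- The components of the Hessian `∇²H` with respect to `g` of a function `H` on `M`. -/
def hessC (H : ℝ × ℝ × S → ℝ) (z : Fin (d + 2) → ℝ) : Matrix (Fin (d + 2)) (Fin (d + 2)) ℝ :=
  hessian (A.gC e) (fun x => H (zPt e x)) z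

/-! Tangent vectors below are given by their components in the coordinates `(r, t, x)`. -/

/-- The vector at `z` tangent to `S` with components `v`. -/
def vecS (v : Fin d → ℝ) : Fin (d + 2) → ℝ := Fin.cons 0 (Fin.cons 0 v)

/-- The vector `T̄ = ∂_t + y f cos(y t) ∂_ρ`, where `∂_ρ = -r² ∂_r`. -/
def Tbar (z : Fin (d + 2) → ℝ) : Fin (d + 2) → ℝ :=
  Fin.cons (y * A.f (zPt e z) * Real.cos (y * z 1) * (-(z 0) ^ 2)) (Fin.cons 1 fun _ => 0)

/-- The vectors `E_1, …, E_d` at `z` are tangent to the level set of `(r, t)` and orthonormal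
with respect to `g`; `E A` lists the components of `E_A`. -/
def IsOrthonormalFrame (z : Fin (d + 2) → ℝ) (E : Fin d → Fin d → ℝ) : Prop :=
  ∀ i j, bil (A.gC e z) (vecS (E i)) (vecS (E j)) = if i = j then 1 else 0

/-- The vector `T̃ = T̄ - ∑_A g(T̄, E_A) E_A`. -/
def Ttilde (z : Fin (d + 2) → ℝ) (E : Fin d → Fin d → ℝ) : Fin (d + 2) → ℝ :=
  A.Tbar e z - ∑ i, bil (A.gC e z) (A.Tbar e z) (vecS (E i)) • vecS (E i)

/-- The vector `T = |g(T̃, T̃)|^(-1/2) T̃`. -/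
def T (z : Fin (d + 2) → ℝ) (E : Fin d → Fin d → ℝ) : Fin (d + 2) → ℝ :=
  (Real.sqrt |bil (A.gC e z) (A.Ttilde e z E) (A.Ttilde e z E)|)⁻¹ • A.Ttilde e z E

/-- The form `-(∇²f + w_ζ g)`. -/
def form (ζ : ℝ × ℝ × S → ℝ) (z : Fin (d + 2) → ℝ) : Matrix (Fin (d + 2)) (Fin (d + 2)) ℝ :=
  -(A.hessC e A.f z + A.w ζ (zPt e z) • A.gC e z)

/-- The vector `∂_t` on `(0, π/y) × S`. -/
def dtI : Fin (d + 1) → ℝ := Fin.cons 1 fun _ => 0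

/-- The vector `r E` on `(0, π/y) × S`, for `E` tangent to `S`. It is `∂_{x^A}` in the coordinates
adapted to the point, in which `E = E_A = ρ ∂_{x^A}`. -/
def rE (z : Fin (d + 2) → ℝ) (v : Fin d → ℝ) : Fin (d + 1) → ℝ := Fin.cons 0 (z 0 • v)

/-- `-(∇²f + w_ζ g)(E_A, E_B)` minus its leading part `-f ρ² (ḡ_{AB} + ζ g̊_{AB})`. -/
def errEE (ζ : ℝ × ℝ × S → ℝ) (E : Fin d → Fin d → ℝ) (i j : Fin d) (z : Fin (d + 2) → ℝ) : ℝ :=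
  bil (A.form e ζ z) (vecS (E i)) (vecS (E j))
    - -(A.f (zPt e z) * A.rho (zPt e z) ^ 2 *
        (bil (A.gbarC e (Fin.tail z)) (rE z (E i)) (rE z (E j))
          + ζ (zPt e z) * bil (A.gringC e (Fin.tail z)) (rE z (E i)) (rE z (E j))))

/-- `-(∇²f + w_ζ g)(T, E_A)` minus its leading part `-f ρ² (ḡ_{tA} + ζ g̊_{tA})`. -/
def errTE (ζ : ℝ × ℝ × S → ℝ) (E : Fin d → Fin d → ℝ) (i : Fin d) (z : Fin (d + 2) → ℝ) : ℝ :=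
  bil (A.form e ζ z) (A.T e z E) (vecS (E i))
    - -(A.f (zPt e z) * A.rho (zPt e z) ^ 2 *
        (bil (A.gbarC e (Fin.tail z)) dtI (rE z (E i))
          + ζ (zPt e z) * bil (A.gringC e (Fin.tail z)) dtI (rE z (E i))))

/-- `-(∇²f + w_ζ g)(T, T)` minus its leading part `-f ρ² (ḡ_{tt} + y² + ζ g̊_{tt})`. -/
def errTT (ζ : ℝ × ℝ × S → ℝ) (E : Fin d → Fin d → ℝ) (z : Fin (d + 2) → ℝ) : ℝ :=
  bil (A.form e ζ z) (A.T e z E) (A.T e z E)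
    - -(A.f (zPt e z) * A.rho (zPt e z) ^ 2 *
        (bil (A.gbarC e (Fin.tail z)) dtI dtI + y ^ 2
          + ζ (zPt e z) * bil (A.gringC e (Fin.tail z)) dtI dtI))

end Coordinates

/-- `A` is an admissible aAdS segment, the implied constants of all the bounds being given by `B`,
uniformly over the bounded coordinate systems `e ∈ A.charts`. -/
structure Admissible (A : Segment d y r₀ S) (B : ℕ → ℕ → ℝ) : Prop where
  γ_bdd : ∀ e ∈ A.charts, ∀ i j, BddDerivs (B 0) (xDom e) fun x => A.γC e x i j
  γ_inv_bdd : ∀ e ∈ A.charts, ∀ i j, ∀ x ∈ xDom e, |(A.γC e x)⁻¹ i j| ≤ B 0 0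
  gbar_bdd : ∀ e ∈ A.charts, ∀ a b,
    BddDerivs (B 0) (qDom (y := y) e) fun q => A.gbarC e q a b
  g_rr : ∀ e ∈ A.charts,
    IsO B (zDom (y := y) (r₀ := r₀) e) (fun z => (z 0) ^ (-5 : ℤ))
      fun z => A.gC e z 0 0 - ((z 0) ^ (-2 : ℤ) - (z 0) ^ (-4 : ℤ))
  g_ra : ∀ e ∈ A.charts, ∀ a : Fin (d + 1),
    IsO B (zDom (y := y) (r₀ := r₀) e) (fun z => (z 0) ^ (-3 : ℤ))
      fun z => A.gC e z 0 a.succ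
  g_ab : ∀ e ∈ A.charts, ∀ a b : Fin (d + 1),
    IsO B (zDom (y := y) (r₀ := r₀) e) (fun z => (z 0) ^ (-3 : ℤ))
      fun z => (z 0) ^ (-2 : ℤ) * A.gC e z a.succ b.succ
        - (A.gringC e (Fin.tail z) a b + (z 0) ^ (-2 : ℤ) * A.gbarC e (Fin.tail z) a b)

/-- `ζ = 𝒪(1)` on `M`, with constants `Z`. -/
def IsO1 (A : Segment d y r₀ S) (Z : ℕ → ℕ → ℝ) (ζ : ℝ × ℝ × S → ℝ) : Prop :=
  ∀ e ∈ A.charts, IsO Z (zDom (y := y) (r₀ := r₀) e) (fun _ => 1) fun z => ζ (zPt e z)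

/-- `ζ ∈ C^∞(M)`. -/
def SmoothOnM (A : Segment d y r₀ S) (ζ : ℝ × ℝ × S → ℝ) : Prop :=
  ContMDiffOn (𝓘(ℝ, ℝ).prod (𝓘(ℝ, ℝ).prod 𝓘(ℝ, EuclideanSpace ℝ (Fin d)))) 𝓘(ℝ, ℝ) ∞ ζ A.M

/-- The hypersurface `{H = 0}` of `M` is pseudoconvex, with respect to the wave operator of `g` and
the direction of increasing `H`, at its points in `Q`: for every nonzero null vector `X` tangent to
it at such a point, `∇²H(X, X) < 0`. As `∇²H` is a tensor, it is enough to compute in the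
coordinate systems `e ∈ A.charts`, which cover `S`. -/
def PseudoconvexOn (A : Segment d y r₀ S) (H : ℝ × ℝ × S → ℝ) (Q : Set (ℝ × ℝ × S)) : Prop :=
  ∀ e ∈ A.charts, ∀ z ∈ zDom (y := y) (r₀ := r₀) e, zPt e z ∈ Q → H (zPt e z) = 0 →
    ∀ X : Fin (d + 2) → ℝ, X ≠ 0 → bil (A.gC e z) X X = 0 →
      ∑ α, pd α (fun x => H (zPt e x)) z * X α = 0 →
      bil (A.hessC e H z) X X < 0

/-- The part `{f < δ}` of the coordinate range. -/
def smallDom (A : Segment d y r₀ S) (δ : ℝ)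
    (e : OpenPartialHomeomorph S (EuclideanSpace ℝ (Fin d))) : Set (Fin (d + 2) → ℝ) :=
  {z | z ∈ zDom (y := y) (r₀ := r₀) e ∧ A.f (zPt e z) < δ}

end Segment

end AAdS

end

/-!
Write `ρ = 1/r` and `f = ρ / sin (y t)`. On `{f < 1}` one has `ρ ≤ f < 1`, so a weight `ρ ^ a f ^ b`
is bounded by `ρ ^ a' f ^ b'` as soon as `a' ≤ a` and `a' + b' ≤ a + b`. All estimates are made with
such weights (`O`, with the comparison `Ord.mono'`). To have constants that depend only on
`d`, `y` and `B`, an estimate is always a statement about a family of functions, indexed for instance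
by the type `CoordData d y B` of all coordinate expressions of admissible metrics; a number `N`
counts the derivatives that are estimated. Thus the pointwise bounds (`N = 0`, the family of all
orthonormal frames at single points) and the bounds of all derivatives (every `N`, the family of all
frames of class `𝒪(ρ)` with given constants) are two instances of the same lemmas.

In the frame `r ∂_r, ρ ∂_t, ρ ∂_x` the metric is a perturbation of the block matrix formed by `1` and
`-dt² + γ`, and its inverse is bounded. This gives first the gradient of `f`, whose radial component
is needed to a higher order than the others (`O_grad_r`), and then the Hessian. In `K = ∇²f + f g`
the leading parts cancel: `K(E_i, E_j)` and, with `T̄ = ∂_t + y f cos(y t) ∂_ρ`, also `K(T̄, T̄)` and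
`K(T̄, E_i)` are of order `f ρ²` in normalized vectors, because the terms of order `f³` compensate
each other (`ord_K_TT`). What remains at order `f ρ²` consists of `ḡ`, of `y² dt²`, and of `-g̊`,
which the summand `f ρ²` of `w_ζ` removes. Passing from `T̄` to `T` costs
errors of higher order only. The function `ζ` enters the components along `T` exactly, since
`g(T, T) = -1 = g̊(∂_t, ∂_t)` and `g(T, E_i) = 0 = g̊(∂_t, E_i)`, which is why it is absent from the
corresponding errors (`O_errEE₀`, `O_errEE₁`, `O_errTE`, `ord_errTT`).

A null vector tangent to a level set of `f` is `X = x₀ T + ∑ x_i E_i` with `x₀² = ∑ x_i²`, so that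
`-∇²f(X, X) = -(∇²f + w_ζ g)(X, X)` is `f ρ² Π_ζ(X̂, X̂)` with `X̂ = x₀ ∂_t + ∑ x_i r E_i`, up to an error
of order `f² ρ² x₀²`. The lower bound `Π_ζ ≥ K` gives `Π_ζ(X̂, X̂) ≥ K x₀²`, and it also bounds `ζ`: from
below through the value on `∂_t`, and from above through the values on vectors tangent to `S`
(`CoordData.abs_le_of_nonneg_piz`). So the main term wins for `f < ε₀(K)`
(`CoordData.exists_pseudoconvex`). If `ζ` does not depend on `r`, a positive lower bound over a
compact set follows from positivity at each point (`Segment.exists_pseudoconvexProperty`).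
-/

noncomputable section
namespace AAdS

/-! ### Coordinate derivatives -/

section CoordinateDerivatives

variable {m : ℕ} {U : Set (Fin m → ℝ)} {g h : (Fin m → ℝ) → ℝ} {z : Fin m → ℝ}

theorem pd_congr (hU : IsOpen U) (H : EqOn g h U) (hz : z ∈ U) (i : Fin m) :
    pd i g z = pd i h z := by
  have : g =ᶠ[nhds z] h := Filter.eventuallyEq_of_mem (hU.mem_nhds hz) H
  simp [pd, this.fderiv_eq]

theorem pd_add (i : Fin m) (hg : DifferentiableAt ℝ g z) (hh : DifferentiableAt ℝ h z) :
    pd i (fun x => g x + h x) z = pd i g z + pd i h z := by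
  simp [pd, fderiv_fun_add hg hh]

theorem pd_sub (i : Fin m) (hg : DifferentiableAt ℝ g z) (hh : DifferentiableAt ℝ h z) :
    pd i (fun x => g x - h x) z = pd i g z - pd i h z := by
  simp [pd, fderiv_fun_sub hg hh]

theorem pd_mul (i : Fin m) (hg : DifferentiableAt ℝ g z) (hh : DifferentiableAt ℝ h z) :
    pd i (fun x => g x * h x) z = g z * pd i h z + h z * pd i g z := by
  simp [pd, fderiv_fun_mul hg hh]

theorem pd_const (i : Fin m) (c : ℝ) : pd i (fun _ => c) z = 0 := by
  simp [pd]

theorem pd_comp {φ : ℝ → ℝ} {φ' : ℝ} (i : Fin m) (hφ : HasDerivAt φ φ' (g z))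
    (hg : DifferentiableAt ℝ g z) : pd i (fun x => φ (g x)) z = φ' * pd i g z := by
  have := (hφ.comp_hasFDerivAt z hg.hasFDerivAt).fderiv
  simp only [Function.comp_def] at this
  simp [pd, this]

theorem pd_coord (i j : Fin m) : pd i (fun x => x j) z = if j = i then 1 else 0 := by
  have : HasFDerivAt (fun x : Fin m → ℝ => x j)
      (ContinuousLinearMap.proj (R := ℝ) (φ := fun _ : Fin m => ℝ) j) z :=
    (ContinuousLinearMap.proj (R := ℝ) (φ := fun _ : Fin m => ℝ) j).hasFDerivAt
  simp [pd, this.fderiv, Pi.single_apply]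

theorem contDiffOn_pd (hU : IsOpen U) (hh : ContDiffOn ℝ ∞ h U) (i : Fin m) :
    ContDiffOn ℝ ∞ (pd i h) U := by
  have h1 : ContDiffOn ℝ ∞ (fun z => fderiv ℝ h z) U :=
    hh.fderiv_of_isOpen hU (by simp)
  exact h1.clm_apply contDiffOn_const

theorem contDiffOn_pds (hU : IsOpen U) (hh : ContDiffOn ℝ ∞ h U) (l : List (Fin m)) :
    ContDiffOn ℝ ∞ (pds l h) U := by
  induction l with
  | nil => exact hh
  | cons a l ih => exact contDiffOn_pd hU ih a

theorem pd_comm (hU : IsOpen U) (hh : ContDiffOn ℝ ∞ h U) (hz : z ∈ U) (i j : Fin m) :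
    pd i (pd j h) z = pd j (pd i h) z := by
  have hc : ContDiffAt ℝ ∞ h z := hh.contDiffAt (hU.mem_nhds hz)
  have hs : IsSymmSndFDerivAt ℝ h z := hc.isSymmSndFDerivAt
    (by rw [minSmoothness_of_isRCLikeNormedField]; exact WithTop.coe_le_coe.2 le_top)
  have hd : DifferentiableAt ℝ (fderiv ℝ h) z :=
    (hc.fderiv_right (m := 1) (by norm_cast)).differentiableAt (by simp)
  have key : ∀ a b : Fin m, pd a (pd b h) z
      = fderiv ℝ (fderiv ℝ h) z (Pi.single a 1) (Pi.single b 1) := by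
    intro a b
    have : HasFDerivAt (fun x => fderiv ℝ h x (Pi.single b 1)) _ z :=
      hd.hasFDerivAt.clm_apply (hasFDerivAt_const _ _)
    change fderiv ℝ (fun x => fderiv ℝ h x (Pi.single b 1)) z (Pi.single a 1) = _
    simp [this.fderiv]
  rw [key, key]
  exact hs.eq _ _

theorem pds_append (l l' : List (Fin m)) : pds (l ++ l') h = pds l (pds l' h) := by
  simp [pds]

theorem pds_pd_comm (hU : IsOpen U) (hh : ContDiffOn ℝ ∞ h U) (i : Fin m) (l : List (Fin m)) :
    EqOn (pds l (pd i h)) (pd i (pds l h)) U := by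
  induction l with
  | nil => exact fun z _ => rfl
  | cons a l ih =>
    intro z hz
    have h1 : pds (a :: l) (pd i h) z = pd a (pd i (pds l h)) z := pd_congr hU ih hz a
    rw [h1, pd_comm hU (contDiffOn_pds hU hh l) hz]
    rfl

end CoordinateDerivatives

/-! ### Uniform symbol estimates for families of functions -/

section Ord

variable {d : ℕ} {ι : Type*}

/-- Uniform symbol estimates of order `N` with weight `w` for a family `ξ i` on the sets `U i`:
`ξ i` is bounded by a multiple of `w`, and, for `N > 0`, it is differentiable with `∂_r ξ i` and
`∂_a ξ i` satisfying estimates of order `N - 1` with weights `r⁻¹ w` and `r w`. The constants do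
not depend on `i`. For `N = 0` nothing is asked about derivatives, so that pointwise estimates and
estimates of all derivatives are instances of the same statement. -/
def Ord (U : ι → Set (Fin (d + 2) → ℝ)) :
    ℕ → ((Fin (d + 2) → ℝ) → ℝ) → (ι → (Fin (d + 2) → ℝ) → ℝ) → Prop
  | 0, w, ξ => ∃ C : ℝ, 0 ≤ C ∧ ∀ i, ∀ z ∈ U i, |ξ i z| ≤ C * w z
  | N + 1, w, ξ => (∃ C : ℝ, 0 ≤ C ∧ ∀ i, ∀ z ∈ U i, |ξ i z| ≤ C * w z) ∧
      (∀ i, ∀ z ∈ U i, DifferentiableAt ℝ (ξ i) z) ∧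
      Ord U N (fun z => (z 0)⁻¹ * w z) (fun i => pd 0 (ξ i)) ∧
      ∀ a : Fin (d + 1), Ord U N (fun z => z 0 * w z) (fun i => pd a.succ (ξ i))

/-- The sets `U i` lie in `{r > 0}` and, if derivatives are considered at all, are open. -/
class Region (U : ι → Set (Fin (d + 2) → ℝ)) (N : ℕ) : Prop where
  isOpen : N = 0 ∨ ∀ i, IsOpen (U i)
  pos : ∀ i, ∀ z ∈ U i, 0 < z 0

variable {U : ι → Set (Fin (d + 2) → ℝ)} {N : ℕ} {w w' : (Fin (d + 2) → ℝ) → ℝ}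
  {ξ η : ι → (Fin (d + 2) → ℝ) → ℝ}

theorem Region.pred (h : Region U (N + 1)) : Region U N :=
  ⟨Or.inr (h.isOpen.resolve_left (by simp)), h.pos⟩

theorem Region.open_succ (h : Region U (N + 1)) (i : ι) : IsOpen (U i) :=
  h.isOpen.resolve_left (by simp) i

theorem Ord.bound (h : Ord U N w ξ) : ∃ C : ℝ, 0 ≤ C ∧ ∀ i, ∀ z ∈ U i, |ξ i z| ≤ C * w z := by
  cases N with
  | zero => exact h
  | succ N => exact h.1

theorem Ord.pred (h : Ord U (N + 1) w ξ) : Ord U N w ξ := by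
  induction N generalizing w ξ with
  | zero => exact h.1
  | succ N ih => exact ⟨h.1, h.2.1, ih h.2.2.1, fun a => ih (h.2.2.2 a)⟩

theorem Ord.congr [hR : Region U N] (h : Ord U N w ξ)
    (H : ∀ i, ∀ z ∈ U i, η i z = ξ i z) : Ord U N w η := by
  induction N generalizing hR w ξ η with
  | zero =>
    obtain ⟨C, hC, hb⟩ := h
    exact ⟨C, hC, fun i z hz => by rw [H i z hz]; exact hb i z hz⟩
  | succ N ih =>
    have := hR.pred
    have ho := hR.open_succ
    obtain ⟨⟨C, hC, hb⟩, hd, h0, h1⟩ := h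
    refine ⟨⟨C, hC, fun i z hz => by rw [H i z hz]; exact hb i z hz⟩, fun i z hz => ?_, ?_, ?_⟩
    · exact (hd i z hz).congr_of_eventuallyEq
        (Filter.eventuallyEq_of_mem ((ho i).mem_nhds hz) (H i))
    · exact ih h0 fun i z hz => pd_congr (ho i) (H i) hz 0
    · exact fun a => ih (h1 a) fun i z hz => pd_congr (ho i) (H i) hz _

/-- An estimate may be weakened by replacing its weight by a larger one: the weights for the
derivatives arise from both by the same power of `r`. -/
theorem Ord.weight [hR : Region U N] (h : Ord U N w ξ) (K : ℝ)
    (hw : ∀ i, ∀ z ∈ U i, w z ≤ K * w' z) (hw' : ∀ i, ∀ z ∈ U i, 0 ≤ w' z) : Ord U N w' ξ := by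
  have key : ∀ {w w' : (Fin (d + 2) → ℝ) → ℝ} {ξ : ι → (Fin (d + 2) → ℝ) → ℝ},
      (∃ C : ℝ, 0 ≤ C ∧ ∀ i, ∀ z ∈ U i, |ξ i z| ≤ C * w z) →
      (∀ i, ∀ z ∈ U i, w z ≤ K * w' z) → (∀ i, ∀ z ∈ U i, 0 ≤ w' z) →
      ∃ C : ℝ, 0 ≤ C ∧ ∀ i, ∀ z ∈ U i, |ξ i z| ≤ C * w' z := by
    rintro w w' ξ ⟨C, hC, hb⟩ hw hw'
    refine ⟨C * |K|, by positivity, fun i z hz => (hb i z hz).trans ?_⟩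
    calc C * w z ≤ C * (K * w' z) := by gcongr; exact hw i z hz
      _ ≤ C * (|K| * w' z) := by
        gcongr
        · exact hw' i z hz
        · exact le_abs_self K
      _ = _ := by ring
  induction N generalizing hR w w' ξ with
  | zero => exact key h hw hw'
  | succ N ih =>
    have := hR.pred
    refine ⟨key h.1 hw hw', h.2.1, ih h.2.2.1 ?_ ?_, fun a => ih (h.2.2.2 a) ?_ ?_⟩
    · intro i z hz
      have := hR.pos i z hz
      calc (z 0)⁻¹ * w z ≤ (z 0)⁻¹ * (K * w' z) := by gcongr; exact hw i z hz
        _ = _ := by ring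
    · intro i z hz
      have := hR.pos i z hz
      have := hw' i z hz
      positivity
    · intro i z hz
      have := hR.pos i z hz
      calc z 0 * w z ≤ z 0 * (K * w' z) := by gcongr; exact hw i z hz
        _ = _ := by ring
    · intro i z hz
      have := hR.pos i z hz
      have := hw' i z hz
      positivity

theorem Ord.weight_eq (h : Ord U N w ξ) (e : ∀ z, w' z = w z) : Ord U N w' ξ := by
  rwa [funext e]

theorem Ord.add [hR : Region U N] (h : Ord U N w ξ) (h' : Ord U N w η) :
    Ord U N w (fun i z => ξ i z + η i z) := by
  have key : ∀ {w : (Fin (d + 2) → ℝ) → ℝ} {ξ η : ι → (Fin (d + 2) → ℝ) → ℝ},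
      (∃ C : ℝ, 0 ≤ C ∧ ∀ i, ∀ z ∈ U i, |ξ i z| ≤ C * w z) →
      (∃ C : ℝ, 0 ≤ C ∧ ∀ i, ∀ z ∈ U i, |η i z| ≤ C * w z) →
      ∃ C : ℝ, 0 ≤ C ∧ ∀ i, ∀ z ∈ U i, |ξ i z + η i z| ≤ C * w z := by
    rintro w ξ η ⟨C, hC, hb⟩ ⟨C', hC', hb'⟩
    refine ⟨C + C', by positivity, fun i z hz => (abs_add_le _ _).trans ?_⟩
    linarith [hb i z hz, hb' i z hz]
  induction N generalizing hR w ξ η with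
  | zero => exact key h h'
  | succ N ih =>
    have := hR.pred
    refine ⟨key h.1 h'.1, fun i z hz => (h.2.1 i z hz).fun_add (h'.2.1 i z hz), ?_, fun a => ?_⟩
    · exact (ih h.2.2.1 h'.2.2.1).congr fun i z hz => pd_add _ (h.2.1 i z hz) (h'.2.1 i z hz)
    · exact (ih (h.2.2.2 a) (h'.2.2.2 a)).congr fun i z hz =>
        pd_add _ (h.2.1 i z hz) (h'.2.1 i z hz)

theorem Ord.mul [hR : Region U N] (h : Ord U N w ξ) (h' : Ord U N w' η) :
    Ord U N (fun z => w z * w' z) (fun i z => ξ i z * η i z) := by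
  have key : ∀ {w w' : (Fin (d + 2) → ℝ) → ℝ} {ξ η : ι → (Fin (d + 2) → ℝ) → ℝ},
      (∃ C : ℝ, 0 ≤ C ∧ ∀ i, ∀ z ∈ U i, |ξ i z| ≤ C * w z) →
      (∃ C : ℝ, 0 ≤ C ∧ ∀ i, ∀ z ∈ U i, |η i z| ≤ C * w' z) →
      ∃ C : ℝ, 0 ≤ C ∧ ∀ i, ∀ z ∈ U i, |ξ i z * η i z| ≤ C * (w z * w' z) := by
    rintro w w' ξ η ⟨C, hC, hb⟩ ⟨C', hC', hb'⟩
    refine ⟨C * C', by positivity, fun i z hz => ?_⟩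
    rw [abs_mul]
    calc |ξ i z| * |η i z| ≤ (C * w z) * (C' * w' z) :=
          mul_le_mul (hb i z hz) (hb' i z hz) (abs_nonneg _) ((abs_nonneg _).trans (hb i z hz))
      _ = _ := by ring
  induction N generalizing hR w w' ξ η with
  | zero => exact key h h'
  | succ N ih =>
    have := hR.pred
    refine ⟨key h.1 h'.1, fun i z hz => (h.2.1 i z hz).fun_mul (h'.2.1 i z hz), ?_, fun a => ?_⟩
    · have e1 := ih h.pred h'.2.2.1
      have e2 := ih h'.pred h.2.2.1
      have e1' := e1.weight_eq (w' := (fun z => (z 0)⁻¹ * (w z * w' z)))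
        fun z => by ring
      have e2' := e2.weight_eq (w' := (fun z => (z 0)⁻¹ * (w z * w' z)))
        fun z => by ring
      exact (e1'.add e2').congr fun i z hz => pd_mul _ (h.2.1 i z hz) (h'.2.1 i z hz)
    · have e1 := ih h.pred (h'.2.2.2 a)
      have e2 := ih h'.pred (h.2.2.2 a)
      have e1' := e1.weight_eq (w' := (fun z => z 0 * (w z * w' z)))
        fun z => by ring
      have e2' := e2.weight_eq (w' := (fun z => z 0 * (w z * w' z)))
        fun z => by ring
      exact (e1'.add e2').congr fun i z hz => pd_mul _ (h.2.1 i z hz) (h'.2.1 i z hz)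

theorem ord_zero [hR : Region U N] (hw : ∀ i, ∀ z ∈ U i, 0 ≤ w z) :
    Ord U N w (fun _ _ => 0) := by
  induction N generalizing hR w with
  | zero => exact ⟨0, le_rfl, fun i z hz => by simp⟩
  | succ N ih =>
    have := hR.pred
    refine ⟨⟨0, le_rfl, fun i z hz => by simp⟩, fun i z hz => differentiableAt_const _,
      (ih ?_).congr fun i z hz => pd_const _ _, fun a => (ih ?_).congr fun i z hz => pd_const _ _⟩
    · intro i z hz
      have := hR.pos i z hz
      have := hw i z hz
      positivity
    · intro i z hz
      have := hR.pos i z hz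
      have := hw i z hz
      positivity

theorem ord_const [hR : Region U N] (c : ℝ) : Ord U N (fun _ => 1) (fun _ _ => c) := by
  cases N with
  | zero => exact ⟨|c|, abs_nonneg _, fun i z hz => by simp⟩
  | succ N =>
    have := hR.pred
    refine ⟨⟨|c|, abs_nonneg _, fun i z hz => by simp⟩, fun i z hz => differentiableAt_const _,
      (ord_zero ?_).congr fun i z hz => pd_const _ _,
      fun a => (ord_zero ?_).congr fun i z hz => pd_const _ _⟩
    · intro i z hz
      have := hR.pos i z hz
      positivity
    · intro i z hz
      have := hR.pos i z hz
      positivity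

theorem Ord.const_mul [hR : Region U N] (h : Ord U N w ξ) (c : ℝ) :
    Ord U N w (fun i z => c * ξ i z) := by
  have := (ord_const (U := U) (N := N) c).mul h
  simpa using this

theorem Ord.neg [hR : Region U N] (h : Ord U N w ξ) : Ord U N w (fun i z => -ξ i z) := by
  simpa using h.const_mul (-1)

theorem Ord.sub [hR : Region U N] (h : Ord U N w ξ) (h' : Ord U N w η) :
    Ord U N w (fun i z => ξ i z - η i z) := by
  simpa [sub_eq_add_neg] using h.add h'.neg

theorem Ord.sum [hR : Region U N] {κ : Type*} (s : Finset κ)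
    {ξ : κ → ι → (Fin (d + 2) → ℝ) → ℝ} (hw : ∀ i, ∀ z ∈ U i, 0 ≤ w z)
    (h : ∀ k ∈ s, Ord U N w (ξ k)) : Ord U N w (fun i z => ∑ k ∈ s, ξ k i z) := by
  classical
  induction s using Finset.induction_on with
  | empty => simpa using ord_zero hw
  | insert a s ha ih =>
    have := (h a (by simp)).add (ih fun k hk => h k (by simp [hk]))
    simpa [Finset.sum_insert ha] using this

theorem Ord.prod [hR : Region U N] {κ : Type*} (s : Finset κ)
    {ξ : κ → ι → (Fin (d + 2) → ℝ) → ℝ}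
    (h : ∀ k ∈ s, Ord U N (fun _ => 1) (ξ k)) :
    Ord U N (fun _ => 1) (fun i z => ∏ k ∈ s, ξ k i z) := by
  classical
  induction s using Finset.induction_on with
  | empty => simpa using ord_const (U := U) (N := N) 1
  | insert a s ha ih =>
    have := (h a (by simp)).mul (ih fun k hk => h k (by simp [hk]))
    simpa [Finset.prod_insert ha] using this

/-- Estimates pass to smaller sets and to reindexed families. -/
theorem Ord.comap {κ : Type*} {V : κ → Set (Fin (d + 2) → ℝ)} (h : Ord U N w ξ) (c : κ → ι)
    (hV : ∀ k, V k ⊆ U (c k)) : Ord V N w (fun k => ξ (c k)) := by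
  have key : ∀ {w : (Fin (d + 2) → ℝ) → ℝ} {ξ : ι → (Fin (d + 2) → ℝ) → ℝ},
      (∃ C : ℝ, 0 ≤ C ∧ ∀ i, ∀ z ∈ U i, |ξ i z| ≤ C * w z) →
      ∃ C : ℝ, 0 ≤ C ∧ ∀ i, ∀ z ∈ V i, |ξ (c i) z| ≤ C * w z := by
    rintro w ξ ⟨C, hC, hb⟩
    exact ⟨C, hC, fun i z hz => hb _ z (hV i hz)⟩
  induction N generalizing w ξ with
  | zero => exact key h
  | succ N ih =>
    exact ⟨key h.1, fun i z hz => h.2.1 _ z (hV i hz), ih h.2.2.1, fun a => ih (h.2.2.2 a)⟩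

theorem Ord.pd_zero (h : Ord U (N + 1) w ξ) :
    Ord U N (fun z => (z 0)⁻¹ * w z) (fun i => pd 0 (ξ i)) := h.2.2.1

theorem Ord.pd_succ (h : Ord U (N + 1) w ξ) (a : Fin (d + 1)) :
    Ord U N (fun z => z 0 * w z) (fun i => pd a.succ (ξ i)) := h.2.2.2 a

/-- The inverse of a family bounded away from zero: the derivative of `ξ⁻¹` is `-ξ⁻² ∂ξ`. -/
theorem Ord.inv [hR : Region U N] (h : Ord U N (fun _ => 1) ξ) {c : ℝ} (hc : 0 < c)
    (hξ : ∀ i, ∀ z ∈ U i, c ≤ |ξ i z|) : Ord U N (fun _ => 1) (fun i z => (ξ i z)⁻¹) := by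
  have key : ∃ C : ℝ, 0 ≤ C ∧ ∀ i, ∀ z ∈ U i, |(ξ i z)⁻¹| ≤ C * 1 := by
    refine ⟨c⁻¹, by positivity, fun i z hz => ?_⟩
    rw [abs_inv, mul_one]
    exact inv_anti₀ hc (hξ i z hz)
  induction N generalizing hR with
  | zero => exact key
  | succ N ih =>
    have := hR.pred
    have hi := ih h.pred
    have hne : ∀ i, ∀ z ∈ U i, ξ i z ≠ 0 := fun i z hz h0 => by
      have := hξ i z hz
      simp [h0] at this; linarith
    have hpd : ∀ j, ∀ i, ∀ z ∈ U i, pd j (fun x => (ξ i x)⁻¹) z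
        = -((ξ i z)⁻¹ * (ξ i z)⁻¹ * pd j (ξ i) z) := by
      intro j i z hz
      rw [pd_comp (φ := fun t => t⁻¹) j (hasDerivAt_inv (hne i z hz)) (h.2.1 i z hz)]
      rw [sq, mul_inv]; ring
    refine ⟨key, fun i z hz => (h.2.1 i z hz).fun_inv (hne i z hz), ?_, fun a => ?_⟩
    · have := ((hi.mul hi).mul h.pd_zero).neg.congr (hpd 0)
      simpa using this
    · have := ((hi.mul hi).mul (h.pd_succ a)).neg.congr (hpd a.succ)
      simpa using this

/-- The inverse square root of a family `n ≥ 1/2`: the derivative of `n ^ (-1/2)` is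
`-(1/2) (n ^ (-1/2))³ ∂n`. -/
theorem Ord.inv_sqrt [hR : Region U N] {n : ι → (Fin (d + 2) → ℝ) → ℝ}
    (h : Ord U N (fun _ => 1) n) (hn : ∀ i, ∀ z ∈ U i, 1 / 2 ≤ n i z) :
    Ord U N (fun _ => 1) (fun i z => (Real.sqrt (n i z))⁻¹) ∧ ∀ j, ∀ i, ∀ z ∈ U i, 0 < N →
      pd j (fun x => (Real.sqrt (n i x))⁻¹) z = -(1 / 2) * ((Real.sqrt (n i z))⁻¹ *
        (Real.sqrt (n i z))⁻¹ * (Real.sqrt (n i z))⁻¹ * pd j (n i) z) := by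
  have key : ∃ C : ℝ, 0 ≤ C ∧ ∀ i, ∀ z ∈ U i, |(Real.sqrt (n i z))⁻¹| ≤ C * 1 := by
    refine ⟨(Real.sqrt (1 / 2))⁻¹, by positivity, fun i z hz => ?_⟩
    rw [abs_inv, mul_one, abs_of_nonneg (Real.sqrt_nonneg _)]
    exact inv_anti₀ (by positivity) (Real.sqrt_le_sqrt (hn i z hz))
  induction N generalizing hR with
  | zero => exact ⟨key, by simp⟩
  | succ N ih =>
    have := hR.pred
    have hi := (ih h.pred).1
    have hpos : ∀ i, ∀ z ∈ U i, 0 < n i z := fun i z hz => by linarith [hn i z hz]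
    have hd : ∀ i, ∀ z ∈ U i, HasDerivAt (fun t => (Real.sqrt t)⁻¹)
        (-(1 / (2 * Real.sqrt (n i z))) / Real.sqrt (n i z) ^ 2) (n i z) := fun i z hz =>
      (Real.hasDerivAt_sqrt (hpos i z hz).ne').fun_inv (Real.sqrt_pos.2 (hpos i z hz)).ne'
    have hpd : ∀ j, ∀ i, ∀ z ∈ U i, pd j (fun x => (Real.sqrt (n i x))⁻¹) z = -(1 / 2) *
        ((Real.sqrt (n i z))⁻¹ * (Real.sqrt (n i z))⁻¹ * (Real.sqrt (n i z))⁻¹ *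
          pd j (n i) z) := by
      intro j i z hz
      rw [pd_comp (φ := fun t => (Real.sqrt t)⁻¹) j (hd i z hz) (h.2.1 i z hz)]
      have := (Real.sqrt_pos.2 (hpos i z hz)).ne'
      field_simp
    refine ⟨⟨key, fun i z hz => ?_, ?_, fun a => ?_⟩, fun j i z hz _ => hpd j i z hz⟩
    · exact ((hd i z hz).comp_hasFDerivAt z (h.2.1 i z hz).hasFDerivAt).differentiableAt
    · have := ((((hi.mul hi).mul hi).mul h.pd_zero).const_mul (-(1 / 2))).congr (hpd 0)
      simpa using this
    · have := ((((hi.mul hi).mul hi).mul (h.pd_succ a)).const_mul (-(1 / 2))).congr (hpd a.succ)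
      simpa using this

/-- If `n - 1` has weight `w` then so has `n ^ (-1/2) - 1`. -/
theorem Ord.inv_sqrt_sub_one [hR : Region U N] {n : ι → (Fin (d + 2) → ℝ) → ℝ}
    (h1 : Ord U N (fun _ => 1) n) (h : Ord U N w (fun i z => n i z - 1))
    (hn : ∀ i, ∀ z ∈ U i, 1 / 2 ≤ n i z) :
    Ord U N w (fun i z => (Real.sqrt (n i z))⁻¹ - 1) := by
  have key : ∀ N, Ord U N w (fun i z => n i z - 1) →
      ∃ C : ℝ, 0 ≤ C ∧ ∀ i, ∀ z ∈ U i, |(Real.sqrt (n i z))⁻¹ - 1| ≤ C * w z := by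
    intro N h
    obtain ⟨C, hC, hb⟩ := h.bound
    refine ⟨2 * C, by positivity, fun i z hz => ?_⟩
    have h2 := hn i z hz
    have hpos : 0 < n i z := by linarith
    set s := Real.sqrt (n i z) with hs
    have hs0 : 0 < s := Real.sqrt_pos.2 hpos
    have hss : s * s = n i z := Real.mul_self_sqrt hpos.le
    have e : s⁻¹ - 1 = -(n i z - 1) * (s * (1 + s))⁻¹ := by
      rw [← hss]; field_simp; ring
    have hle : (s * (1 + s))⁻¹ ≤ 2 := by
      rw [inv_le_comm₀ (by positivity) (by norm_num)]
      nlinarith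
    rw [e, abs_mul, abs_neg, abs_of_nonneg (a := (s * (1 + s))⁻¹) (by positivity)]
    have := hb i z hz
    nlinarith [abs_nonneg (n i z - 1)]
  cases N with
  | zero => exact key 0 h
  | succ N =>
    have := hR.pred
    have ho := hR.open_succ
    obtain ⟨hs, hpd⟩ := h1.inv_sqrt hn
    have hpd' : ∀ j, ∀ i, ∀ z ∈ U i, pd j (fun x => (Real.sqrt (n i x))⁻¹ - 1) z = -(1 / 2) *
        ((Real.sqrt (n i z))⁻¹ * (Real.sqrt (n i z))⁻¹ * (Real.sqrt (n i z))⁻¹ *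
          pd j (fun x => n i x - 1) z) := by
      intro j i z hz
      rw [pd_sub j (hs.2.1 i z hz) (differentiableAt_const _), hpd j i z hz (by simp),
        pd_sub j (h1.2.1 i z hz) (differentiableAt_const _), pd_const]
      simp
    have hi := hs.pred
    refine ⟨key _ h, fun i z hz => (hs.2.1 i z hz).sub_const _, ?_, fun a => ?_⟩
    · have := ((((hi.mul hi).mul hi).mul h.pd_zero).const_mul (-(1 / 2))).congr (hpd' 0)
      simpa using this
    · have := ((((hi.mul hi).mul hi).mul (h.pd_succ a)).const_mul (-(1 / 2))).congr (hpd' a.succ)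
      simpa using this

/-! ### Comparison with `IsO` -/

theorem IsO.pd_zero {C : ℕ → ℕ → ℝ} {V : Set (Fin (d + 2) → ℝ)} {χ : (Fin (d + 2) → ℝ) → ℝ}
    (hV : IsOpen V) (hpos : ∀ z ∈ V, 0 < z 0) (h : IsO C V w χ) :
    IsO (fun k m => C (k + 1) m) V (fun z => (z 0)⁻¹ * w z) (pd 0 χ) := by
  refine ⟨contDiffOn_pd hV h.1 0, fun k l z hz => ?_⟩
  have h0 := hpos z hz
  have e : pds (List.replicate k 0 ++ l.map Fin.succ) (pd 0 χ) z
      = pds (List.replicate (k + 1) 0 ++ l.map Fin.succ) χ z := by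
    rw [pds_pd_comm hV h.1 0 _ hz, List.replicate_succ]
    rfl
  rw [e]
  refine (h.2 (k + 1) l z hz).trans (le_of_eq ?_)
  have : ((l.length : ℤ) - ((k + 1 : ℕ) : ℤ)) = ((l.length : ℤ) - (k : ℤ)) + (-1) := by
    push_cast; ring
  rw [this, zpow_add₀ h0.ne', zpow_neg_one]; ring

theorem IsO.pd_succ {C : ℕ → ℕ → ℝ} {V : Set (Fin (d + 2) → ℝ)} {χ : (Fin (d + 2) → ℝ) → ℝ}
    (hV : IsOpen V) (hpos : ∀ z ∈ V, 0 < z 0) (h : IsO C V w χ) (a : Fin (d + 1)) :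
    IsO (fun k m => C k (m + 1)) V (fun z => z 0 * w z) (pd a.succ χ) := by
  refine ⟨contDiffOn_pd hV h.1 _, fun k l z hz => ?_⟩
  have h0 := hpos z hz
  have e : pds (List.replicate k 0 ++ l.map Fin.succ) (pd a.succ χ) z
      = pds (List.replicate k 0 ++ (l ++ [a]).map Fin.succ) χ z := by
    rw [List.map_append, ← List.append_assoc, pds_append (l' := [a].map Fin.succ)]
    rfl
  rw [e]
  refine (h.2 k (l ++ [a]) z hz).trans (le_of_eq ?_)
  have : (((l ++ [a]).length : ℤ) - (k : ℤ)) = ((l.length : ℤ) - (k : ℤ)) + 1 := by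
    simp; ring
  rw [this, zpow_add₀ h0.ne', zpow_one]
  simp; ring

/-- Families satisfying `IsO` with the same constants satisfy the estimates of every order. -/
theorem ord_of_isO {C : ℕ → ℕ → ℝ} (hU : ∀ i, IsOpen (U i)) (hpos : ∀ i, ∀ z ∈ U i, 0 < z 0)
    (hw : ∀ i, ∀ z ∈ U i, 0 ≤ w z) (h : ∀ i, IsO C (U i) w (ξ i)) (N : ℕ) : Ord U N w ξ := by
  have key : ∀ {C : ℕ → ℕ → ℝ} {w : (Fin (d + 2) → ℝ) → ℝ} {ξ : ι → (Fin (d + 2) → ℝ) → ℝ},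
      (∀ i, ∀ z ∈ U i, 0 ≤ w z) → (∀ i, IsO C (U i) w (ξ i)) →
      ∃ C : ℝ, 0 ≤ C ∧ ∀ i, ∀ z ∈ U i, |ξ i z| ≤ C * w z := by
    intro C w ξ hw h
    refine ⟨|C 0 0|, abs_nonneg _, fun i z hz => ?_⟩
    have := (h i).2 0 [] z hz
    simp [pds] at this
    exact this.trans (mul_le_mul_of_nonneg_right (le_abs_self _) (hw i z hz))
  induction N generalizing C w ξ with
  | zero => exact key hw h
  | succ N ih =>
    refine ⟨key hw h, fun i z hz => ?_,
      ih ?_ fun i => (h i).pd_zero (hU i) (hpos i), fun a =>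
      ih ?_ fun i => (h i).pd_succ (hU i) (hpos i) a⟩
    · exact ((h i).1.contDiffAt ((hU i).mem_nhds hz)).differentiableAt (by simp)
    · intro i z hz
      have := hpos i z hz
      have := hw i z hz
      positivity
    · intro i z hz
      have := hpos i z hz
      have := hw i z hz
      positivity

theorem contDiffOn_of_ord (hU : ∀ i, IsOpen (U i)) (i : ι) (n : ℕ) :
    ∀ {w : (Fin (d + 2) → ℝ) → ℝ} {ξ : ι → (Fin (d + 2) → ℝ) → ℝ}, Ord U (n + 1) w ξ →
      ContDiffOn ℝ n (ξ i) (U i) := by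
  induction n with
  | zero =>
    intro w ξ h
    have : ContinuousOn (ξ i) (U i) :=
      fun z hz => (h.2.1 i z hz).continuousAt.continuousWithinAt
    simpa using this
  | succ n ih =>
    intro w ξ h
    rw [Nat.cast_succ, contDiffOn_succ_iff_fderiv_of_isOpen (hU i)]
    refine ⟨fun z hz => (h.2.1 i z hz).differentiableWithinAt, by simp, ?_⟩
    have hj : ∀ j : Fin (d + 2), ContDiffOn ℝ n (pd j (ξ i)) (U i) := by
      intro j
      refine Fin.cases ?_ (fun a => ?_) j
      · exact ih h.pd_zero
      · exact ih (h.pd_succ a)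
    have e : fderiv ℝ (ξ i) = fun z => ∑ j, pd j (ξ i) z •
        ContinuousLinearMap.proj (R := ℝ) (φ := fun _ : Fin (d + 2) => ℝ) j := by
      funext z
      ext v
      conv_lhs => rw [← Finset.univ_sum_single v, map_sum]
      simp only [_root_.sum_apply, _root_.smul_apply,
        ContinuousLinearMap.proj_apply, pd, smul_eq_mul]
      refine Finset.sum_congr rfl fun j _ => ?_
      have : (Pi.single j (v j) : Fin (d + 2) → ℝ) = v j • Pi.single j (1 : ℝ) := by
        rw [← Pi.single_smul]; simp
      rw [this, map_smul, smul_eq_mul, mul_comm]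
    rw [e]
    exact ContDiffOn.sum fun j _ => (hj j).smul contDiffOn_const

/-- Families satisfying the estimates of every order satisfy `IsO` with common constants. -/
theorem exists_isO_of_ord (hU : ∀ i, IsOpen (U i)) (hpos : ∀ i, ∀ z ∈ U i, 0 < z 0)
    (hw : ∀ i, ∀ z ∈ U i, 0 ≤ w z) (h : ∀ N, Ord U N w ξ) :
    ∃ C : ℕ → ℕ → ℝ, ∀ i, IsO C (U i) w (ξ i) := by
  have hlist : ∀ (l : List (Fin (d + 1))) (N : ℕ),
      Ord U N (fun z => (z 0) ^ (l.length : ℤ) * w z) (fun i => pds (l.map Fin.succ) (ξ i)) := by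
    intro l
    induction l with
    | nil => intro N; simpa [pds] using h N
    | cons a l ih =>
      intro N
      have : Region U N := ⟨Or.inr hU, hpos⟩
      refine ((ih (N + 1)).pd_succ a).weight 1 (fun i z hz => ?_) (fun i z hz => ?_)
      · have h0 := hpos i z hz
        rw [List.length_cons, Nat.cast_succ, zpow_add₀ h0.ne', zpow_one]
        exact le_of_eq (by ring)
      · have h0 := hpos i z hz
        have := hw i z hz
        positivity
  have hall : ∀ (l : List (Fin (d + 1))) (k N : ℕ),
      Ord U N (fun z => (z 0) ^ ((l.length : ℤ) - (k : ℤ)) * w z)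
        (fun i => pds (List.replicate k 0 ++ l.map Fin.succ) (ξ i)) := by
    intro l k
    induction k with
    | zero => intro N; simpa using hlist l N
    | succ k ih =>
      intro N
      have : Region U N := ⟨Or.inr hU, hpos⟩
      refine ((ih (N + 1)).pd_zero).weight 1 (fun i z hz => ?_) (fun i z hz => ?_)
      · have h0 := hpos i z hz
        have : ((l.length : ℤ) - ((k + 1 : ℕ) : ℤ)) = ((l.length : ℤ) - (k : ℤ)) + (-1) := by
          push_cast; ring
        rw [this, zpow_add₀ h0.ne', zpow_neg_one]
        exact le_of_eq (by ring)
      · have h0 := hpos i z hz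
        have := hw i z hz
        positivity
  choose c hc0 hc using fun (l : List (Fin (d + 1))) (k : ℕ) => hall l k 0
  have hfin : ∀ m : ℕ, {l : List (Fin (d + 1)) | l.length = m}.Finite :=
    fun m => List.finite_length_eq _ m
  refine ⟨fun k m => ∑ l ∈ (hfin m).toFinset, c l k, fun i => ⟨?_, fun k l z hz => ?_⟩⟩
  · rw [contDiffOn_infty]
    exact fun n => contDiffOn_of_ord hU i n (h (n + 1))
  · have h0 := hpos i z hz
    have h1 := hw i z hz
    have hle : c l k ≤ ∑ l' ∈ (hfin l.length).toFinset, c l' k :=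
      Finset.single_le_sum (f := fun l' => c l' k) (fun l' _ => hc0 l' k) (by simp)
    refine (hc l k i z hz).trans ?_
    rw [← mul_assoc]
    gcongr

end Ord


/-! ### Weights `ρ ^ a f ^ b` -/

section Weights

variable {d : ℕ} {ι : Type*} {y : ℝ}

/-- The function `f = ρ / sin (y t)` in coordinates `(r, t, x)`. -/
def fC (y : ℝ) (z : Fin (d + 2) → ℝ) : ℝ := (z 0)⁻¹ / Real.sin (y * z 1)

/-- The weight `ρ ^ a f ^ b`. -/
def mono (y : ℝ) (a b : ℤ) (z : Fin (d + 2) → ℝ) : ℝ := (z 0)⁻¹ ^ a * fC y z ^ b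

/-- Estimates with weight `ρ ^ a f ^ b`. -/
abbrev O (y : ℝ) (U : ι → Set (Fin (d + 2) → ℝ)) (N : ℕ) (a b : ℤ)
    (ξ : ι → (Fin (d + 2) → ℝ) → ℝ) : Prop := Ord U N (mono y a b) ξ

/-- The sets `U i` lie in the region `{0 < ρ, 0 < sin (y t), f < 1}`, on which `ρ ≤ f < 1`. -/
class Inside (y : ℝ) (U : ι → Set (Fin (d + 2) → ℝ)) : Prop where
  pos : ∀ i, ∀ z ∈ U i, 0 < z 0
  sin_pos : ∀ i, ∀ z ∈ U i, 0 < Real.sin (y * z 1)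
  lt_one : ∀ i, ∀ z ∈ U i, fC y z < 1

theorem inv_le_fC {z : Fin (d + 2) → ℝ} (h0 : 0 < z 0) (h1 : 0 < Real.sin (y * z 1)) :
    (z 0)⁻¹ ≤ fC y z := by
  rw [fC, le_div_iff₀ h1]
  have : 0 < (z 0)⁻¹ := by positivity
  nlinarith [Real.sin_le_one (y * z 1)]

theorem fC_pos {z : Fin (d + 2) → ℝ} (h0 : 0 < z 0) (h1 : 0 < Real.sin (y * z 1)) :
    0 < fC y z := by
  rw [fC]; positivity

variable {U : ι → Set (Fin (d + 2) → ℝ)} {N : ℕ} {a b a' b' : ℤ}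
  {ξ η : ι → (Fin (d + 2) → ℝ) → ℝ}

theorem mono_pos [hI : Inside y U] (a b : ℤ) {i : ι} {z : Fin (d + 2) → ℝ} (hz : z ∈ U i) :
    0 < mono y a b z := by
  have h0 := hI.pos i z hz
  have := fC_pos h0 (hI.sin_pos i z hz)
  rw [mono]; positivity

/-- As `ρ ≤ f < 1`, a weight becomes larger when powers of `ρ` are replaced by powers of `f`, and
when its total degree is lowered. -/
theorem mono_le_mono [hI : Inside y U] (h1 : a' ≤ a) (h2 : a' + b' ≤ a + b) {i : ι}
    {z : Fin (d + 2) → ℝ} (hz : z ∈ U i) : mono y a b z ≤ mono y a' b' z := by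
  have h0 := hI.pos i z hz
  have hs := hI.sin_pos i z hz
  have hlt := hI.lt_one i z hz
  have hρ : 0 < (z 0)⁻¹ := by positivity
  have hf := fC_pos h0 hs
  have hle := inv_le_fC h0 hs
  simp only [mono]
  generalize (z 0)⁻¹ = ρ at *
  generalize fC y z = f at *
  obtain ⟨n, hn⟩ := Int.eq_ofNat_of_zero_le (sub_nonneg.2 h1)
  obtain ⟨k, hk⟩ := Int.eq_ofNat_of_zero_le (sub_nonneg.2 h2)
  have ea : a = a' + n := by omega
  have eb : b = b' + (k - n : ℤ) := by omega
  rw [ea, eb, zpow_add₀ hρ.ne', zpow_add₀ hf.ne', zpow_sub₀ hf.ne', zpow_natCast, zpow_natCast,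
    zpow_natCast]
  have e1 : ρ ^ n ≤ f ^ n := by gcongr
  have e2 : f ^ k ≤ 1 := pow_le_one₀ hf.le hlt.le
  have e3 : ρ ^ n * (f ^ k / f ^ n) ≤ 1 := by
    rw [mul_div_assoc', div_le_one (by positivity)]
    calc ρ ^ n * f ^ k ≤ f ^ n * 1 := by gcongr
      _ = _ := mul_one _
  calc ρ ^ a' * ρ ^ n * (f ^ b' * (f ^ k / f ^ n))
      = ρ ^ a' * f ^ b' * (ρ ^ n * (f ^ k / f ^ n)) := by ring
    _ ≤ ρ ^ a' * f ^ b' * 1 := by gcongr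
    _ = _ := mul_one _

theorem Ord.mono' [Region U N] [hI : Inside y U] (h : O y U N a b ξ) (h1 : a' ≤ a)
    (h2 : a' + b' ≤ a + b) : O y U N a' b' ξ :=
  h.weight 1 (fun _ _ hz => by rw [one_mul]; exact mono_le_mono h1 h2 hz)
    fun _ _ hz => (mono_pos a' b' hz).le

theorem Ord.mulO [Region U N] [hI : Inside y U] (h : O y U N a b ξ) (h' : O y U N a' b' η) :
    O y U N (a + a') (b + b') (fun i z => ξ i z * η i z) := by
  refine (h.mul h').weight 1 (fun i z hz => ?_) fun _ _ hz => (mono_pos _ _ hz).le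
  have h0 := hI.pos i z hz
  have hf := fC_pos h0 (hI.sin_pos i z hz)
  simp only [mono, one_mul]
  rw [zpow_add₀ (by positivity), zpow_add₀ hf.ne']
  exact le_of_eq (by ring)

theorem Ord.pd0 [hI : Inside y U] (hR : Region U N) (h : O y U (N + 1) a b ξ) :
    O y U N (a + 1) b (fun i => pd 0 (ξ i)) := by
  refine h.pd_zero.weight 1 (fun i z hz => ?_) fun _ _ hz => (mono_pos _ _ hz).le
  have h0 := hI.pos i z hz
  simp only [mono, one_mul]
  rw [zpow_add₀ (by positivity), zpow_one]
  exact le_of_eq (by ring)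

theorem Ord.pdS [hI : Inside y U] (hR : Region U N) (h : O y U (N + 1) a b ξ) (j : Fin (d + 1)) :
    O y U N (a - 1) b (fun i => pd j.succ (ξ i)) := by
  refine (h.pd_succ j).weight 1 (fun i z hz => ?_) fun _ _ hz => (mono_pos _ _ hz).le
  have h0 := hI.pos i z hz
  simp only [mono, one_mul]
  rw [zpow_sub₀ (by positivity), zpow_one]
  exact le_of_eq (by field_simp)

theorem Ord.sumO [Region U N] [hI : Inside y U] {κ : Type*} {s : Finset κ}
    {ξ : κ → ι → (Fin (d + 2) → ℝ) → ℝ} (h : ∀ k ∈ s, O y U N a b (ξ k)) :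
    O y U N a b (fun i z => ∑ k ∈ s, ξ k i z) :=
  Ord.sum s (fun _ _ hz => (mono_pos a b hz).le) h

theorem O_zero [Region U N] [hI : Inside y U] (a b : ℤ) : O y U N a b (fun _ _ => 0) :=
  ord_zero fun _ _ hz => (mono_pos a b hz).le

theorem mono_zero_zero : mono (d := d) y 0 0 = fun _ => 1 := by
  funext z; simp [mono]

theorem O_const [Region U N] (c : ℝ) : O y U N 0 0 (fun _ _ => c) := by
  rw [O, mono_zero_zero]
  exact ord_const c

/-- Assembles an estimate of order `N + 1` from one for the function and ones for its
derivatives. -/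
theorem O_succ [hI : Inside y U] (hR : Region U N) (hb : O y U 0 a b ξ)
    (hd : ∀ i, ∀ z ∈ U i, DifferentiableAt ℝ (ξ i) z)
    (h0 : O y U N (a + 1) b (fun i => pd 0 (ξ i)))
    (hS : ∀ j : Fin (d + 1), O y U N (a - 1) b (fun i => pd j.succ (ξ i))) :
    O y U (N + 1) a b ξ := by
  refine ⟨hb, hd, h0.weight 1 (fun i z hz => ?_) (fun i z hz => ?_), fun j =>
    (hS j).weight 1 (fun i z hz => ?_) (fun i z hz => ?_)⟩
  · have h0 := hI.pos i z hz
    simp only [mono, one_mul]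
    rw [zpow_add₀ (by positivity), zpow_one]
    exact le_of_eq (by ring)
  · have := hI.pos i z hz
    have := mono_pos (y := y) a b hz
    positivity
  · have h0 := hI.pos i z hz
    simp only [mono, one_mul]
    rw [zpow_sub₀ (by positivity), zpow_one]
    exact le_of_eq (by field_simp)
  · have := hI.pos i z hz
    have := mono_pos (y := y) a b hz
    positivity

/-! ### The functions `r`, `ρ`, `sin`, `cos`, `f` -/

theorem differentiableAt_coord (j : Fin (d + 2)) (z : Fin (d + 2) → ℝ) :
    DifferentiableAt ℝ (fun x : Fin (d + 2) → ℝ => x j) z :=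
  (ContinuousLinearMap.proj (R := ℝ) (φ := fun _ : Fin (d + 2) => ℝ) j).differentiableAt

theorem pd_inv_coord {z : Fin (d + 2) → ℝ} (h0 : 0 < z 0) (j : Fin (d + 2)) :
    pd j (fun x => (x 0)⁻¹) z = -((z 0)⁻¹ * (z 0)⁻¹) * if 0 = j then 1 else 0 := by
  rw [pd_comp (φ := fun t => t⁻¹) j (hasDerivAt_inv h0.ne') (differentiableAt_coord 0 z), pd_coord]
  rw [sq, mul_inv]

theorem hasDerivAt_sin_mul (y t : ℝ) :
    HasDerivAt (fun t => Real.sin (y * t)) (y * Real.cos (y * t)) t := by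
  have := ((hasDerivAt_id t).const_mul y).sin
  simpa [mul_comm] using this

theorem hasDerivAt_cos_mul (y t : ℝ) :
    HasDerivAt (fun t => Real.cos (y * t)) (-(y * Real.sin (y * t))) t := by
  have := ((hasDerivAt_id t).const_mul y).cos
  simpa [mul_comm] using this

theorem pd_sin (z : Fin (d + 2) → ℝ) (j : Fin (d + 2)) :
    pd j (fun x => Real.sin (y * x 1)) z = y * Real.cos (y * z 1) * if 1 = j then 1 else 0 := by
  rw [pd_comp (φ := fun t => Real.sin (y * t)) j (hasDerivAt_sin_mul y (z 1))
    (differentiableAt_coord 1 z), pd_coord]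

theorem pd_cos (z : Fin (d + 2) → ℝ) (j : Fin (d + 2)) :
    pd j (fun x => Real.cos (y * x 1)) z
      = -(y * Real.sin (y * z 1)) * if 1 = j then 1 else 0 := by
  rw [pd_comp (φ := fun t => Real.cos (y * t)) j (hasDerivAt_cos_mul y (z 1))
    (differentiableAt_coord 1 z), pd_coord]

theorem differentiableAt_sin (z : Fin (d + 2) → ℝ) :
    DifferentiableAt ℝ (fun x : Fin (d + 2) → ℝ => Real.sin (y * x 1)) z :=
  ((differentiableAt_coord 1 z).const_mul y).sin

theorem differentiableAt_cos (z : Fin (d + 2) → ℝ) :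
    DifferentiableAt ℝ (fun x : Fin (d + 2) → ℝ => Real.cos (y * x 1)) z :=
  ((differentiableAt_coord 1 z).const_mul y).cos

theorem differentiableAt_inv_coord {z : Fin (d + 2) → ℝ} (h0 : 0 < z 0) :
    DifferentiableAt ℝ (fun x : Fin (d + 2) → ℝ => (x 0)⁻¹) z :=
  (differentiableAt_coord 0 z).fun_inv h0.ne'

theorem differentiableAt_fC {z : Fin (d + 2) → ℝ} (h0 : 0 < z 0) (h1 : 0 < Real.sin (y * z 1)) :
    DifferentiableAt ℝ (fC y) z := by
  have e : fC (d := d) y = fun x => (x 0)⁻¹ * (Real.sin (y * x 1))⁻¹ := by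
    funext x; rw [fC, div_eq_mul_inv]
  rw [e]
  exact (differentiableAt_inv_coord h0).fun_mul ((differentiableAt_sin z).fun_inv h1.ne')

theorem pd_fC {z : Fin (d + 2) → ℝ} (h0 : 0 < z 0) (h1 : 0 < Real.sin (y * z 1))
    (j : Fin (d + 2)) : pd j (fC y) z = -((z 0)⁻¹ * fC y z) * (if 0 = j then 1 else 0)
      - y * Real.cos (y * z 1) * (fC y z * fC y z) * z 0 * (if 1 = j then 1 else 0) := by
  have hinv : DifferentiableAt ℝ (fun x : Fin (d + 2) → ℝ => (Real.sin (y * x 1))⁻¹) z :=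
    (differentiableAt_sin z).fun_inv h1.ne'
  have e : fC (d := d) y = fun x => (x 0)⁻¹ * (Real.sin (y * x 1))⁻¹ := by
    funext x; rw [fC, div_eq_mul_inv]
  rw [e, pd_mul j (differentiableAt_inv_coord h0) hinv, pd_inv_coord h0,
    pd_comp (φ := fun t => t⁻¹) j (hasDerivAt_inv h1.ne') (differentiableAt_sin z), pd_sin]
  field_simp
  ring

/-- The region in which `f` is smooth and positive. -/
def region (d : ℕ) (y : ℝ) : Set (Fin (d + 2) → ℝ) := {z | 0 < z 0 ∧ 0 < Real.sin (y * z 1)}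

theorem isOpen_region : IsOpen (region d y) :=
  (isOpen_lt (f := fun _ : Fin (d + 2) → ℝ => (0 : ℝ)) continuous_const
    (continuous_apply 0)).inter (isOpen_lt (f := fun _ : Fin (d + 2) → ℝ => (0 : ℝ))
    (g := fun z => Real.sin (y * z 1)) continuous_const (by fun_prop))

theorem pd_fC_zero {z : Fin (d + 2) → ℝ} (hz : z ∈ region d y) :
    pd 0 (fC y) z = -((z 0)⁻¹ * fC y z) := by
  simp [pd_fC hz.1 hz.2]

theorem pd_fC_succ {z : Fin (d + 2) → ℝ} (hz : z ∈ region d y) (a : Fin (d + 1)) :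
    pd a.succ (fC y) z
      = -(y * Real.cos (y * z 1) * (fC y z * fC y z) * z 0) * Segment.dtI a := by
  rw [pd_fC hz.1 hz.2]
  refine Fin.cases ?_ (fun a => ?_) a
  · simp [Segment.dtI]
  · have : (1 : Fin (d + 2)) ≠ a.succ.succ := by
      intro h
      have := congrArg Fin.val h
      simp at this
    simp [Segment.dtI, this, (Fin.succ_ne_zero _).symm]

theorem pd_pd_fC_zero_zero {z : Fin (d + 2) → ℝ} (hz : z ∈ region d y) :
    pd 0 (pd 0 (fC y)) z = 2 * (z 0)⁻¹ ^ 2 * fC y z := by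
  have hf := differentiableAt_fC hz.1 hz.2
  have hi := differentiableAt_inv_coord hz.1
  have e : EqOn (pd 0 (fC y)) (fun x => (-1) * ((x 0)⁻¹ * fC y x)) (region d y) :=
    fun x hx => by rw [pd_fC_zero hx]; ring
  rw [pd_congr isOpen_region e hz, pd_mul _ (differentiableAt_const _) (hi.fun_mul hf),
    pd_const, pd_mul _ hi hf, pd_fC_zero hz, pd_inv_coord hz.1]
  simp; ring

theorem pd_pd_fC_succ_zero {z : Fin (d + 2) → ℝ} (hz : z ∈ region d y) (a : Fin (d + 1)) :
    pd a.succ (pd 0 (fC y)) z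
      = y * Real.cos (y * z 1) * fC y z ^ 2 * Segment.dtI a := by
  have hf := differentiableAt_fC hz.1 hz.2
  have hi := differentiableAt_inv_coord hz.1
  have h0 := hz.1
  have e : EqOn (pd 0 (fC y)) (fun x => (-1) * ((x 0)⁻¹ * fC y x)) (region d y) :=
    fun x hx => by rw [pd_fC_zero hx]; ring
  rw [pd_congr isOpen_region e hz, pd_mul _ (differentiableAt_const _) (hi.fun_mul hf),
    pd_const, pd_mul _ hi hf, pd_fC_succ hz, pd_inv_coord hz.1]
  rw [if_neg (Fin.succ_ne_zero _).symm]
  field_simp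
  ring

theorem pd_pd_fC_zero_succ {z : Fin (d + 2) → ℝ} (hz : z ∈ region d y) (a : Fin (d + 1)) :
    pd 0 (pd a.succ (fC y)) z
      = y * Real.cos (y * z 1) * fC y z ^ 2 * Segment.dtI a := by
  have hf := differentiableAt_fC hz.1 hz.2
  have hc := differentiableAt_cos (y := y) z
  have hr := differentiableAt_coord 0 z
  have h0 := hz.1
  have e : EqOn (pd a.succ (fC y)) (fun x => (-(y * Segment.dtI a)) *
      (Real.cos (y * x 1) * ((fC y x * fC y x) * x 0))) (region d y) :=
    fun x hx => by rw [pd_fC_succ hx]; ring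
  rw [pd_congr isOpen_region e hz, pd_mul _ (differentiableAt_const _)
    (hc.fun_mul ((hf.fun_mul hf).fun_mul hr)), pd_const, pd_mul _ hc ((hf.fun_mul hf).fun_mul hr),
    pd_mul _ (hf.fun_mul hf) hr, pd_mul _ hf hf, pd_fC_zero hz, pd_cos, pd_coord]
  simp
  field_simp
  ring

theorem pd_pd_fC_succ_succ {z : Fin (d + 2) → ℝ} (hz : z ∈ region d y) (a b : Fin (d + 1)) :
    pd a.succ (pd b.succ (fC y)) z = (y ^ 2 * fC y z +
      2 * y ^ 2 * Real.cos (y * z 1) ^ 2 * fC y z ^ 3 * z 0 ^ 2) *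
        (Segment.dtI a * Segment.dtI b) := by
  have hf := differentiableAt_fC hz.1 hz.2
  have hc := differentiableAt_cos (y := y) z
  have hr := differentiableAt_coord 0 z
  have h0 := hz.1
  have e : EqOn (pd b.succ (fC y)) (fun x => (-(y * Segment.dtI b)) *
      (Real.cos (y * x 1) * ((fC y x * fC y x) * x 0))) (region d y) :=
    fun x hx => by rw [pd_fC_succ hx]; ring
  rw [pd_congr isOpen_region e hz, pd_mul _ (differentiableAt_const _)
    (hc.fun_mul ((hf.fun_mul hf).fun_mul hr)), pd_const, pd_mul _ hc ((hf.fun_mul hf).fun_mul hr),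
    pd_mul _ (hf.fun_mul hf) hr, pd_mul _ hf hf, pd_fC_succ hz, pd_cos, pd_coord]
  rw [if_neg (Fin.succ_ne_zero _).symm]
  have hs : Real.sin (y * z 1) * fC y z * z 0 = 1 := by
    rw [fC]; have := hz.2; field_simp
  have ha : (if (1 : Fin (d + 2)) = a.succ then (1 : ℝ) else 0) = Segment.dtI a := by
    refine Fin.cases ?_ (fun a => ?_) a
    · simp [Segment.dtI]
    · have : (1 : Fin (d + 2)) ≠ a.succ.succ := by
        intro h
        have := congrArg Fin.val h
        simp at this
      simp [Segment.dtI, this]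
  rw [ha]
  linear_combination (y ^ 2 * Segment.dtI a * Segment.dtI b * fC y z) * hs

theorem O_r [Inside y U] [hR : Region U N] : O y U N (-1) 0 (fun _ z => z 0) := by
  have key : O y U 0 (-1) 0 (fun _ z => z 0) := by
    refine ⟨1, zero_le_one, fun i z hz => ?_⟩
    have := hR.pos i z hz
    simp [mono, abs_of_pos this]
  cases N with
  | zero => exact key
  | succ N =>
    have := hR.pred
    refine O_succ this key (fun i z _ => differentiableAt_coord 0 z) ?_ fun j => ?_
    · exact (O_const 1).congr fun i z _ => by simp [pd_coord]
    · exact (O_zero _ _).congr fun i z _ => by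
        simp [pd_coord, (Fin.succ_ne_zero j).symm]

theorem O_rho [hI : Inside y U] [hR : Region U N] : O y U N 1 0 (fun _ z => (z 0)⁻¹) := by
  have key : O y U 0 1 0 (fun _ z => (z 0)⁻¹) := by
    refine ⟨1, zero_le_one, fun i z hz => ?_⟩
    have := hR.pos i z hz
    simp [mono, abs_of_pos this]
  induction N generalizing hR with
  | zero => exact key
  | succ N ih =>
    have := hR.pred
    refine O_succ this key (fun i z hz => differentiableAt_inv_coord (hR.pos i z hz)) ?_
      fun j => ?_
    · exact ((ih.mulO ih).neg.mono' (by norm_num) (by norm_num)).congr fun i z hz => by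
        simp [pd_inv_coord (hR.pos i z hz)]
    · exact (O_zero _ _).congr fun i z hz => by
        simp [pd_inv_coord (hR.pos i z hz), (Fin.succ_ne_zero j).symm]

theorem O_sin_cos [hI : Inside y U] [hR : Region U N] :
    O y U N 0 0 (fun _ z => Real.sin (y * z 1)) ∧
    O y U N 0 0 (fun _ z => Real.cos (y * z 1)) := by
  have key : O y U 0 0 0 (fun _ z => Real.sin (y * z 1)) ∧
      O y U 0 0 0 (fun _ z => Real.cos (y * z 1)) := by
    refine ⟨⟨1, zero_le_one, fun i z hz => ?_⟩, ⟨1, zero_le_one, fun i z hz => ?_⟩⟩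
    · simpa [mono] using Real.abs_sin_le_one _
    · simpa [mono] using Real.abs_cos_le_one _
  induction N generalizing hR with
  | zero => exact key
  | succ N ih =>
    have := hR.pred
    obtain ⟨hs, hc⟩ := ih
    constructor
    · refine O_succ this key.1 (fun i z hz => differentiableAt_sin z) ?_ fun j => ?_
      · exact (O_zero _ _).congr fun i z hz => by simp [pd_sin]
      · refine ((hc.const_mul (y * if 1 = j.succ then 1 else 0)).mono' (by norm_num)
          (by norm_num)).congr fun i z hz => ?_
        rw [pd_sin]; ring
    · refine O_succ this key.2 (fun i z hz => differentiableAt_cos z) ?_ fun j => ?_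
      · exact (O_zero _ _).congr fun i z hz => by simp [pd_cos]
      · refine ((hs.const_mul (-y * if 1 = j.succ then 1 else 0)).mono' (by norm_num)
          (by norm_num)).congr fun i z hz => ?_
        rw [pd_cos]; ring

theorem O_cos [hI : Inside y U] [hR : Region U N] :
    O y U N 0 0 (fun _ z => Real.cos (y * z 1)) := O_sin_cos.2

theorem O_f [hI : Inside y U] [hR : Region U N] : O y U N 0 1 (fun _ z => fC y z) := by
  have key : O y U 0 0 1 (fun _ z => fC y z) := by
    refine ⟨1, zero_le_one, fun i z hz => ?_⟩
    simp [mono, abs_of_pos (fC_pos (hI.pos i z hz) (hI.sin_pos i z hz))]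
  induction N generalizing hR with
  | zero => exact key
  | succ N ih =>
    have := hR.pred
    refine O_succ this key
      (fun i z hz => differentiableAt_fC (hI.pos i z hz) (hI.sin_pos i z hz)) ?_ fun j => ?_
    · exact ((O_rho.mulO ih).neg.mono' (by norm_num) (by norm_num)).congr fun i z hz =>
        pd_fC_zero ⟨hI.pos i z hz, hI.sin_pos i z hz⟩
    · refine ((((O_cos.mulO (ih.mulO ih)).mulO O_r).const_mul (-(y * Segment.dtI j))).mono'
        (by norm_num) (by norm_num)).congr fun i z hz => ?_
      rw [pd_fC_succ ⟨hI.pos i z hz, hI.sin_pos i z hz⟩]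
      ring

end Weights

/-! ### Functions of `(t, x)` with bounded derivatives -/

section Slow

variable {d m : ℕ} {ι : Type*} {y : ℝ} {U : ι → Set (Fin (d + 2) → ℝ)} {N : ℕ}

theorem hasFDerivAt_comp_coords (σ : Fin m → Fin (d + 2)) {h : (Fin m → ℝ) → ℝ}
    {z : Fin (d + 2) → ℝ} (hd : DifferentiableAt ℝ h (fun k => z (σ k))) :
    HasFDerivAt (fun x : Fin (d + 2) → ℝ => h (fun k => x (σ k)))
      ((fderiv ℝ h (fun k => z (σ k))).comp (ContinuousLinearMap.pi fun k =>
        ContinuousLinearMap.proj (R := ℝ) (φ := fun _ : Fin (d + 2) => ℝ) (σ k))) z := by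
  have hL : HasFDerivAt (fun x : Fin (d + 2) → ℝ => fun k => x (σ k)) (ContinuousLinearMap.pi
      fun k => ContinuousLinearMap.proj (R := ℝ) (φ := fun _ : Fin (d + 2) => ℝ) (σ k)) z :=
    (ContinuousLinearMap.pi fun k =>
      ContinuousLinearMap.proj (R := ℝ) (φ := fun _ : Fin (d + 2) => ℝ) (σ k)).hasFDerivAt
  exact HasFDerivAt.comp z hd.hasFDerivAt hL

theorem pd_comp_coords (σ : Fin m → Fin (d + 2)) (hσ : Function.Injective σ)
    {h : (Fin m → ℝ) → ℝ} {z : Fin (d + 2) → ℝ}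
    (hd : DifferentiableAt ℝ h (fun k => z (σ k))) (k : Fin m) :
    pd (σ k) (fun x => h (fun k => x (σ k))) z = pd k h (fun k => z (σ k)) := by
  rw [pd, (hasFDerivAt_comp_coords σ hd).fderiv, ContinuousLinearMap.comp_apply, pd]
  congr 1
  funext k'
  simp [Pi.single_apply, hσ.eq_iff]

theorem pd_comp_coords_of_notMem (σ : Fin m → Fin (d + 2))
    {h : (Fin m → ℝ) → ℝ} {z : Fin (d + 2) → ℝ}
    (hd : DifferentiableAt ℝ h (fun k => z (σ k))) {j : Fin (d + 2)} (hj : ∀ k, σ k ≠ j) :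
    pd j (fun x => h (fun k => x (σ k))) z = 0 := by
  rw [pd, (hasFDerivAt_comp_coords σ hd).fderiv, ContinuousLinearMap.comp_apply]
  convert map_zero (fderiv ℝ h (fun k => z (σ k)))
  funext k'
  simp [hj]

theorem BddDerivs.pd {b : ℕ → ℝ} {Q : Set (Fin m → ℝ)} {h : (Fin m → ℝ) → ℝ} (hQ : IsOpen Q)
    (hb : BddDerivs b Q h) (k : Fin m) : BddDerivs (fun n => b (n + 1)) Q (AAdS.pd k h) := by
  refine ⟨contDiffOn_pd hQ hb.1 k, fun l z hz => ?_⟩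
  have := hb.2 (l ++ [k]) z hz
  rw [pds_append, List.length_append] at this
  exact this

variable {σ : Fin m → Fin (d + 2)} {b : ℕ → ℝ} {Q : ι → Set (Fin m → ℝ)}
  {h : ι → (Fin m → ℝ) → ℝ}

theorem BddDerivs.differentiableAt {h : (Fin m → ℝ) → ℝ} {Q : Set (Fin m → ℝ)}
    (hb : BddDerivs b Q h) (hQ : IsOpen Q) {q : Fin m → ℝ} (hq : q ∈ Q) :
    DifferentiableAt ℝ h q :=
  (hb.1.contDiffAt (hQ.mem_nhds hq)).differentiableAt (by simp)

/-- Functions of some of the coordinates `(t, x)` with bounded derivatives are `O(1)`; this uses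
`r ≥ 1`. -/
theorem O_comp_coords [hI : Inside y U] [hR : Region U N] (hσ : Function.Injective σ)
    (hσ0 : ∀ k, σ k ≠ 0) (hQ : ∀ i, IsOpen (Q i))
    (hmem : ∀ i, ∀ z ∈ U i, (fun k => z (σ k)) ∈ Q i) (hb : ∀ i, BddDerivs b (Q i) (h i)) :
    O y U N 0 0 (fun i z => h i (fun k => z (σ k))) := by
  have key : ∀ {b : ℕ → ℝ} {h : ι → (Fin m → ℝ) → ℝ}, (∀ i, BddDerivs b (Q i) (h i)) →
      O y U 0 0 0 (fun i z => h i (fun k => z (σ k))) := by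
    intro b h hb
    refine ⟨|b 0|, abs_nonneg _, fun i z hz => ?_⟩
    have := (hb i).2 [] _ (hmem i z hz)
    simp only [pds, List.foldr_nil, List.length_nil] at this
    simpa [mono] using this.trans (le_abs_self _)
  induction N generalizing hR b h with
  | zero => exact key hb
  | succ N ih =>
    have := hR.pred
    have hd : ∀ i, ∀ z ∈ U i, DifferentiableAt ℝ (h i) (fun k => z (σ k)) :=
      fun i z hz => (hb i).differentiableAt (hQ i) (hmem i z hz)
    refine O_succ this (key hb)
      (fun i z hz => (hasFDerivAt_comp_coords σ (hd i z hz)).differentiableAt) ?_ fun j => ?_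
    · exact (O_zero _ _).congr fun i z hz => pd_comp_coords_of_notMem σ (hd i z hz) hσ0
    · by_cases hj : ∃ k, σ k = j.succ
      · obtain ⟨k, hk⟩ := hj
        rw [← hk]
        exact ((ih fun i => (hb i).pd (hQ i) k).mono' (by norm_num) (by norm_num)).congr
          fun i z hz => pd_comp_coords σ hσ (hd i z hz) k
      · push Not at hj
        exact (O_zero _ _).congr fun i z hz => pd_comp_coords_of_notMem σ (hd i z hz) hj

/-- Unlike for a general family `O(1)`, derivatives in `(t, x)` do not lose a power of `r`. -/
theorem O_pd_comp_coords [hI : Inside y U] [hR : Region U N] (hσ : Function.Injective σ)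
    (hσ0 : ∀ k, σ k ≠ 0) (hQ : ∀ i, IsOpen (Q i))
    (hmem : ∀ i, ∀ z ∈ U i, (fun k => z (σ k)) ∈ Q i) (hb : ∀ i, BddDerivs b (Q i) (h i))
    (j : Fin (d + 2)) : O y U N 0 0 (fun i => pd j (fun z => h i (fun k => z (σ k)))) := by
  have hd : ∀ i, ∀ z ∈ U i, DifferentiableAt ℝ (h i) (fun k => z (σ k)) :=
    fun i z hz => (hb i).differentiableAt (hQ i) (hmem i z hz)
  by_cases hj : ∃ k, σ k = j
  · obtain ⟨k, rfl⟩ := hj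
    exact (O_comp_coords hσ hσ0 hQ hmem fun i => (hb i).pd (hQ i) k).congr
      fun i z hz => pd_comp_coords σ hσ (hd i z hz) k
  · push Not at hj
    exact (O_zero _ _).congr fun i z hz => pd_comp_coords_of_notMem σ (hd i z hz) hj

end Slow


/-! ### Coordinate expressions of admissible metrics -/

/-- The components of `-dt² + γ`, for given components of `γ`. -/
def gr {d : ℕ} (γ : Matrix (Fin d) (Fin d) ℝ) : Matrix (Fin (d + 1)) (Fin (d + 1)) ℝ :=
  Matrix.of fun a b => Fin.cases (Fin.cases (-1) (fun _ => 0) b)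
    (fun i => Fin.cases 0 (fun j => γ i j) b) a

/-- The coordinate expression of an admissible metric in one bounded coordinate system: `dom`, `qdom`
and `xdom` are the ranges of the coordinates `(r, t, x)`, `(t, x)` and `x`, and `G`, `gb` and `γ` are
the components of `g`, `ḡ` and the metric of `S`. The manifolds do not appear in it. Uniformity
over all admissible segments and all their bounded coordinate systems is uniformity over this
type. -/
structure CoordData (d : ℕ) (y : ℝ) (B : ℕ → ℕ → ℝ) where
  dom : Set (Fin (d + 2) → ℝ)
  qdom : Set (Fin (d + 1) → ℝ)
  xdom : Set (Fin d → ℝ)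
  isOpen_dom : IsOpen dom
  isOpen_qdom : IsOpen qdom
  isOpen_xdom : IsOpen xdom
  pos : ∀ z ∈ dom, 0 < z 0
  sin_pos : ∀ z ∈ dom, 0 < Real.sin (y * z 1)
  q_mem : ∀ z ∈ dom, (fun k => z (Fin.succ k)) ∈ qdom
  x_mem : ∀ z ∈ dom, (fun k => z (Fin.succ (Fin.succ k))) ∈ xdom
  γ : (Fin d → ℝ) → Matrix (Fin d) (Fin d) ℝ
  gb : (Fin (d + 1) → ℝ) → Matrix (Fin (d + 1)) (Fin (d + 1)) ℝ
  G : (Fin (d + 2) → ℝ) → Matrix (Fin (d + 2)) (Fin (d + 2)) ℝ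
  γ_posDef : ∀ x ∈ xdom, (γ x).PosDef
  G_symm : ∀ z ∈ dom, ∀ α β, G z α β = G z β α
  γ_bdd : ∀ i j, BddDerivs (B 0) xdom fun x => γ x i j
  γ_inv_bdd : ∀ i j, ∀ x ∈ xdom, |(γ x)⁻¹ i j| ≤ B 0 0
  gb_bdd : ∀ a b, BddDerivs (B 0) qdom fun q => gb q a b
  G_rr : IsO B dom (fun z => (z 0) ^ (-5 : ℤ))
    fun z => G z 0 0 - ((z 0) ^ (-2 : ℤ) - (z 0) ^ (-4 : ℤ))
  G_ra : ∀ a : Fin (d + 1), IsO B dom (fun z => (z 0) ^ (-3 : ℤ)) fun z => G z 0 a.succ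
  G_ab : ∀ a b : Fin (d + 1), IsO B dom (fun z => (z 0) ^ (-3 : ℤ))
    fun z => (z 0) ^ (-2 : ℤ) * G z a.succ b.succ
      - (gr (γ fun k => z (Fin.succ (Fin.succ k))) a b
        + (z 0) ^ (-2 : ℤ) * gb (fun k => z (Fin.succ k)) a b)

/-- The frame `r ∂_r, ρ ∂_t, ρ ∂_x` is the coordinate frame with factors `scale`. -/
def scale {d : ℕ} (z : Fin (d + 2) → ℝ) : Fin (d + 2) → ℝ := Fin.cons (z 0) fun _ => (z 0)⁻¹

@[simp] theorem scale_zero {d : ℕ} (z : Fin (d + 2) → ℝ) : scale z 0 = z 0 := rfl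
@[simp] theorem scale_succ {d : ℕ} (z : Fin (d + 2) → ℝ) (a : Fin (d + 1)) :
    scale z a.succ = (z 0)⁻¹ := rfl

theorem scale_ne_zero {d : ℕ} {z : Fin (d + 2) → ℝ} (h : 0 < z 0) (α : Fin (d + 2)) :
    scale z α ≠ 0 := by
  refine Fin.cases ?_ (fun a => ?_) α
  · exact h.ne'
  · exact inv_ne_zero h.ne'

/-- The components of a covariant `2`-tensor in the scaled frame. -/
def hat {d : ℕ} (z : Fin (d + 2) → ℝ) (M : Matrix (Fin (d + 2)) (Fin (d + 2)) ℝ) :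
    Matrix (Fin (d + 2)) (Fin (d + 2)) ℝ :=
  Matrix.of fun α β => scale z α * scale z β * M α β

theorem Ord.diff {d : ℕ} {ι : Type*} {U : ι → Set (Fin (d + 2) → ℝ)} {N : ℕ}
    {w : (Fin (d + 2) → ℝ) → ℝ} {ξ : ι → (Fin (d + 2) → ℝ) → ℝ} (h : Ord U (N + 1) w ξ)
    {i : ι} {z : Fin (d + 2) → ℝ} (hz : z ∈ U i) : DifferentiableAt ℝ (ξ i) z := h.2.1 i z hz

namespace CoordData

variable {d : ℕ} {y : ℝ} {B : ℕ → ℕ → ℝ}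

/-- The components of `-dt² + γ` at the point with coordinates `z`. -/
def grz (c : CoordData d y B) (z : Fin (d + 2) → ℝ) : Matrix (Fin (d + 1)) (Fin (d + 1)) ℝ :=
  gr (c.γ fun k => z (Fin.succ (Fin.succ k)))

/-- The components of `ḡ` at the point with coordinates `z`. -/
def gbz (c : CoordData d y B) (z : Fin (d + 2) → ℝ) : Matrix (Fin (d + 1)) (Fin (d + 1)) ℝ :=
  c.gb fun k => z (Fin.succ k)

/-- The part `{f < δ}` of the coordinate range. -/
def small (δ : ℝ) (c : CoordData d y B) : Set (Fin (d + 2) → ℝ) := {z | z ∈ c.dom ∧ fC y z < δ}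

theorem small_subset (δ : ℝ) (c : CoordData d y B) : c.small δ ⊆ region d y :=
  fun z hz => ⟨c.pos z hz.1, c.sin_pos z hz.1⟩

theorem isOpen_small (δ : ℝ) (c : CoordData d y B) : IsOpen (c.small δ) := by
  have hc : ContinuousOn (fC (d := d) y) c.dom := fun z hz =>
    (differentiableAt_fC (c.pos z hz) (c.sin_pos z hz)).continuousAt.continuousWithinAt
  exact hc.isOpen_inter_preimage c.isOpen_dom isOpen_Iio

instance (δ : ℝ) (N : ℕ) : Region (small (d := d) (y := y) (B := B) δ) N where
  isOpen := Or.inr fun c => c.isOpen_small δ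
  pos c z hz := c.pos z hz.1

instance (δ : ℝ) [h : Fact (δ ≤ 1)] : Inside y (small (d := d) (y := y) (B := B) δ) where
  pos c z hz := c.pos z hz.1
  sin_pos c z hz := c.sin_pos z hz.1
  lt_one c z hz := hz.2.trans_le h.out

variable {δ : ℝ} [Fact (δ ≤ 1)] {N : ℕ}

local notation "𝒰" => small (d := d) (y := y) (B := B) δ

/-! ### The data `-dt² + γ` and `ḡ` -/

theorem succ_succ_injective : Function.Injective fun k : Fin d => Fin.succ (Fin.succ k) :=
  (Fin.succ_injective _).comp (Fin.succ_injective _)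

theorem O_grz (a b : Fin (d + 1)) : O y 𝒰 N 0 0 fun c z => c.grz z a b := by
  refine Fin.cases (Fin.cases ?_ (fun j => ?_) b) (fun i => Fin.cases ?_ (fun j => ?_) b) a
  · exact O_const (-1)
  · exact O_const 0
  · exact O_const 0
  · exact O_comp_coords (Q := xdom) (h := fun c x => c.γ x i j) succ_succ_injective
      (fun k => Fin.succ_ne_zero _) isOpen_xdom (fun c z hz => c.x_mem z hz.1)
      fun c => c.γ_bdd i j

theorem O_pd_grz (j : Fin (d + 2)) (a b : Fin (d + 1)) :
    O y 𝒰 N 0 0 fun c => pd j fun z => c.grz z a b := by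
  have hconst : ∀ k : ℝ, O y 𝒰 N 0 0 fun _ => pd j fun _ => k := fun k =>
    (O_zero 0 0).congr fun c z hz => pd_const j k
  refine Fin.cases (Fin.cases ?_ (fun l => ?_) b) (fun i => Fin.cases ?_ (fun l => ?_) b) a
  · exact hconst (-1)
  · exact hconst 0
  · exact hconst 0
  · exact O_pd_comp_coords (Q := xdom) (h := fun c x => c.γ x i l) succ_succ_injective
      (fun k => Fin.succ_ne_zero _) isOpen_xdom (fun c z hz => c.x_mem z hz.1)
      (fun c => c.γ_bdd i l) j

/-- `-dt² + γ` depends on `x` only. -/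
theorem pd_grz_eq_zero (c : CoordData d y B) {z : Fin (d + 2) → ℝ} (hz : z ∈ c.dom)
    {j : Fin (d + 2)} (hj : ∀ k : Fin d, k.succ.succ ≠ j) (a b : Fin (d + 1)) :
    pd j (fun z => c.grz z a b) z = 0 := by
  refine Fin.cases (Fin.cases ?_ (fun l => ?_) b) (fun i => Fin.cases ?_ (fun l => ?_) b) a
  · exact pd_const j (-1)
  · exact pd_const j 0
  · exact pd_const j 0
  · exact pd_comp_coords_of_notMem (h := fun x => c.γ x i l) _
      ((c.γ_bdd i l).differentiableAt c.isOpen_xdom (c.x_mem z hz)) hj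

/-- The components of `-dt² + γ` in the direction of `t` are constant. -/
theorem pd_grz_zero (c : CoordData d y B) (z : Fin (d + 2) → ℝ) (j : Fin (d + 2))
    (b : Fin (d + 1)) : pd j (fun z => c.grz z 0 b) z = 0 := by
  refine Fin.cases ?_ (fun l => ?_) b
  · exact pd_const j (-1)
  · exact pd_const j 0

theorem grz_zero (c : CoordData d y B) (z : Fin (d + 2) → ℝ) (b : Fin (d + 1)) :
    c.grz z 0 b = -Segment.dtI b := by
  refine Fin.cases ?_ (fun l => ?_) b
  · simp [grz, gr, Segment.dtI]
  · simp [grz, gr, Segment.dtI]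

theorem grz_symm (c : CoordData d y B) {z : Fin (d + 2) → ℝ} (hz : z ∈ c.dom)
    (a b : Fin (d + 1)) : c.grz z a b = c.grz z b a := by
  have h := (c.γ_posDef _ (c.x_mem z hz)).isHermitian
  refine Fin.cases (Fin.cases ?_ (fun l => ?_) b) (fun i => Fin.cases ?_ (fun l => ?_) b) a
  · rfl
  · rfl
  · rfl
  · simpa [grz, gr] using (h.apply l i)

theorem O_gbz (a b : Fin (d + 1)) : O y 𝒰 N 0 0 fun c z => c.gbz z a b :=
  O_comp_coords (Q := qdom) (h := fun c x => c.gb x a b) (Fin.succ_injective _)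
    (fun k => Fin.succ_ne_zero _) isOpen_qdom (fun c z hz => c.q_mem z hz.1)
    fun c => c.gb_bdd a b

theorem O_pd_gbz (j : Fin (d + 2)) (a b : Fin (d + 1)) :
    O y 𝒰 N 0 0 fun c => pd j fun z => c.gbz z a b :=
  O_pd_comp_coords (Q := qdom) (h := fun c x => c.gb x a b) (Fin.succ_injective _)
    (fun k => Fin.succ_ne_zero _) isOpen_qdom (fun c z hz => c.q_mem z hz.1)
    (fun c => c.gb_bdd a b) j

theorem pd_zero_gbz (c : CoordData d y B) {z : Fin (d + 2) → ℝ} (hz : z ∈ c.dom)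
    (a b : Fin (d + 1)) : pd 0 (fun z => c.gbz z a b) z = 0 :=
  pd_comp_coords_of_notMem (h := fun x => c.gb x a b) _
    ((c.gb_bdd a b).differentiableAt c.isOpen_qdom (c.q_mem z hz)) fun k => Fin.succ_ne_zero k

/-! ### Expansions of the metric -/

theorem O_of_isO {n : ℕ} {ξ : CoordData d y B → (Fin (d + 2) → ℝ) → ℝ}
    (h : ∀ c, IsO B c.dom (fun z => (z 0) ^ (-(n : ℤ))) (ξ c)) : O y 𝒰 N n 0 ξ := by
  have h' : ∀ c : CoordData d y B, IsO B (𝒰 c) (fun z => (z 0) ^ (-(n : ℤ))) (ξ c) := fun c =>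
    ⟨(h c).1.mono fun z hz => hz.1, fun k l z hz => (h c).2 k l z hz.1⟩
  have hpos : ∀ c : CoordData d y B, ∀ z ∈ 𝒰 c, 0 < z 0 := fun c z hz => c.pos z hz.1
  refine (ord_of_isO (fun c => c.isOpen_small δ) hpos (fun c z hz => ?_) h' N).weight 1
    (fun c z hz => ?_) fun c z hz => (mono_pos _ _ hz).le
  · have := hpos c z hz
    positivity
  · simp [mono]

theorem O_G_rr : O y 𝒰 N 5 0 fun c z => c.G z 0 0 - ((z 0)⁻¹ ^ 2 - (z 0)⁻¹ ^ 4) := by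
  refine (O_of_isO (n := 5) fun c => c.G_rr).congr fun c z hz => ?_
  simp only [zpow_neg, inv_pow]
  norm_cast

theorem O_G_ra (a : Fin (d + 1)) : O y 𝒰 N 3 0 fun c z => c.G z 0 a.succ :=
  O_of_isO (n := 3) fun c => c.G_ra a

theorem O_G_ar (a : Fin (d + 1)) : O y 𝒰 N 3 0 fun c z => c.G z a.succ 0 :=
  (O_G_ra a).congr fun c z hz => c.G_symm z hz.1 _ _

theorem O_G_ab (a b : Fin (d + 1)) : O y 𝒰 N 1 0 fun c z =>
    c.G z a.succ b.succ - (z 0 * z 0 * c.grz z a b + c.gbz z a b) := by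
  have h := O_of_isO (δ := δ) (N := N) (n := 3) fun c : CoordData d y B => c.G_ab a b
  refine ((O_r.mulO O_r).mulO h).congr fun c z hz => ?_
  have h0 := c.pos z hz.1
  have e : (z 0) ^ (-2 : ℤ) = (z 0)⁻¹ * (z 0)⁻¹ := by
    rw [zpow_neg, ← mul_inv]; norm_cast; rw [sq]
  simp only [e, grz, gbz]
  field_simp

theorem O_hatG_rr : O y 𝒰 N 3 0 fun c z => hat z (c.G z) 0 0 - 1 + (z 0)⁻¹ ^ 2 := by
  refine ((O_r.mulO O_r).mulO O_G_rr).congr fun c z hz => ?_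
  have h0 := c.pos z hz.1
  simp [hat]
  field_simp
  ring

theorem O_hatG_ra (a : Fin (d + 1)) : O y 𝒰 N 3 0 fun c z => hat z (c.G z) 0 a.succ := by
  refine (O_G_ra a).congr fun c z hz => ?_
  have h0 := c.pos z hz.1
  simp [hat, h0.ne']

theorem O_hatG_ar (a : Fin (d + 1)) : O y 𝒰 N 3 0 fun c z => hat z (c.G z) a.succ 0 := by
  refine (O_G_ar a).congr fun c z hz => ?_
  have h0 := c.pos z hz.1
  simp [hat, h0.ne']

theorem O_hatG_ab (a b : Fin (d + 1)) : O y 𝒰 N 3 0 fun c z =>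
    hat z (c.G z) a.succ b.succ - (c.grz z a b + (z 0)⁻¹ ^ 2 * c.gbz z a b) := by
  refine ((O_rho.mulO O_rho).mulO (O_G_ab a b)).congr fun c z hz => ?_
  have h0 := c.pos z hz.1
  simp [hat]
  field_simp

/-! ### Derivatives of the metric -/

/-- The derivatives `∂_α g_{λβ}` in the scaled frame. -/
def D (c : CoordData d y B) (z : Fin (d + 2) → ℝ) (α l β : Fin (d + 2)) : ℝ :=
  scale z α * scale z l * scale z β * pd α (fun x => c.G x l β) z

theorem D_symm (c : CoordData d y B) {z : Fin (d + 2) → ℝ} (hz : z ∈ c.dom)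
    (α l β : Fin (d + 2)) : c.D z α l β = c.D z α β l := by
  simp only [D]
  rw [pd_congr c.isOpen_dom (fun x hx => c.G_symm x hx l β) hz]
  ring

theorem pd_rho_pow {z : Fin (d + 2) → ℝ} (h0 : 0 < z 0) (j : Fin (d + 2)) :
    pd j (fun x => (x 0)⁻¹ ^ 2 - (x 0)⁻¹ ^ 4) z
      = (-2 * (z 0)⁻¹ ^ 3 + 4 * (z 0)⁻¹ ^ 5) * if 0 = j then 1 else 0 := by
  have hφ : HasDerivAt (fun t : ℝ => t ^ 2 - t ^ 4) (2 * (z 0)⁻¹ - 4 * (z 0)⁻¹ ^ 3) (z 0)⁻¹ := by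
    simpa using (hasDerivAt_pow 2 (z 0)⁻¹).fun_sub (hasDerivAt_pow 4 (z 0)⁻¹)
  rw [pd_comp (φ := fun t => t ^ 2 - t ^ 4) (g := fun x => (x 0)⁻¹) j hφ
    (differentiableAt_inv_coord h0), pd_inv_coord h0]
  ring

theorem pd_G_rr (c : CoordData d y B) {z : Fin (d + 2) → ℝ} (hz : z ∈ 𝒰 c) (j : Fin (d + 2)) :
    pd j (fun x => c.G x 0 0) z = pd j (fun x => c.G x 0 0 - ((x 0)⁻¹ ^ 2 - (x 0)⁻¹ ^ 4)) z
      + (-2 * (z 0)⁻¹ ^ 3 + 4 * (z 0)⁻¹ ^ 5) * if 0 = j then 1 else 0 := by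
  have h0 := c.pos z hz.1
  have hd := (O_G_rr (δ := δ) (N := 1)).diff hz
  have hi := differentiableAt_inv_coord h0
  rw [← pd_rho_pow h0, ← pd_add _ hd ((hi.fun_pow 2).fun_sub (hi.fun_pow 4))]
  simp

theorem O_D_rrr : O y 𝒰 N 2 0 fun c z => c.D z 0 0 0 + 2 := by
  have h1 := ((O_r.mulO O_r).mulO O_r).mulO
    (O_G_rr.pd0 (inferInstance : Region (small (d := d) (y := y) (B := B) δ) N))
  have h2 := (O_rho (y := y) (U := 𝒰) (N := N)).mulO O_rho
  have h3 := (h1.mono' (a' := 2) (b' := 0) (by norm_num) (by norm_num)).add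
    ((h2.const_mul 4).mono' (a' := 2) (b' := 0) (by norm_num) (by norm_num))
  refine h3.congr fun c z hz => ?_
  have h0 := c.pos z hz.1
  rw [D, pd_G_rr c hz]
  simp
  field_simp
  ring

theorem O_D_arr (a : Fin (d + 1)) : O y 𝒰 N 3 0 fun c z => c.D z a.succ 0 0 := by
  have h1 := ((O_r.mulO O_r).mulO O_rho).mulO
    (O_G_rr.pdS (inferInstance : Region (small (d := d) (y := y) (B := B) δ) N) a)
  refine (h1.mono' (by norm_num) (by norm_num)).congr fun c z hz => ?_
  rw [D, pd_G_rr c hz]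
  simp [(Fin.succ_ne_zero a).symm]

theorem O_D_rra (a : Fin (d + 1)) : O y 𝒰 N 3 0 fun c z => c.D z 0 0 a.succ := by
  have h1 := ((O_r.mulO O_r).mulO O_rho).mulO
    ((O_G_ra a).pd0 (inferInstance : Region (small (d := d) (y := y) (B := B) δ) N))
  exact (h1.mono' (by norm_num) (by norm_num)).congr fun c z hz => by simp [D]

theorem O_D_rar (a : Fin (d + 1)) : O y 𝒰 N 3 0 fun c z => c.D z 0 a.succ 0 :=
  (O_D_rra a).congr fun c _ hz => c.D_symm hz.1 _ _ _

theorem O_D_bra (a b : Fin (d + 1)) : O y 𝒰 N 3 0 fun c z => c.D z b.succ 0 a.succ := by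
  have h1 := ((O_r.mulO O_rho).mulO O_rho).mulO
    ((O_G_ra a).pdS (inferInstance : Region (small (d := d) (y := y) (B := B) δ) N) b)
  exact (h1.mono' (by norm_num) (by norm_num)).congr fun c z hz => by
    simp only [D, scale_zero, scale_succ]; ring

theorem O_D_bar (a b : Fin (d + 1)) : O y 𝒰 N 3 0 fun c z => c.D z b.succ a.succ 0 :=
  (O_D_bra a b).congr fun c _ hz => c.D_symm hz.1 _ _ _

theorem pd_G_ab (c : CoordData d y B) {z : Fin (d + 2) → ℝ} (hz : z ∈ 𝒰 c) (j : Fin (d + 2))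
    (a b : Fin (d + 1)) : pd j (fun x => c.G x a.succ b.succ) z =
      pd j (fun x => c.G x a.succ b.succ - (x 0 * x 0 * c.grz x a b + c.gbz x a b)) z
      + (z 0 * z 0 * pd j (fun x => c.grz x a b) z + c.grz z a b * (2 * z 0 *
        if 0 = j then 1 else 0) + pd j (fun x => c.gbz x a b) z) := by
  have hd := (O_G_ab (δ := δ) (N := 1) a b).diff hz
  have hgr := (O_grz (δ := δ) (N := 1) a b).diff hz
  have hgb := (O_gbz (δ := δ) (N := 1) a b).diff hz
  have hr := differentiableAt_coord 0 z
  have e := pd_add j hd (((hr.fun_mul hr).fun_mul hgr).fun_add hgb)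
  rw [pd_add j ((hr.fun_mul hr).fun_mul hgr) hgb, pd_mul j (hr.fun_mul hr) hgr, pd_mul j hr hr,
    pd_coord] at e
  have e' : (fun x => c.G x a.succ b.succ) = fun x =>
      (c.G x a.succ b.succ - (x 0 * x 0 * c.grz x a b + c.gbz x a b)) +
        (x 0 * x 0 * c.grz x a b + c.gbz x a b) := by funext x; ring
  rw [e', e]
  ring

theorem O_D_rab (a b : Fin (d + 1)) :
    O y 𝒰 N 3 0 fun c z => c.D z 0 a.succ b.succ - 2 * c.grz z a b := by
  have h1 := ((O_r.mulO O_rho).mulO O_rho).mulO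
    ((O_G_ab a b).pd0 (inferInstance : Region (small (d := d) (y := y) (B := B) δ) N))
  refine (h1.mono' (by norm_num) (by norm_num)).congr fun c z hz => ?_
  have h0 := c.pos z hz.1
  rw [D, pd_G_ab c hz, pd_zero_gbz c hz.1, pd_grz_eq_zero c hz.1 fun k => Fin.succ_ne_zero _]
  simp
  field_simp
  ring

theorem O_D_cab (e a b : Fin (d + 1)) : O y 𝒰 N 3 0 fun c z =>
    c.D z e.succ a.succ b.succ - (z 0)⁻¹ * pd e.succ (fun x => c.grz x a b) z := by
  have hR : Region (small (d := d) (y := y) (B := B) δ) N := inferInstance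
  have h1 := ((O_rho.mulO O_rho).mulO O_rho).mulO ((O_G_ab a b).pdS hR e)
  have h2 := ((O_rho.mulO O_rho).mulO O_rho).mulO
    (O_pd_gbz (y := y) (B := B) (δ := δ) (N := N) e.succ a b)
  refine ((h1.mono' (a' := 3) (b' := 0) (by norm_num) (by norm_num)).add
    (h2.mono' (a' := 3) (b' := 0) (by norm_num) (by norm_num))).congr fun c z hz => ?_
  have h0 := c.pos z hz.1
  rw [D, pd_G_ab c hz]
  simp [(Fin.succ_ne_zero e).symm]
  field_simp
  ring

/-! ### Christoffel symbols of the first kind -/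

/-- The Christoffel symbols of the first kind `Γ_{λαβ}` in the scaled frame. -/
def Gam (c : CoordData d y B) (z : Fin (d + 2) → ℝ) (l α β : Fin (d + 2)) : ℝ :=
  (1 / 2) * (c.D z α l β + c.D z β l α - c.D z l α β)

theorem Gam_symm (c : CoordData d y B) {z : Fin (d + 2) → ℝ} (hz : z ∈ c.dom)
    (l α β : Fin (d + 2)) : c.Gam z l α β = c.Gam z l β α := by
  rw [Gam, Gam, c.D_symm hz l α β]; ring

theorem O_Gam_r_rr : O y 𝒰 N 2 0 fun c z => c.Gam z 0 0 0 + 1 :=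
  (O_D_rrr.const_mul (1 / 2)).congr fun c z hz => by rw [Gam]; ring

theorem O_Gam_r_ra (a : Fin (d + 1)) : O y 𝒰 N 3 0 fun c z => c.Gam z 0 0 a.succ :=
  ((O_D_arr a).const_mul (1 / 2)).congr fun c z hz => by rw [Gam]; ring

theorem O_Gam_c_rr (e : Fin (d + 1)) : O y 𝒰 N 3 0 fun c z => c.Gam z e.succ 0 0 :=
  (((O_D_rar e).const_mul 2).sub (O_D_arr e)).const_mul (1 / 2) |>.congr fun c z hz => by
    rw [Gam]; ring

theorem O_Gam_c_ra (e a : Fin (d + 1)) :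
    O y 𝒰 N 3 0 fun c z => c.Gam z e.succ 0 a.succ - c.grz z e a :=
  (((O_D_rab e a).add (O_D_bar e a)).sub (O_D_bra a e)).const_mul (1 / 2) |>.congr
    fun c z hz => by rw [Gam]; ring

theorem O_Gam_r_ab (a b : Fin (d + 1)) :
    O y 𝒰 N 3 0 fun c z => c.Gam z 0 a.succ b.succ + c.grz z a b :=
  (((O_D_bra b a).add (O_D_bra a b)).sub (O_D_rab a b)).const_mul (1 / 2) |>.congr
    fun c z hz => by rw [Gam]; ring

theorem O_D_cab' (e a b : Fin (d + 1)) :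
    O y 𝒰 N 1 0 fun c z => c.D z e.succ a.succ b.succ :=
  (((O_D_cab e a b).mono' (a' := 1) (b' := 0) (by norm_num) (by norm_num)).add
    ((O_rho.mulO (O_pd_grz e.succ a b)).mono' (a' := 1) (b' := 0) (by norm_num)
      (by norm_num))).congr fun c z hz => by ring

theorem O_Gam_c_ab (e a b : Fin (d + 1)) :
    O y 𝒰 N 1 0 fun c z => c.Gam z e.succ a.succ b.succ :=
  (((O_D_cab' a e b).add (O_D_cab' b e a)).sub (O_D_cab' e a b)).const_mul (1 / 2)

theorem O_Gam_t_ab (a b : Fin (d + 1)) :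
    O y 𝒰 N 3 0 fun c z => c.Gam z (Fin.succ 0) a.succ b.succ := by
  refine (((O_D_cab a 0 b).add (O_D_cab b 0 a)).sub (O_D_cab 0 a b)).const_mul (1 / 2) |>.congr
    fun c z hz => ?_
  rw [Gam, pd_grz_zero, pd_grz_zero, pd_grz_eq_zero c hz.1 (j := Fin.succ 0)]
  · ring
  · intro k h
    simpa using Fin.succ_injective _ h

end CoordData


/-! ### The inverse metric -/

theorem det_of_row_zero {R : Type*} [CommRing R] {n : ℕ} (M : Matrix (Fin (n + 1)) (Fin (n + 1)) R)
    (h : ∀ j : Fin n, M 0 j.succ = 0) : M.det = M 0 0 * (M.submatrix Fin.succ Fin.succ).det := by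
  rw [Matrix.det_succ_row_zero, Fin.sum_univ_succ]
  simp [h]

theorem dtI_zero {d : ℕ} : Segment.dtI (0 : Fin (d + 1)) = 1 := rfl
theorem dtI_succ {d : ℕ} (i : Fin d) : Segment.dtI i.succ = 0 := rfl

theorem sum_dtI_mul {d : ℕ} (X : Fin (d + 1) → ℝ) : ∑ a, Segment.dtI a * X a = X 0 := by
  rw [Fin.sum_univ_succ]
  simp [dtI_zero, dtI_succ]

namespace CoordData

variable {d : ℕ} {y : ℝ} {B : ℕ → ℕ → ℝ}

/-- The metric is uniformly nondegenerate on `{f < δ}`. -/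
class Nondeg (d : ℕ) (y : ℝ) (B : ℕ → ℕ → ℝ) (δ : ℝ) : Prop where
  out : ∃ k : ℝ, 0 < k ∧ ∀ c : CoordData d y B, ∀ z ∈ c.small δ, k ≤ |(hat z (c.G z)).det|

theorem small_mono {δ δ' : ℝ} (h : δ ≤ δ') (c : CoordData d y B) : c.small δ ⊆ c.small δ' :=
  fun _ hz => ⟨hz.1, hz.2.trans_le h⟩

theorem Nondeg.mono {δ δ' : ℝ} (h : δ ≤ δ') (hn : Nondeg d y B δ') : Nondeg d y B δ := by
  obtain ⟨k, hk, hb⟩ := hn.out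
  exact ⟨k, hk, fun c z hz => hb c z (c.small_mono h hz)⟩

/-- The bounds of the inverse of `γ` bound its determinant from below. -/
theorem exists_le_det_γ (d : ℕ) (y : ℝ) (B : ℕ → ℕ → ℝ) :
    ∃ k : ℝ, 0 < k ∧ ∀ c : CoordData d y B, ∀ x ∈ c.xdom, k ≤ |(c.γ x).det| := by
  refine ⟨((Nat.factorial d : ℝ) * |B 0 0| ^ d + 1)⁻¹, by positivity, fun c x hx => ?_⟩
  have hdet := (c.γ_posDef x hx).det_pos
  have h1 := Matrix.det_le (abv := AbsoluteValue.abs) (A := (c.γ x)⁻¹) (x := |B 0 0|)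
    fun i j => (c.γ_inv_bdd i j x hx).trans (le_abs_self _)
  have h2 : |(c.γ x)⁻¹.det| = |(c.γ x).det|⁻¹ := by
    rw [Matrix.det_nonsing_inv, Ring.inverse_eq_inv', abs_inv]
  simp only [AbsoluteValue.abs_apply, h2, Fintype.card_fin, nsmul_eq_mul] at h1
  rw [inv_le_comm₀ (by positivity) (abs_pos.2 hdet.ne')]
  linarith

variable {δ : ℝ} [hδ : Fact (δ ≤ 1)] {N : ℕ}

local notation "𝒰" => small (d := d) (y := y) (B := B) δ

theorem O_prod_sub {κ : Type*} (s : Finset κ) {n : ℤ} (hn : 0 ≤ n)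
    {ξ η : κ → CoordData d y B → (Fin (d + 2) → ℝ) → ℝ}
    (h : ∀ k, O y 𝒰 N 0 0 (ξ k)) (h' : ∀ k, O y 𝒰 N n 0 fun c z => η k c z - ξ k c z) :
    O y 𝒰 N 0 0 (fun c z => ∏ k ∈ s, ξ k c z) ∧
    O y 𝒰 N n 0 fun c z => ∏ k ∈ s, η k c z - ∏ k ∈ s, ξ k c z := by
  classical
  induction s using Finset.induction_on with
  | empty =>
    simp only [Finset.prod_empty, sub_self]
    exact ⟨O_const 1, O_zero _ _⟩
  | insert a s ha ih =>
    refine ⟨((h a).mulO ih.1).congr fun c z _ => Finset.prod_insert ha, ?_⟩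
    have e1 := (h a).mulO ih.2
    have e2 := (h' a).mulO ih.1
    have e3 := (h' a).mulO ih.2
    refine (((e1.mono' (a' := n) (b' := 0) (by omega) (by omega)).add
      (e2.mono' (a' := n) (b' := 0) (by omega) (by omega))).add
      (e3.mono' (a' := n) (b' := 0) (by omega) (by omega))).congr fun c z _ => ?_
    rw [Finset.prod_insert ha, Finset.prod_insert ha]
    ring

/-- The leading part of the metric in the scaled frame. -/
def lead (c : CoordData d y B) (z : Fin (d + 2) → ℝ) : Matrix (Fin (d + 2)) (Fin (d + 2)) ℝ :=
  Matrix.of fun α β => Fin.cases (Fin.cases 1 (fun _ => 0) β)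
    (fun a => Fin.cases 0 (fun b => c.grz z a b) β) α

theorem det_lead (c : CoordData d y B) (z : Fin (d + 2) → ℝ) :
    (c.lead z).det = -(c.γ fun k => z (Fin.succ (Fin.succ k))).det := by
  rw [det_of_row_zero _ fun j => rfl, det_of_row_zero _ fun j => rfl]
  have : ((c.lead z).submatrix Fin.succ Fin.succ).submatrix Fin.succ Fin.succ
      = c.γ fun k => z (Fin.succ (Fin.succ k)) := by ext; rfl
  rw [this]
  change 1 * ((-1) * _) = _
  ring

theorem O_lead (α β : Fin (d + 2)) : O y 𝒰 N 0 0 fun c z => c.lead z α β := by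
  refine Fin.cases (Fin.cases ?_ (fun j => ?_) β) (fun i => Fin.cases ?_ (fun j => ?_) β) α
  · exact O_const 1
  · exact O_const 0
  · exact O_const 0
  · exact O_grz i j

theorem O_hatG_rr' : O y 𝒰 N 2 0 fun c z => hat z (c.G z) 0 0 - 1 := by
  have h2 := (O_rho (y := y) (U := 𝒰) (N := N)).mulO O_rho
  refine ((O_hatG_rr.mono' (a' := 2) (b' := 0) (by norm_num) (by norm_num)).sub
    (h2.mono' (a' := 2) (b' := 0) (by norm_num) (by norm_num))).congr fun c z hz => by ring

theorem O_hatG_ab' (a b : Fin (d + 1)) : O y 𝒰 N 2 0 fun c z =>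
    hat z (c.G z) a.succ b.succ - c.grz z a b := by
  have h2 := ((O_rho (y := y) (U := 𝒰) (N := N)).mulO O_rho).mulO (O_gbz a b)
  refine (((O_hatG_ab a b).mono' (a' := 2) (b' := 0) (by norm_num) (by norm_num)).add
    (h2.mono' (a' := 2) (b' := 0) (by norm_num) (by norm_num))).congr fun c z hz => by ring

theorem O_hatG_sub_lead (α β : Fin (d + 2)) :
    O y 𝒰 N 2 0 fun c z => hat z (c.G z) α β - c.lead z α β := by
  refine Fin.cases (Fin.cases ?_ (fun j => ?_) β) (fun i => Fin.cases ?_ (fun j => ?_) β) α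
  · exact O_hatG_rr'
  · simpa [lead] using (O_hatG_ra j).mono' (a' := 2) (b' := 0) (by norm_num) (by norm_num)
  · simpa [lead] using (O_hatG_ar i).mono' (a' := 2) (b' := 0) (by norm_num) (by norm_num)
  · exact O_hatG_ab' i j

theorem O_hatG (α β : Fin (d + 2)) : O y 𝒰 N 0 0 fun c z => hat z (c.G z) α β :=
  (((O_hatG_sub_lead α β).mono' (a' := 0) (b' := 0) (by norm_num) (by norm_num)).add
    (O_lead α β)).congr fun c z _ => by ring

theorem O_det_sub : O y 𝒰 N 2 0 fun c z => (hat z (c.G z)).det - (c.lead z).det := by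
  simp only [Matrix.det_apply', ← Finset.sum_sub_distrib, ← mul_sub]
  exact Ord.sumO fun σ _ => ((O_prod_sub Finset.univ (by norm_num) (fun k => O_lead _ _)
    fun k => O_hatG_sub_lead _ _).2).const_mul _

omit hδ in
/-- For small `δ` the metric is uniformly nondegenerate on `{f < δ}`, as its leading part is. -/
theorem exists_nondeg (d : ℕ) (y : ℝ) (B : ℕ → ℕ → ℝ) :
    ∃ δ : ℝ, 0 < δ ∧ δ ≤ 1 ∧ Nondeg d y B δ := by
  have : Fact ((1 : ℝ) ≤ 1) := ⟨le_rfl⟩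
  obtain ⟨k, hk, hb⟩ := exists_le_det_γ d y B
  obtain ⟨C, hC, hD⟩ := O_det_sub (d := d) (y := y) (B := B) (δ := 1) (N := 0)
  refine ⟨min 1 (k / (2 * (C + 1))), by positivity, min_le_left _ _, ⟨k / 2, by positivity,
    fun c z hz => ?_⟩⟩
  have hz1 := c.small_mono (min_le_left _ _) hz
  have h1 := hD c z hz1
  have h2 := hb c _ (c.x_mem z hz.1)
  rw [← abs_neg, ← c.det_lead z] at h2
  have h3 : mono y 2 0 z ≤ k / (2 * (C + 1)) := by
    have h4 : mono y 2 0 z ≤ mono y 0 1 z :=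
      mono_le_mono (U := small (d := d) (y := y) (B := B) 1) (by norm_num) (by norm_num) hz1
    have h5 : mono y 0 1 z = fC y z := by simp [mono]
    exact h4.trans (h5.le.trans (hz.2.le.trans (min_le_right _ _)))
  have h6 : C * mono y 2 0 z ≤ k / 2 := by
    calc C * mono y 2 0 z ≤ C * (k / (2 * (C + 1))) := by gcongr
      _ ≤ (C + 1) * (k / (2 * (C + 1))) := by gcongr; linarith
      _ = k / 2 := by field_simp
  have h7 := abs_sub_abs_le_abs_sub (c.lead z).det (hat z (c.G z)).det
  rw [abs_sub_comm] at h7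
  linarith

variable [hnd : Nondeg d y B δ]

theorem O_det_inv : O y 𝒰 N 0 0 fun c z => ((hat z (c.G z)).det)⁻¹ := by
  obtain ⟨k, hk, hb⟩ := hnd.out
  have h : O y 𝒰 N 0 0 fun c z => (hat z (c.G z)).det := by
    simp only [Matrix.det_apply']
    refine Ord.sumO fun σ _ => ?_
    have := Ord.prod (U := 𝒰) (N := N) Finset.univ
      (ξ := fun i c z => hat z (c.G z) (σ i) i) fun i _ => by
        have := O_hatG (δ := δ) (B := B) (N := N) (y := y) (σ i) i
        rwa [O, mono_zero_zero] at this
    rw [O, mono_zero_zero]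
    exact this.const_mul _
  rw [O, mono_zero_zero] at h ⊢
  exact h.inv hk hb

theorem O_hatG_inv (α β : Fin (d + 2)) : O y 𝒰 N 0 0 fun c z => (hat z (c.G z))⁻¹ α β := by
  have hadj : O y 𝒰 N 0 0 fun c z => (hat z (c.G z)).adjugate α β := by
    simp only [Matrix.adjugate_apply, Matrix.det_apply']
    refine Ord.sumO fun σ _ => ?_
    have := Ord.prod (U := 𝒰) (N := N) Finset.univ
      (ξ := fun i c z => (hat z (c.G z)).updateRow β (Pi.single α 1) (σ i) i) fun i _ => by
        by_cases h : σ i = β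
        · simp only [h, Matrix.updateRow_self]
          exact ord_const _
        · simp only [Matrix.updateRow_ne h]
          have := O_hatG (δ := δ) (B := B) (N := N) (y := y) (σ i) i
          rwa [O, mono_zero_zero] at this
    rw [O, mono_zero_zero]
    exact this.const_mul _
  refine (O_det_inv.mulO hadj).congr fun c z hz => ?_
  rw [Matrix.inv_def, Ring.inverse_eq_inv']
  simp

omit hδ in
theorem det_hat_ne_zero (c : CoordData d y B) {z : Fin (d + 2) → ℝ} (hz : z ∈ c.small δ) :
    (hat z (c.G z)).det ≠ 0 := by
  obtain ⟨k, hk, hb⟩ := hnd.out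
  have := hb c z hz
  intro h
  rw [h, abs_zero] at this
  linarith

omit hδ in
theorem det_G_ne_zero (c : CoordData d y B) {z : Fin (d + 2) → ℝ} (hz : z ∈ c.small δ) :
    (c.G z).det ≠ 0 := by
  have h := c.det_hat_ne_zero hz
  have e : hat z (c.G z) = Matrix.diagonal (scale z) * c.G z * Matrix.diagonal (scale z) := by
    ext α β
    simp [hat]
    ring
  intro h0
  rw [e, Matrix.det_mul, Matrix.det_mul, h0] at h
  simp at h

/-! ### The gradient of `f` -/

/-- The components of the gradient of `f` in the scaled frame. -/
def grad (c : CoordData d y B) (z : Fin (d + 2) → ℝ) (l : Fin (d + 2)) : ℝ :=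
  (scale z l)⁻¹ * ∑ k, (c.G z)⁻¹ k l * pd k (fC y) z

omit hδ in
theorem sum_grad_mul (c : CoordData d y B) {z : Fin (d + 2) → ℝ} (hz : z ∈ c.small δ)
    (m : Fin (d + 2)) : ∑ l, c.grad z l * hat z (c.G z) l m = scale z m * pd m (fC y) z := by
  have hinv : (c.G z)⁻¹ * c.G z = 1 :=
    Matrix.nonsing_inv_mul _ (isUnit_iff_ne_zero.2 (c.det_G_ne_zero hz))
  have e : ∀ l, c.grad z l * hat z (c.G z) l m
      = scale z m * ∑ k, pd k (fC y) z * ((c.G z)⁻¹ k l * c.G z l m) := by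
    intro l
    have := scale_ne_zero (c.pos z hz.1) l
    simp only [grad, hat, Matrix.of_apply, Finset.mul_sum, Finset.sum_mul]
    refine Finset.sum_congr rfl fun k _ => ?_
    field_simp
  simp only [e, ← Finset.mul_sum]
  rw [Finset.sum_comm]
  simp only [← Finset.mul_sum, ← Matrix.mul_apply, hinv]
  simp [Matrix.one_apply]

/-- The leading part of the gradient of `f`. -/
def gradLead (y : ℝ) (z : Fin (d + 2) → ℝ) : Fin (d + 2) → ℝ :=
  Fin.cons (-(fC y z + (z 0)⁻¹ ^ 2 * fC y z))
    fun a => y * Real.cos (y * z 1) * fC y z ^ 2 * Segment.dtI a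

/-- The defect of `gradLead` as a solution of the equation satisfied by the gradient. -/
def gradRes (c : CoordData d y B) (z : Fin (d + 2) → ℝ) (m : Fin (d + 2)) : ℝ :=
  scale z m * pd m (fC y) z - ∑ l, gradLead y z l * hat z (c.G z) l m

theorem gradRes_eq (c : CoordData d y B) (z : Fin (d + 2) → ℝ) (m : Fin (d + 2)) :
    c.gradRes z m = scale z m * pd m (fC y) z
      + (fC y z + (z 0)⁻¹ ^ 2 * fC y z) * hat z (c.G z) 0 m
      - y * Real.cos (y * z 1) * fC y z ^ 2 * hat z (c.G z) (Fin.succ 0) m := by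
  rw [gradRes, Fin.sum_univ_succ]
  simp only [gradLead, Fin.cons_zero, Fin.cons_succ, mul_assoc, ← Finset.mul_sum, sum_dtI_mul]
  ring

omit hnd in
theorem O_y_cos_f_sq : O y 𝒰 N 0 2 fun _ z => y * Real.cos (y * z 1) * fC y z ^ 2 :=
  (((O_cos.const_mul y).mulO (O_f.mulO O_f)).mono' (by norm_num) (by norm_num)).congr
    fun c z _ => by ring

omit hnd in
theorem O_f_add : O y 𝒰 N 0 1 fun _ z => fC y z + (z 0)⁻¹ ^ 2 * fC y z :=
  (O_f.add (((O_rho.mulO O_rho).mulO O_f).mono' (a' := 0) (b' := 1) (by norm_num)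
    (by norm_num))).congr fun c z _ => by ring

omit hnd in
theorem O_gradRes_r : O y 𝒰 N 3 1 fun c z => c.gradRes z 0 := by
  have h1 := (O_f_add (d := d) (B := B) (δ := δ) (y := y) (N := N)).mulO O_hatG_rr
  have h2 := (O_y_cos_f_sq (d := d) (y := y) (B := B) (δ := δ) (N := N)).mulO (O_hatG_ar (B := B) 0)
  have h3 := (((O_rho.mulO O_rho).mulO O_rho).mulO O_rho).mulO (O_f (y := y) (U := 𝒰) (N := N))
  refine (((h1.mono' (a' := 3) (b' := 1) (by norm_num) (by norm_num)).sub
    (h2.mono' (a' := 3) (b' := 1) (by norm_num) (by norm_num))).sub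
    (h3.mono' (a' := 3) (b' := 1) (by norm_num) (by norm_num))).congr fun c z hz => ?_
  have h0 := c.pos z hz.1
  rw [gradRes_eq, pd_fC_zero (c.small_subset δ hz), scale_zero]
  field_simp
  ring

omit hnd in
theorem O_gradRes_a (b : Fin (d + 1)) : O y 𝒰 N 2 2 fun c z => c.gradRes z b.succ := by
  have h1 := (O_f_add (d := d) (B := B) (δ := δ) (y := y) (N := N)).mulO (O_hatG_ra b)
  have h2 := (O_y_cos_f_sq (d := d) (y := y) (B := B) (δ := δ) (N := N)).mulO (O_hatG_ab' (B := B) 0 b)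
  refine ((h1.mono' (a' := 2) (b' := 2) (by norm_num) (by norm_num)).sub
    (h2.mono' (a' := 2) (b' := 2) (by norm_num) (by norm_num))).congr fun c z hz => ?_
  have h0 := c.pos z hz.1
  rw [gradRes_eq, pd_fC_succ (c.small_subset δ hz), scale_succ, grz_zero]
  field_simp
  ring

omit hδ in
theorem sum_grad_sub_mul (c : CoordData d y B) {z : Fin (d + 2) → ℝ} (hz : z ∈ c.small δ)
    (m : Fin (d + 2)) :
    ∑ l, (c.grad z l - gradLead y z l) * hat z (c.G z) l m = c.gradRes z m := by
  simp only [sub_mul, Finset.sum_sub_distrib, c.sum_grad_mul hz]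
  rfl

/-- The gradient differs from its leading part by the defect multiplied by the inverse metric. -/
theorem O_grad_sub (l : Fin (d + 2)) : O y 𝒰 N 2 2 fun c z => c.grad z l - gradLead y z l := by
  have hres : ∀ m, O y 𝒰 N 2 2 fun c z => c.gradRes z m := fun m => by
    refine Fin.cases ?_ (fun a => ?_) m
    · exact O_gradRes_r.mono' (by norm_num) (by norm_num)
    · exact O_gradRes_a a
  have h : O y 𝒰 N 2 2 fun c z => ∑ m, c.gradRes z m * (hat z (c.G z))⁻¹ m l :=
    Ord.sumO fun m _ => ((hres m).mulO (O_hatG_inv m l)).mono' (by norm_num) (by norm_num)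
  refine h.congr fun c z hz => ?_
  have hinv : hat z (c.G z) * (hat z (c.G z))⁻¹ = 1 :=
    Matrix.mul_nonsing_inv _ (isUnit_iff_ne_zero.2 (c.det_hat_ne_zero hz))
  simp only [← c.sum_grad_sub_mul hz, Finset.sum_mul]
  rw [Finset.sum_comm]
  simp only [mul_assoc, ← Finset.mul_sum, ← Matrix.mul_apply, hinv]
  simp [Matrix.one_apply]

/-- The radial component of the gradient is known to a higher order than the others, because the
mixed components of the metric are of higher order. -/
theorem O_grad_r : O y 𝒰 N 3 1 fun c z => c.grad z 0 + (fC y z + (z 0)⁻¹ ^ 2 * fC y z) := by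
  have h1 := (O_grad_sub (B := B) (δ := δ) (N := N) (y := y) (d := d) 0).mulO O_hatG_rr'
  have h2 : O y 𝒰 N 3 1 fun c z => ∑ a : Fin (d + 1),
      (c.grad z a.succ - gradLead y z a.succ) * hat z (c.G z) a.succ 0 :=
    Ord.sumO fun a _ => ((O_grad_sub _).mulO (O_hatG_ar a)).mono' (by norm_num) (by norm_num)
  refine ((O_gradRes_r.sub (h1.mono' (a' := 3) (b' := 1) (by norm_num) (by norm_num))).sub
    h2).congr fun c z hz => ?_
  have e := c.sum_grad_sub_mul hz 0
  rw [Fin.sum_univ_succ] at e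
  rw [← e]
  simp only [gradLead, Fin.cons_zero]
  ring

theorem O_grad_r' : O y 𝒰 N 0 1 fun c z => c.grad z 0 :=
  ((O_grad_r.mono' (a' := 0) (b' := 1) (by norm_num) (by norm_num)).sub O_f_add).congr
    fun c z _ => by ring

theorem O_grad_a (a : Fin (d + 1)) : O y 𝒰 N 2 2 fun c z =>
    c.grad z a.succ - y * Real.cos (y * z 1) * fC y z ^ 2 * Segment.dtI a :=
  O_grad_sub a.succ

theorem O_grad_a' (a : Fin (d + 1)) : O y 𝒰 N 0 2 fun c z => c.grad z a.succ :=
  (((O_grad_a a).mono' (a' := 0) (b' := 2) (by norm_num) (by norm_num)).add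
    (O_y_cos_f_sq.const_mul (Segment.dtI a))).congr fun c z _ => by ring

/-! ### The Hessian of `f` -/

/-- The components of the Hessian of `f` in the scaled frame. -/
def H (c : CoordData d y B) (z : Fin (d + 2) → ℝ) : Matrix (Fin (d + 2)) (Fin (d + 2)) ℝ :=
  hat z (hessian c.G (fC y) z)

omit hδ hnd in
theorem H_eq (c : CoordData d y B) {z : Fin (d + 2) → ℝ} (hz : z ∈ c.dom)
    (α β : Fin (d + 2)) : c.H z α β = scale z α * scale z β * pd α (pd β (fC y)) z
      - ∑ l, c.Gam z l α β * c.grad z l := by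
  simp only [H, hat, hessian, Matrix.of_apply, mul_sub]
  congr 1
  simp only [christoffel, Finset.mul_sum, Finset.sum_mul, grad]
  rw [Finset.sum_comm]
  refine Finset.sum_congr rfl fun l _ => Finset.sum_congr rfl fun k _ => ?_
  have := scale_ne_zero (c.pos z hz) l
  simp only [Gam, D]
  field_simp

omit hδ hnd in
theorem H_symm (c : CoordData d y B) {z : Fin (d + 2) → ℝ} (hz : z ∈ c.dom)
    (α β : Fin (d + 2)) : c.H z α β = c.H z β α := by
  have hz' : z ∈ region d y := ⟨c.pos z hz, c.sin_pos z hz⟩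
  have e : pd α (pd β (fC y)) z = pd β (pd α (fC y)) z := by
    refine Fin.cases (Fin.cases ?_ (fun j => ?_) β) (fun i => Fin.cases ?_ (fun j => ?_) β) α
    · rfl
    · rw [pd_pd_fC_succ_zero hz', pd_pd_fC_zero_succ hz']
    · rw [pd_pd_fC_succ_zero hz', pd_pd_fC_zero_succ hz']
    · rw [pd_pd_fC_succ_succ hz', pd_pd_fC_succ_succ hz', mul_comm (Segment.dtI i)]
  rw [c.H_eq hz, c.H_eq hz, e, mul_comm (scale z α)]
  simp only [c.Gam_symm hz _ α β]

theorem O_H_rr : O y 𝒰 N 2 1 fun c z => c.H z 0 0 - fC y z := by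
  have h1 := (O_Gam_r_rr (δ := δ) (N := N)).mulO (O_grad_r' (d := d) (y := y) (B := B))
  have h2 : O y 𝒰 N 2 1 fun c z => ∑ a : Fin (d + 1), c.Gam z a.succ 0 0 * c.grad z a.succ :=
    Ord.sumO fun a _ => ((O_Gam_c_rr a).mulO (O_grad_a' a)).mono' (by norm_num) (by norm_num)
  have h3 := (O_rho.mulO O_rho).mulO (O_f (y := y) (U := 𝒰) (N := N))
  refine ((((O_grad_r.mono' (a' := 2) (b' := 1) (by norm_num) (by norm_num)).sub
    (h1.mono' (a' := 2) (b' := 1) (by norm_num) (by norm_num))).sub h2).sub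
    (h3.mono' (a' := 2) (b' := 1) (by norm_num) (by norm_num))).congr fun c z hz => ?_
  have h0 := c.pos z hz.1
  rw [c.H_eq hz.1, Fin.sum_univ_succ, pd_pd_fC_zero_zero (c.small_subset δ hz)]
  simp only [scale_zero]
  field_simp
  ring

theorem O_H_ra (a : Fin (d + 1)) : O y 𝒰 N 2 2 fun c z =>
    c.H z 0 a.succ - 2 * (y * Real.cos (y * z 1) * fC y z ^ 2) * Segment.dtI a := by
  have h1 := (O_Gam_r_ra (δ := δ) (N := N) a).mulO (O_grad_r' (d := d) (y := y) (B := B))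
  have h2 : O y 𝒰 N 2 2 fun c z => ∑ e : Fin (d + 1),
      (c.Gam z e.succ 0 a.succ - c.grz z e a) * c.grad z e.succ :=
    Ord.sumO fun e _ => ((O_Gam_c_ra e a).mulO (O_grad_a' e)).mono' (by norm_num) (by norm_num)
  have h3 : O y 𝒰 N 2 2 fun c z => ∑ e : Fin (d + 1), c.grz z e a *
      (c.grad z e.succ - y * Real.cos (y * z 1) * fC y z ^ 2 * Segment.dtI e) :=
    Ord.sumO fun e _ => ((O_grz e a).mulO (O_grad_a e)).mono' (by norm_num) (by norm_num)
  refine (((h1.mono' (a' := 2) (b' := 2) (by norm_num) (by norm_num)).add h2).add h3).neg.congr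
    fun c z hz => ?_
  have h0 := c.pos z hz.1
  have e : ∑ e : Fin (d + 1), c.grz z e a *
      (y * Real.cos (y * z 1) * fC y z ^ 2 * Segment.dtI e)
      = -(y * Real.cos (y * z 1) * fC y z ^ 2 * Segment.dtI a) := by
    have := sum_dtI_mul fun e => c.grz z e a * (y * Real.cos (y * z 1) * fC y z ^ 2)
    rw [grz_zero] at this
    rw [← neg_mul_eq_neg_mul] at this
    calc _ = _ := Finset.sum_congr rfl fun e _ => by ring
      _ = _ := this
      _ = _ := by ring
  rw [c.H_eq hz.1, Fin.sum_univ_succ, pd_pd_fC_zero_succ (c.small_subset δ hz)]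
  simp only [mul_sub, sub_mul, Finset.sum_sub_distrib, e]
  simp only [scale_zero, scale_succ]
  field_simp
  ring

theorem O_H_ab (a b : Fin (d + 1)) : O y 𝒰 N 3 1 fun c z => c.H z a.succ b.succ -
    ((y ^ 2 * fC y z * (z 0)⁻¹ ^ 2 + 2 * y ^ 2 * Real.cos (y * z 1) ^ 2 * fC y z ^ 3) *
      (Segment.dtI a * Segment.dtI b) - c.grz z a b * (fC y z + (z 0)⁻¹ ^ 2 * fC y z)) := by
  have h1 := (O_Gam_r_ab (δ := δ) (N := N) a b).mulO (O_grad_r' (d := d) (y := y) (B := B))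
  have h2 := (O_grz (δ := δ) (N := N) a b).mulO (O_grad_r (d := d) (y := y) (B := B))
  have h3 : O y 𝒰 N 3 1 fun c z => ∑ e : Fin (d + 1), c.Gam z e.succ a.succ b.succ *
      (c.grad z e.succ - y * Real.cos (y * z 1) * fC y z ^ 2 * Segment.dtI e) :=
    Ord.sumO fun e _ => ((O_Gam_c_ab e a b).mulO (O_grad_a e)).mono' (by norm_num) (by norm_num)
  have h4 := (O_Gam_t_ab (δ := δ) (N := N) (B := B) (y := y) a b).mulO O_y_cos_f_sq
  refine ((((h2.mono' (a' := 3) (b' := 1) (by norm_num) (by norm_num)).sub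
    (h1.mono' (a' := 3) (b' := 1) (by norm_num) (by norm_num))).sub h3).sub
    (h4.mono' (a' := 3) (b' := 1) (by norm_num) (by norm_num))).congr fun c z hz => ?_
  have h0 := c.pos z hz.1
  have e : ∑ e : Fin (d + 1), c.Gam z e.succ a.succ b.succ *
      (y * Real.cos (y * z 1) * fC y z ^ 2 * Segment.dtI e)
      = c.Gam z (Fin.succ 0) a.succ b.succ * (y * Real.cos (y * z 1) * fC y z ^ 2) := by
    rw [← sum_dtI_mul fun e => c.Gam z e.succ a.succ b.succ *
      (y * Real.cos (y * z 1) * fC y z ^ 2)]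
    exact Finset.sum_congr rfl fun e _ => by ring
  rw [c.H_eq hz.1, Fin.sum_univ_succ, pd_pd_fC_succ_succ (c.small_subset δ hz)]
  simp only [mul_sub, Finset.sum_sub_distrib, e]
  simp only [scale_succ]
  field_simp
  ring

/-! ### The form `∇²f + f g` -/

/-- The components of `∇²f + f g` in the scaled frame. In this combination the leading parts of
`∇²f` cancel in the directions tangent to the level sets of `f`. -/
def K (c : CoordData d y B) (z : Fin (d + 2) → ℝ) : Matrix (Fin (d + 2)) (Fin (d + 2)) ℝ :=
  c.H z + fC y z • hat z (c.G z)

theorem O_K_rr : O y 𝒰 N 2 1 fun c z => c.K z 0 0 - 2 * fC y z :=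
  (O_H_rr.add ((O_f.mulO O_hatG_rr').mono' (a' := 2) (b' := 1) (by norm_num)
    (by norm_num))).congr fun c z _ => by simp [K]; ring

theorem O_K_ra (a : Fin (d + 1)) : O y 𝒰 N 2 2 fun c z =>
    c.K z 0 a.succ - 2 * (y * Real.cos (y * z 1) * fC y z ^ 2) * Segment.dtI a :=
  ((O_H_ra a).add ((O_f.mulO (O_hatG_ra a)).mono' (a' := 2) (b' := 2) (by norm_num)
    (by norm_num))).congr fun c z _ => by simp [K]; ring

omit hδ hnd in
theorem K_symm (c : CoordData d y B) {z : Fin (d + 2) → ℝ} (hz : z ∈ c.dom)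
    (α β : Fin (d + 2)) : c.K z α β = c.K z β α := by
  simp only [K, Matrix.add_apply, Matrix.smul_apply, c.H_symm hz α β, hat, Matrix.of_apply,
    c.G_symm z hz α β, mul_comm (scale z α)]

theorem O_K_ar (a : Fin (d + 1)) : O y 𝒰 N 2 2 fun c z =>
    c.K z a.succ 0 - 2 * (y * Real.cos (y * z 1) * fC y z ^ 2) * Segment.dtI a :=
  (O_K_ra a).congr fun c z hz => by rw [c.K_symm hz.1]

theorem O_K_ab (a b : Fin (d + 1)) : O y 𝒰 N 3 1 fun c z => c.K z a.succ b.succ -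
    ((y ^ 2 * fC y z * (z 0)⁻¹ ^ 2 + 2 * y ^ 2 * Real.cos (y * z 1) ^ 2 * fC y z ^ 3) *
      (Segment.dtI a * Segment.dtI b) - (z 0)⁻¹ ^ 2 * fC y z * c.grz z a b
      + (z 0)⁻¹ ^ 2 * fC y z * c.gbz z a b) :=
  ((O_H_ab a b).add ((O_f.mulO (O_hatG_ab a b)).mono' (a' := 3) (b' := 1) (by norm_num)
    (by norm_num))).congr fun c z _ => by simp [K]; ring

end CoordData


/-! ### Bilinear forms in components -/

section Bil

open Matrix

variable {m : ℕ} (M M' : Matrix (Fin m) (Fin m) ℝ) (u u' v v' : Fin m → ℝ)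

theorem bil_eq_dotProduct : bil M u v = u ⬝ᵥ (M *ᵥ v) := by
  simp only [bil, dotProduct, mulVec, Finset.mul_sum]
  exact Finset.sum_congr rfl fun i _ => Finset.sum_congr rfl fun j _ => by ring

theorem bil_sub_left : bil M (u - u') v = bil M u v - bil M u' v := by
  simp only [bil_eq_dotProduct, sub_dotProduct]

theorem bil_add_left : bil M (u + u') v = bil M u v + bil M u' v := by
  simp only [bil_eq_dotProduct, add_dotProduct]

theorem bil_add_right : bil M u (v + v') = bil M u v + bil M u v' := by
  simp only [bil_eq_dotProduct, mulVec_add, dotProduct_add]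

theorem bil_sub_right : bil M u (v - v') = bil M u v - bil M u v' := by
  simp only [bil_eq_dotProduct, mulVec_sub, dotProduct_sub]

theorem bil_smul_left (k : ℝ) : bil M (k • u) v = k * bil M u v := by
  simp only [bil_eq_dotProduct, smul_dotProduct, smul_eq_mul]

theorem bil_smul_right (k : ℝ) : bil M u (k • v) = k * bil M u v := by
  simp only [bil_eq_dotProduct, mulVec_smul, dotProduct_smul, smul_eq_mul]

theorem bil_sum_left {κ : Type*} (s : Finset κ) (w : κ → Fin m → ℝ) :
    bil M (∑ k ∈ s, w k) v = ∑ k ∈ s, bil M (w k) v := by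
  simp only [bil_eq_dotProduct, sum_dotProduct]

theorem bil_sum_right {κ : Type*} (s : Finset κ) (w : κ → Fin m → ℝ) :
    bil M u (∑ k ∈ s, w k) = ∑ k ∈ s, bil M u (w k) := by
  simp only [bil_eq_dotProduct, mulVec_sum, dotProduct_sum]

theorem bil_add_matrix : bil (M + M') u v = bil M u v + bil M' u v := by
  simp only [bil_eq_dotProduct, add_mulVec, dotProduct_add]

theorem bil_smul_matrix (k : ℝ) : bil (k • M) u v = k * bil M u v := by
  simp only [bil_eq_dotProduct, smul_mulVec, dotProduct_smul, smul_eq_mul]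

theorem bil_neg_matrix : bil (-M) u v = -bil M u v := by
  simp only [bil_eq_dotProduct, neg_mulVec, dotProduct_neg]

theorem bil_symm (h : ∀ i j, M i j = M j i) : bil M u v = bil M v u := by
  simp only [bil]
  rw [Finset.sum_comm]
  exact Finset.sum_congr rfl fun i _ => Finset.sum_congr rfl fun j _ => by rw [h]; ring

/-- Splitting off the radial components. -/
theorem bil_cons {d : ℕ} (M : Matrix (Fin (d + 2)) (Fin (d + 2)) ℝ) (x y : ℝ)
    (u v : Fin (d + 1) → ℝ) : bil M (Fin.cons x u) (Fin.cons y v) =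
      M 0 0 * x * y + x * (∑ b, M 0 b.succ * v b) + y * (∑ a, M a.succ 0 * u a)
        + bil (M.submatrix Fin.succ Fin.succ) u v := by
  simp only [bil, Fin.sum_univ_succ (n := d + 1), Fin.cons_zero, Fin.cons_succ,
    Finset.sum_add_distrib, submatrix_apply, Finset.mul_sum]
  have e1 : ∀ b : Fin (d + 1), M 0 b.succ * x * v b = x * (M 0 b.succ * v b) := fun b => by ring
  have e2 : ∀ a : Fin (d + 1), M a.succ 0 * u a * y = y * (M a.succ 0 * u a) := fun b => by ring
  simp only [e1, e2]
  ring

theorem bil_dtI_left {d : ℕ} (M : Matrix (Fin (d + 1)) (Fin (d + 1)) ℝ) (v : Fin (d + 1) → ℝ) :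
    bil M Segment.dtI v = ∑ b, M 0 b * v b := by
  simp only [bil]
  rw [Finset.sum_comm]
  refine Finset.sum_congr rfl fun b _ => ?_
  rw [← sum_dtI_mul fun a => M a b * v b]
  exact Finset.sum_congr rfl fun a _ => by ring

theorem sum_mul_dtI {d : ℕ} (X : Fin (d + 1) → ℝ) : ∑ a, X a * Segment.dtI a = X 0 := by
  rw [← sum_dtI_mul X]
  exact Finset.sum_congr rfl fun a _ => mul_comm _ _

theorem bil_dtI_dtI {d : ℕ} (M : Matrix (Fin (d + 1)) (Fin (d + 1)) ℝ) :
    bil M Segment.dtI Segment.dtI = M 0 0 := by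
  rw [bil_dtI_left, sum_mul_dtI]

/-- Values of a bilinear form computed in the scaled frame. -/
theorem bil_eq_bil_hat {d : ℕ} {z : Fin (d + 2) → ℝ} (hz : 0 < z 0)
    (M : Matrix (Fin (d + 2)) (Fin (d + 2)) ℝ) {u v u' v' : Fin (d + 2) → ℝ}
    (hu : ∀ α, u α = scale z α * u' α) (hv : ∀ α, v α = scale z α * v' α) :
    bil M u v = bil (hat z M) u' v' := by
  simp only [bil, hat, Matrix.of_apply, hu, hv]
  exact Finset.sum_congr rfl fun i _ => Finset.sum_congr rfl fun j _ => by ring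

end Bil

/-! ### Frames and the vector field `T` -/

section Frames

variable {d : ℕ} {y : ℝ} {B : ℕ → ℕ → ℝ}

/-- The components of the vector `T̄`. -/
def tbar (y : ℝ) (z : Fin (d + 2) → ℝ) : Fin (d + 2) → ℝ :=
  Fin.cons (y * fC y z * Real.cos (y * z 1) * (-(z 0) ^ 2)) (Fin.cons 1 fun _ => 0)

namespace CoordData

/-- The components of the vector `T̃`. -/
def ttilde (c : CoordData d y B) (z : Fin (d + 2) → ℝ) (E : Fin d → Fin d → ℝ) :
    Fin (d + 2) → ℝ :=
  tbar y z - ∑ i, bil (c.G z) (tbar y z) (Segment.vecS (E i)) • Segment.vecS (E i)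

/-- The components of the vector `T`. -/
def tvec (c : CoordData d y B) (z : Fin (d + 2) → ℝ) (E : Fin d → Fin d → ℝ) :
    Fin (d + 2) → ℝ :=
  (Real.sqrt |bil (c.G z) (c.ttilde z E) (c.ttilde z E)|)⁻¹ • c.ttilde z E

/-- The components of `-(∇²f + w_ζ g)` at a point where `ζ` has the value `s`. -/
def formC (c : CoordData d y B) (s : ℝ) (z : Fin (d + 2) → ℝ) :
    Matrix (Fin (d + 2)) (Fin (d + 2)) ℝ :=
  -(hessian c.G (fC y) z + (fC y z + fC y z * (z 0)⁻¹ ^ 2 + fC y z * (z 0)⁻¹ ^ 2 * s) • c.G z)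

/-- The error term of `-(∇²f + w_ζ g)(E_i, E_j)`. -/
def errEE (c : CoordData d y B) (s : ℝ) (E : Fin d → Fin d → ℝ) (i j : Fin d)
    (z : Fin (d + 2) → ℝ) : ℝ :=
  bil (c.formC s z) (Segment.vecS (E i)) (Segment.vecS (E j))
    - -(fC y z * (z 0)⁻¹ ^ 2 * (bil (c.gbz z) (Segment.rE z (E i)) (Segment.rE z (E j))
          + s * bil (c.grz z) (Segment.rE z (E i)) (Segment.rE z (E j))))

/-- The error term of `-(∇²f + w_ζ g)(T, E_i)`. -/
def errTE (c : CoordData d y B) (s : ℝ) (E : Fin d → Fin d → ℝ) (i : Fin d)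
    (z : Fin (d + 2) → ℝ) : ℝ :=
  bil (c.formC s z) (c.tvec z E) (Segment.vecS (E i))
    - -(fC y z * (z 0)⁻¹ ^ 2 * (bil (c.gbz z) Segment.dtI (Segment.rE z (E i))
          + s * bil (c.grz z) Segment.dtI (Segment.rE z (E i))))

/-- The error term of `-(∇²f + w_ζ g)(T, T)`. -/
def errTT (c : CoordData d y B) (s : ℝ) (E : Fin d → Fin d → ℝ) (z : Fin (d + 2) → ℝ) : ℝ :=
  bil (c.formC s z) (c.tvec z E) (c.tvec z E)
    - -(fC y z * (z 0)⁻¹ ^ 2 * (bil (c.gbz z) Segment.dtI Segment.dtI + y ^ 2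
          + s * bil (c.grz z) Segment.dtI Segment.dtI))

end CoordData

/-- The components of `E_i` in the scaled frame. -/
def eh (z : Fin (d + 2) → ℝ) (v : Fin d → ℝ) : Fin (d + 2) → ℝ := Fin.cons 0 (Segment.rE z v)

/-- The components of `ρ T̄` in the scaled frame. -/
def th (y : ℝ) (z : Fin (d + 2) → ℝ) : Fin (d + 2) → ℝ :=
  Fin.cons (-(y * Real.cos (y * z 1) * fC y z)) Segment.dtI

theorem vecS_eq {z : Fin (d + 2) → ℝ} (hz : 0 < z 0) (v : Fin d → ℝ) (α : Fin (d + 2)) :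
    Segment.vecS v α = scale z α * eh z v α := by
  refine Fin.cases ?_ (fun a => Fin.cases ?_ (fun j => ?_) a) α
  · simp [Segment.vecS, eh]
  · simp [Segment.vecS, eh, Segment.rE]
  · simp [Segment.vecS, eh, Segment.rE, hz.ne']

theorem tbar_eq {z : Fin (d + 2) → ℝ} (hz : 0 < z 0) (α : Fin (d + 2)) :
    tbar y z α = scale z α * (z 0 • th y z) α := by
  refine Fin.cases ?_ (fun a => Fin.cases ?_ (fun j => ?_) a) α
  · simp [tbar, th]; ring
  · change (1 : ℝ) = (z 0)⁻¹ * (z 0 * 1)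
    field_simp
  · simp [tbar, th, dtI_succ]

namespace CoordData

variable (c : CoordData d y B) (z : Fin (d + 2) → ℝ) (E : Fin d → Fin d → ℝ)

/-- The component `g(ρ T̄, E_i)`. -/
def tau (i : Fin d) : ℝ := bil (hat z (c.G z)) (th y z) (eh z (E i))

/-- The components of `ρ T̃` in the scaled frame. -/
def tth : Fin (d + 2) → ℝ := th y z - ∑ i, c.tau z E i • eh z (E i)

/-- The square `-g(ρ T̃, ρ T̃)`. -/
def nn : ℝ := -bil (hat z (c.G z)) (c.tth z E) (c.tth z E)

variable {c z E}

theorem ttilde_eq (hz : 0 < z 0) (α : Fin (d + 2)) :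
    c.ttilde z E α = scale z α * (z 0 • c.tth z E) α := by
  have e : ∀ i, bil (c.G z) (tbar y z) (Segment.vecS (E i)) = z 0 * c.tau z E i := fun i => by
    rw [bil_eq_bil_hat hz _ (tbar_eq hz) (vecS_eq hz (E i)), bil_smul_left]; rfl
  simp only [ttilde, tth, e, Pi.sub_apply, Finset.sum_apply, Pi.smul_apply, smul_eq_mul,
    vecS_eq hz, tbar_eq hz, mul_sub, Finset.mul_sum]
  congr 1
  exact Finset.sum_congr rfl fun i _ => by ring

theorem tvec_eq (hz : 0 < z 0) (hn : 0 < c.nn z E) (α : Fin (d + 2)) :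
    c.tvec z E α = scale z α * ((Real.sqrt (c.nn z E))⁻¹ • c.tth z E) α := by
  have e : |bil (c.G z) (c.ttilde z E) (c.ttilde z E)| = z 0 ^ 2 * c.nn z E := by
    rw [bil_eq_bil_hat hz _ (ttilde_eq hz) (ttilde_eq hz), bil_smul_left, bil_smul_right]
    have : bil (hat z (c.G z)) (c.tth z E) (c.tth z E) = -c.nn z E := by rw [nn, neg_neg]
    rw [this, ← mul_assoc, mul_neg, abs_neg, abs_of_pos (by positivity), sq]
  rw [tvec, e, Real.sqrt_mul (by positivity), Real.sqrt_sq hz.le]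
  simp only [Pi.smul_apply, smul_eq_mul, ttilde_eq hz]
  have := Real.sqrt_pos.2 hn
  field_simp

/-- `-(∇²f + w_ζ g)` in terms of `∇²f + f g`. -/
theorem bil_formC (hz : 0 < z 0) (s : ℝ) {u v u' v' : Fin (d + 2) → ℝ}
    (hu : ∀ α, u α = scale z α * u' α) (hv : ∀ α, v α = scale z α * v' α) :
    bil (c.formC s z) u v = -(bil (c.K z) u' v'
      + fC y z * (z 0)⁻¹ ^ 2 * (1 + s) * bil (hat z (c.G z)) u' v') := by
  rw [formC, bil_neg_matrix, bil_add_matrix, bil_smul_matrix, bil_eq_bil_hat hz _ hu hv,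
    bil_eq_bil_hat hz _ hu hv, K, bil_add_matrix, bil_smul_matrix, H]
  ring

/-- The vectors `E_i` are orthonormal. -/
def Orth (c : CoordData d y B) (z : Fin (d + 2) → ℝ) (E : Fin d → Fin d → ℝ) : Prop :=
  ∀ i j, bil (c.G z) (Segment.vecS (E i)) (Segment.vecS (E j)) = if i = j then 1 else 0

theorem Orth.hat (h : c.Orth z E) (hz : 0 < z 0) (i j : Fin d) :
    bil (hat z (c.G z)) (eh z (E i)) (eh z (E j)) = if i = j then 1 else 0 := by
  rw [← h i j, bil_eq_bil_hat hz _ (vecS_eq hz _) (vecS_eq hz _)]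

theorem hatG_symm (hz : z ∈ c.dom) (α β : Fin (d + 2)) :
    hat z (c.G z) α β = hat z (c.G z) β α := by
  simp only [AAdS.hat, Matrix.of_apply, c.G_symm z hz α β, mul_comm (scale z α)]

theorem bil_tth_left (M : Matrix (Fin (d + 2)) (Fin (d + 2)) ℝ) (v : Fin (d + 2) → ℝ) :
    bil M (c.tth z E) v = bil M (th y z) v - ∑ i, c.tau z E i * bil M (eh z (E i)) v := by
  simp only [tth, bil_sub_left, bil_sum_left, bil_smul_left]

theorem bil_tth_right (M : Matrix (Fin (d + 2)) (Fin (d + 2)) ℝ) (v : Fin (d + 2) → ℝ) :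
    bil M v (c.tth z E) = bil M v (th y z) - ∑ i, c.tau z E i * bil M v (eh z (E i)) := by
  simp only [tth, bil_sub_right, bil_sum_right, bil_smul_right]

theorem Orth.bil_tth_eh (h : c.Orth z E) (hz : 0 < z 0) (j : Fin d) :
    bil (AAdS.hat z (c.G z)) (c.tth z E) (eh z (E j)) = 0 := by
  rw [bil_tth_left]
  simp [h.hat hz, tau]

theorem Orth.nn_eq (h : c.Orth z E) (hz : z ∈ c.dom) :
    c.nn z E = -bil (AAdS.hat z (c.G z)) (th y z) (th y z) + ∑ i, c.tau z E i * c.tau z E i := by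
  have e : ∀ i, bil (AAdS.hat z (c.G z)) (eh z (E i)) (th y z) = c.tau z E i := fun i => by
    rw [bil_symm _ _ _ (hatG_symm hz)]; rfl
  rw [nn, bil_tth_right]
  simp only [h.bil_tth_eh (c.pos z hz), mul_zero, Finset.sum_const_zero, sub_zero]
  rw [bil_tth_left]
  simp only [e]
  ring

end CoordData

end Frames

/-! ### The error terms along families of frames -/

/-- A family of orthonormal frames. Frames on open sets and frames at single points are treated
alike. -/
structure FrameFamily (κ : Type*) (d : ℕ) (y : ℝ) (B : ℕ → ℕ → ℝ) (δ : ℝ) where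
  c : κ → CoordData d y B
  V : κ → Set (Fin (d + 2) → ℝ)
  sub : ∀ k, V k ⊆ (c k).small δ
  E : κ → (Fin (d + 2) → ℝ) → Fin d → Fin d → ℝ
  orth : ∀ k, ∀ z ∈ V k, (c k).Orth z (E k z)

namespace FrameFamily

variable {κ : Type*} {d : ℕ} {y : ℝ} {B : ℕ → ℕ → ℝ} {δ : ℝ} [hδ : Fact (δ ≤ 1)]
  [hnd : CoordData.Nondeg d y B δ] {N : ℕ}
  (F : FrameFamily κ d y B δ) [Region F.V N]

omit hnd in
theorem inside (F : FrameFamily κ d y B δ) : Inside y F.V where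
  pos k z hz := (F.c k).pos z (F.sub k hz).1
  sin_pos k z hz := (F.c k).sin_pos z (F.sub k hz).1
  lt_one k z hz := (F.sub k hz).2.trans_le hδ.out

attribute [instance] inside

omit hδ hnd in
theorem pos {k : κ} {z : Fin (d + 2) → ℝ} (hz : z ∈ F.V k) : 0 < z 0 :=
  (F.c k).pos z (F.sub k hz).1

omit hδ hnd [Region F.V N] in
/-- Estimates for coordinate expressions of metrics hold along a family of frames. -/
theorem pull {a b : ℤ} {ξ : CoordData d y B → (Fin (d + 2) → ℝ) → ℝ}
    (h : O y (CoordData.small (d := d) (y := y) (B := B) δ) N a b ξ) :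
    O y F.V N a b fun k z => ξ (F.c k) z :=
  h.comap F.c F.sub

omit hnd in
theorem O_rE (hE : ∀ i j, O y F.V N 1 0 fun k z => F.E k z i j) (i : Fin d) (a : Fin (d + 1)) :
    O y F.V N 0 0 fun k z => Segment.rE z (F.E k z i) a := by
  refine Fin.cases ?_ (fun j => ?_) a
  · exact O_zero 0 0
  · exact O_r.mulO (hE i j)

omit hnd in
theorem O_bil {ι : Type*} {V : ι → Set (Fin (d + 2) → ℝ)} [Inside y V] [Region V N] {m : ℕ}
    {a b : ℤ} {M : ι → (Fin (d + 2) → ℝ) → Matrix (Fin m) (Fin m) ℝ}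
    {u v : ι → (Fin (d + 2) → ℝ) → Fin m → ℝ} (hM : ∀ i j, O y V N a b fun k z => M k z i j)
    (hu : ∀ i, O y V N 0 0 fun k z => u k z i) (hv : ∀ i, O y V N 0 0 fun k z => v k z i) :
    O y V N a b fun k z => bil (M k z) (u k z) (v k z) :=
  Ord.sumO fun i _ => Ord.sumO fun j _ =>
    (((hM i j).mulO (hu i)).mulO (hv j)).mono' (by omega) (by omega)

omit hδ hnd in
theorem rE_zero (z : Fin (d + 2) → ℝ) (v : Fin d → ℝ) : Segment.rE z v 0 = 0 := rfl

end FrameFamily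


namespace FrameFamily

variable {κ : Type*} {d : ℕ} {y : ℝ} {B : ℕ → ℕ → ℝ} {δ : ℝ} [hδ : Fact (δ ≤ 1)]
  {N : ℕ} (F : FrameFamily κ d y B δ) [Region F.V N]

theorem O_th_r : O y F.V N 0 1 fun _ z => y * Real.cos (y * z 1) * fC y z :=
  (O_cos.const_mul y).mulO O_f

theorem bil_eh_eh {d : ℕ} (M : Matrix (Fin (d + 2)) (Fin (d + 2)) ℝ) (z : Fin (d + 2) → ℝ)
    (u v : Fin d → ℝ) : bil M (eh z u) (eh z v)
      = bil (M.submatrix Fin.succ Fin.succ) (Segment.rE z u) (Segment.rE z v) := by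
  rw [eh, eh, bil_cons]; ring

theorem bil_th_eh {d : ℕ} (M : Matrix (Fin (d + 2)) (Fin (d + 2)) ℝ) (z : Fin (d + 2) → ℝ)
    (v : Fin d → ℝ) : bil M (th y z) (eh z v)
      = -(y * Real.cos (y * z 1) * fC y z) * ∑ b, M 0 b.succ * Segment.rE z v b
        + ∑ b : Fin (d + 1), M (Fin.succ 0) b.succ * Segment.rE z v b := by
  rw [th, eh, bil_cons, bil_dtI_left]; simp

theorem bil_th_th {d : ℕ} (M : Matrix (Fin (d + 2)) (Fin (d + 2)) ℝ) (z : Fin (d + 2) → ℝ) :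
    bil M (th y z) (th y z) = (y * Real.cos (y * z 1) * fC y z) ^ 2 * M 0 0
      - (y * Real.cos (y * z 1) * fC y z) * (M 0 (Fin.succ 0) + M (Fin.succ 0) 0)
      + M (Fin.succ 0) (Fin.succ 0) := by
  rw [th, bil_cons, bil_dtI_dtI, sum_mul_dtI, sum_mul_dtI]
  simp; ring

theorem sum_dtI_mul_rE {d : ℕ} (z : Fin (d + 2) → ℝ) (v : Fin d → ℝ) :
    ∑ b, Segment.dtI b * Segment.rE z v b = 0 := sum_dtI_mul _

/-! ### Values of the metric on the frame -/

theorem O_hatG_TT : O y F.V N 0 2 fun k z => bil (hat z ((F.c k).G z)) (th y z) (th y z) + 1 := by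
  have hb := F.O_th_r (N := N)
  have h1 := (hb.mulO hb).mulO (F.pull (CoordData.O_hatG (N := N) 0 0))
  have h2 := hb.mulO (F.pull ((CoordData.O_hatG_ra (N := N) 0).add (CoordData.O_hatG_ar 0)))
  have h3 := F.pull (CoordData.O_hatG_ab' (N := N) 0 0)
  refine (((h1.mono' (a' := 0) (b' := 2) (by norm_num) (by norm_num)).sub
    (h2.mono' (a' := 0) (b' := 2) (by norm_num) (by norm_num))).add
    (h3.mono' (a' := 0) (b' := 2) (by norm_num) (by norm_num))).congr fun k z hz => ?_
  rw [bil_th_th, CoordData.grz_zero, dtI_zero]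
  ring

theorem O_tau (hE : ∀ i j, O y F.V N 1 0 fun k z => F.E k z i j) (i : Fin d) :
    O y F.V N 2 0 fun k z => (F.c k).tau z (F.E k z) i := by
  have h1 : O y F.V N 3 0 fun k z =>
      ∑ b, hat z ((F.c k).G z) 0 b.succ * Segment.rE z (F.E k z i) b :=
    Ord.sumO fun b _ => ((F.pull (CoordData.O_hatG_ra b)).mulO (F.O_rE hE i b)).mono'
      (by norm_num) (by norm_num)
  have h2 : O y F.V N 2 0 fun k z => ∑ b : Fin (d + 1), (hat z ((F.c k).G z) (Fin.succ 0) b.succ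
      - (F.c k).grz z 0 b) * Segment.rE z (F.E k z i) b :=
    Ord.sumO fun b _ => ((F.pull (CoordData.O_hatG_ab' 0 b)).mulO (F.O_rE hE i b)).mono'
      (by norm_num) (by norm_num)
  refine (h2.sub (((F.O_th_r (N := N)).mulO h1).mono' (a' := 2) (b' := 0) (by norm_num)
    (by norm_num))).congr fun k z hz => ?_
  have e := sum_dtI_mul_rE z (F.E k z i)
  simp only [CoordData.tau, bil_th_eh, sub_mul, Finset.sum_sub_distrib, CoordData.grz_zero,
    neg_mul, Finset.sum_neg_distrib, e]
  ring

theorem O_hatG_EE (hE : ∀ i j, O y F.V N 1 0 fun k z => F.E k z i j) (i j : Fin d) :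
    O y F.V N 2 0 fun k z => bil (hat z ((F.c k).G z)) (eh z (F.E k z i)) (eh z (F.E k z j))
      - bil ((F.c k).grz z) (Segment.rE z (F.E k z i)) (Segment.rE z (F.E k z j)) := by
  have h := O_bil (V := F.V) (M := fun k z => (hat z ((F.c k).G z)).submatrix Fin.succ Fin.succ
    + (-1 : ℝ) • (F.c k).grz z) (a := 2) (b := 0) (N := N)
    (fun a b => (F.pull (CoordData.O_hatG_ab' a b)).congr fun k z _ => by simp; ring)
    (F.O_rE hE i) (F.O_rE hE j)
  refine h.congr fun k z hz => ?_
  rw [bil_eh_eh, bil_add_matrix, bil_smul_matrix]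
  ring

/-- The normalization of `T̃` is trivial to leading order. -/
theorem O_nn (hE : ∀ i j, O y F.V N 1 0 fun k z => F.E k z i j) :
    O y F.V N 0 2 fun k z => (F.c k).nn z (F.E k z) - 1 := by
  have h1 : O y F.V N 0 2 fun k z => ∑ i, (F.c k).tau z (F.E k z) i * (F.c k).tau z (F.E k z) i :=
    Ord.sumO fun i _ => ((F.O_tau hE i).mulO (F.O_tau hE i)).mono' (by norm_num) (by norm_num)
  refine (h1.sub F.O_hatG_TT).congr fun k z hz => ?_
  rw [(F.orth k z hz).nn_eq (F.sub k hz).1]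
  ring

/-! ### Values of `∇²f + f g` on the frame -/

variable [hnd : CoordData.Nondeg d y B δ]

theorem O_K_TE (hE : ∀ i j, O y F.V N 1 0 fun k z => F.E k z i j) (i : Fin d) :
    O y F.V N 2 2 fun k z => bil ((F.c k).K z) (th y z) (eh z (F.E k z i))
      - (z 0)⁻¹ ^ 2 * fC y z * bil ((F.c k).gbz z) Segment.dtI (Segment.rE z (F.E k z i)) := by
  have h1 : O y F.V N 2 2 fun k z => ∑ b : Fin (d + 1), ((F.c k).K z 0 b.succ
      - 2 * (y * Real.cos (y * z 1) * fC y z ^ 2) * Segment.dtI b) * Segment.rE z (F.E k z i) b :=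
    Ord.sumO fun b _ => ((F.pull (CoordData.O_K_ra b)).mulO (F.O_rE hE i b)).mono'
      (by norm_num) (by norm_num)
  have h2 : O y F.V N 2 2 fun k z => ∑ b : Fin (d + 1), _ * Segment.rE z (F.E k z i) b :=
    Ord.sumO fun b _ => ((F.pull (CoordData.O_K_ab 0 b)).mulO (F.O_rE hE i b)).mono'
      (by norm_num) (by norm_num)
  refine (h2.sub (((F.O_th_r (N := N)).mulO h1).mono' (a' := 2) (b' := 2) (by norm_num)
    (by norm_num))).congr fun k z hz => ?_
  have e := sum_dtI_mul_rE z (F.E k z i)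
  simp only [bil_th_eh, bil_dtI_left, CoordData.grz_zero, dtI_zero, one_mul, sub_mul, add_mul,
    mul_assoc, Finset.sum_sub_distrib, Finset.sum_add_distrib, ← Finset.mul_sum, neg_mul, mul_neg,
    Finset.sum_neg_distrib, e]
  ring

theorem O_K_EE (hE : ∀ i j, O y F.V N 1 0 fun k z => F.E k z i j) (i j : Fin d) :
    O y F.V N 3 1 fun k z => bil ((F.c k).K z) (eh z (F.E k z i)) (eh z (F.E k z j))
      + (z 0)⁻¹ ^ 2 * fC y z *
        bil ((F.c k).grz z) (Segment.rE z (F.E k z i)) (Segment.rE z (F.E k z j))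
      - (z 0)⁻¹ ^ 2 * fC y z *
        bil ((F.c k).gbz z) (Segment.rE z (F.E k z i)) (Segment.rE z (F.E k z j)) := by
  have h := O_bil (V := F.V) (a := 3) (b := 1) (N := N)
    (M := fun k z => ((F.c k).K z).submatrix Fin.succ Fin.succ
      + (-(y ^ 2 * fC y z * (z 0)⁻¹ ^ 2 + 2 * y ^ 2 * Real.cos (y * z 1) ^ 2 * fC y z ^ 3)) •
        Matrix.vecMulVec Segment.dtI Segment.dtI
      + ((z 0)⁻¹ ^ 2 * fC y z) • (F.c k).grz z + (-((z 0)⁻¹ ^ 2 * fC y z)) • (F.c k).gbz z)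
    (fun a b => (F.pull (CoordData.O_K_ab a b)).congr fun k z _ => by
      simp [Matrix.vecMulVec_apply]; ring)
    (F.O_rE hE i) (F.O_rE hE j)
  refine h.congr fun k z hz => ?_
  have e : bil (Matrix.vecMulVec Segment.dtI Segment.dtI) (Segment.rE z (F.E k z i))
      (Segment.rE z (F.E k z j)) = 0 := by
    simp only [bil, Matrix.vecMulVec_apply]
    rw [← zero_mul (0 : ℝ)]
    nth_rw 1 [← sum_dtI_mul_rE z (F.E k z i)]
    rw [← sum_dtI_mul_rE z (F.E k z j), Finset.sum_mul_sum]
    exact Finset.sum_congr rfl fun a _ => Finset.sum_congr rfl fun b _ => by ring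
  rw [bil_eh_eh, bil_add_matrix, bil_add_matrix, bil_add_matrix, bil_smul_matrix, bil_smul_matrix,
    bil_smul_matrix, e]
  ring

theorem O_K_EE' (hE : ∀ i j, O y F.V N 1 0 fun k z => F.E k z i j) (i j : Fin d) :
    O y F.V N 2 1 fun k z => bil ((F.c k).K z) (eh z (F.E k z i)) (eh z (F.E k z j)) := by
  have h1 := ((O_rho.mulO O_rho).mulO O_f).mulO (O_bil (V := F.V) (N := N)
    (fun a b => F.pull (CoordData.O_grz a b)) (F.O_rE hE i) (F.O_rE hE j))
  have h2 := ((O_rho.mulO O_rho).mulO O_f).mulO (O_bil (V := F.V) (N := N)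
    (fun a b => F.pull (CoordData.O_gbz a b)) (F.O_rE hE i) (F.O_rE hE j))
  refine ((((F.O_K_EE hE i j).mono' (a' := 2) (b' := 1) (by norm_num) (by norm_num)).sub
    (h1.mono' (a' := 2) (b' := 1) (by norm_num) (by norm_num))).add
    (h2.mono' (a' := 2) (b' := 1) (by norm_num) (by norm_num))).congr fun k z _ => by ring

theorem O_K_TE' (hE : ∀ i j, O y F.V N 1 0 fun k z => F.E k z i j) (i : Fin d) :
    O y F.V N 2 1 fun k z => bil ((F.c k).K z) (th y z) (eh z (F.E k z i)) := by
  have hdt : ∀ a : Fin (d + 1), O y F.V N 0 0 fun _ _ => Segment.dtI a := fun a => O_const _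
  have h2 := ((O_rho.mulO O_rho).mulO O_f).mulO (O_bil (V := F.V) (N := N)
    (u := fun _ _ => Segment.dtI)
    (fun a b => F.pull (CoordData.O_gbz a b)) hdt (F.O_rE hE i))
  refine (((F.O_K_TE hE i).mono' (a' := 2) (b' := 1) (by norm_num) (by norm_num)).add
    (h2.mono' (a' := 2) (b' := 1) (by norm_num) (by norm_num))).congr fun k z _ => by ring

/-- The weight `f ρ³ + f³ ρ²`. -/
def wTT (y : ℝ) (z : Fin (d + 2) → ℝ) : ℝ := mono y 3 1 z + mono y 2 3 z

omit hnd in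
theorem wTT_nonneg {k : κ} {z : Fin (d + 2) → ℝ} (hz : z ∈ F.V k) : 0 ≤ wTT y z :=
  add_nonneg (mono_pos _ _ hz).le (mono_pos _ _ hz).le

variable {F}

omit hnd in
theorem ord_wTT {ξ : κ → (Fin (d + 2) → ℝ) → ℝ} (h : O y F.V N 3 1 ξ) :
    Ord F.V N (wTT y) ξ :=
  h.weight 1 (fun k z hz => by
    rw [one_mul, wTT]; exact le_add_of_nonneg_right (mono_pos _ _ hz).le) fun _ _ hz =>
    F.wTT_nonneg hz

omit hnd in
theorem ord_wTT' {ξ : κ → (Fin (d + 2) → ℝ) → ℝ} (h : O y F.V N 2 3 ξ) :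
    Ord F.V N (wTT y) ξ :=
  h.weight 1 (fun k z hz => by
    rw [one_mul, wTT]; exact le_add_of_nonneg_left (mono_pos _ _ hz).le) fun _ _ hz =>
    F.wTT_nonneg hz

variable (F)

/-- The contributions `2 y² cos² f³`, `-4 y² cos² f³` and `2 y² cos² f³` of the radial, mixed and
`t` components cancel on the vector `T̄`, which is tangent to the level sets of `f`. -/
theorem ord_K_TT : Ord F.V N (wTT y) fun k z => bil ((F.c k).K z) (th y z) (th y z)
      - (z 0)⁻¹ ^ 2 * fC y z * (y ^ 2 + 1 + (F.c k).gbz z 0 0) := by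
  have hb := F.O_th_r (N := N)
  have h1 := (hb.mulO hb).mulO (F.pull (CoordData.O_K_rr (N := N)))
  have h2 := hb.mulO (F.pull ((CoordData.O_K_ra (N := N) 0).add (CoordData.O_K_ar 0)))
  have h3 := F.pull (CoordData.O_K_ab (N := N) 0 0)
  refine (((ord_wTT' (h1.mono' (a' := 2) (b' := 3) (by norm_num) (by norm_num))).sub
    (ord_wTT' (h2.mono' (a' := 2) (b' := 3) (by norm_num) (by norm_num)))).add
    (ord_wTT h3)).congr fun k z hz => ?_
  rw [bil_th_th, CoordData.grz_zero, dtI_zero]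
  ring

theorem O_K_tth_eh (hE : ∀ i j, O y F.V N 1 0 fun k z => F.E k z i j) (i : Fin d) :
    O y F.V N 2 2 fun k z => bil ((F.c k).K z) ((F.c k).tth z (F.E k z)) (eh z (F.E k z i))
      - (z 0)⁻¹ ^ 2 * fC y z * bil ((F.c k).gbz z) Segment.dtI (Segment.rE z (F.E k z i)) := by
  have h : O y F.V N 2 2 fun k z => ∑ j, (F.c k).tau z (F.E k z) j *
      bil ((F.c k).K z) (eh z (F.E k z j)) (eh z (F.E k z i)) :=
    Ord.sumO fun j _ => ((F.O_tau hE j).mulO (F.O_K_EE' hE j i)).mono' (by norm_num) (by norm_num)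
  refine ((F.O_K_TE hE i).sub h).congr fun k z _ => ?_
  rw [CoordData.bil_tth_left]
  ring

theorem O_K_tth_eh' (hE : ∀ i j, O y F.V N 1 0 fun k z => F.E k z i j) (i : Fin d) :
    O y F.V N 2 1 fun k z => bil ((F.c k).K z) ((F.c k).tth z (F.E k z)) (eh z (F.E k z i)) := by
  have h : O y F.V N 2 1 fun k z => ∑ j, (F.c k).tau z (F.E k z) j *
      bil ((F.c k).K z) (eh z (F.E k z j)) (eh z (F.E k z i)) :=
    Ord.sumO fun j _ => ((F.O_tau hE j).mulO (F.O_K_EE' hE j i)).mono' (by norm_num) (by norm_num)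
  refine ((F.O_K_TE' hE i).sub h).congr fun k z _ => ?_
  rw [CoordData.bil_tth_left]

theorem ord_K_tth_tth (hE : ∀ i j, O y F.V N 1 0 fun k z => F.E k z i j) :
    Ord F.V N (wTT y) fun k z =>
      bil ((F.c k).K z) ((F.c k).tth z (F.E k z)) ((F.c k).tth z (F.E k z))
      - (z 0)⁻¹ ^ 2 * fC y z * (y ^ 2 + 1 + (F.c k).gbz z 0 0) := by
  have h1 : O y F.V N 3 1 fun k z => ∑ i, (F.c k).tau z (F.E k z) i *
      bil ((F.c k).K z) (th y z) (eh z (F.E k z i)) :=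
    Ord.sumO fun i _ => ((F.O_tau hE i).mulO (F.O_K_TE' hE i)).mono' (by norm_num) (by norm_num)
  have h2 : O y F.V N 3 1 fun k z => ∑ i, (F.c k).tau z (F.E k z) i *
      bil ((F.c k).K z) ((F.c k).tth z (F.E k z)) (eh z (F.E k z i)) :=
    Ord.sumO fun i _ => ((F.O_tau hE i).mulO (F.O_K_tth_eh' hE i)).mono' (by norm_num)
      (by norm_num)
  refine ((F.ord_K_TT.sub (ord_wTT h1)).sub (ord_wTT h2)).congr fun k z hz => ?_
  have e : ∀ i, bil ((F.c k).K z) (eh z (F.E k z i)) (th y z)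
      = bil ((F.c k).K z) (th y z) (eh z (F.E k z i)) := fun i =>
    bil_symm _ _ _ ((F.c k).K_symm (F.sub k hz).1)
  rw [CoordData.bil_tth_right (v := (F.c k).tth z (F.E k z)),
    CoordData.bil_tth_left (v := th y z)]
  simp only [e]
  ring

theorem O_K_tth_tth (hE : ∀ i j, O y F.V N 1 0 fun k z => F.E k z i j) :
    O y F.V N 2 1 fun k z =>
      bil ((F.c k).K z) ((F.c k).tth z (F.E k z)) ((F.c k).tth z (F.E k z)) := by
  have h1 : O y F.V N 2 1 fun k z =>
      bil ((F.c k).K z) ((F.c k).tth z (F.E k z)) ((F.c k).tth z (F.E k z))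
      - (z 0)⁻¹ ^ 2 * fC y z * (y ^ 2 + 1 + (F.c k).gbz z 0 0) :=
    (F.ord_K_tth_tth hE).weight 2 (fun k z hz => by
      rw [wTT, two_mul]
      exact add_le_add (mono_le_mono (by norm_num) (by norm_num) hz)
        (mono_le_mono (by norm_num) (by norm_num) hz)) fun _ _ hz => (mono_pos _ _ hz).le
  have h2 := ((O_rho.mulO O_rho).mulO O_f).mulO ((O_const (U := F.V) (N := N) (y := y)
    (y ^ 2 + 1)).add (F.pull (CoordData.O_gbz 0 0)))
  exact (h1.add (h2.mono' (a' := 2) (b' := 1) (by norm_num) (by norm_num))).congr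
    fun k z _ => by ring

/-! ### The error terms -/

/-- The part of the first error term that does not involve `ζ`. -/
def errEE₀ (c : CoordData d y B) (E : Fin d → Fin d → ℝ) (i j : Fin d)
    (z : Fin (d + 2) → ℝ) : ℝ := c.errEE 0 E i j z

/-- The coefficient of `ζ` in the first error term. -/
def errEE₁ (c : CoordData d y B) (E : Fin d → Fin d → ℝ) (i j : Fin d)
    (z : Fin (d + 2) → ℝ) : ℝ :=
  -(fC y z * (z 0)⁻¹ ^ 2 * (bil (hat z (c.G z)) (eh z (E i)) (eh z (E j))
    - bil (c.grz z) (Segment.rE z (E i)) (Segment.rE z (E j))))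

omit hδ hnd in
theorem errEE_eq (c : CoordData d y B) (s : ℝ) (E : Fin d → Fin d → ℝ) (i j : Fin d)
    {z : Fin (d + 2) → ℝ} (hz : 0 < z 0) :
    c.errEE s E i j z = errEE₀ c E i j z + s * errEE₁ c E i j z := by
  simp only [errEE₀, errEE₁, CoordData.errEE,
    CoordData.bil_formC hz _ (vecS_eq hz (E i)) (vecS_eq hz (E j))]
  ring

theorem O_errEE₀ (hE : ∀ i j, O y F.V N 1 0 fun k z => F.E k z i j) (i j : Fin d) :
    O y F.V N 3 1 fun k z => errEE₀ (F.c k) (F.E k z) i j z := by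
  have h1 := ((O_rho.mulO O_rho).mulO O_f).mulO (F.O_hatG_EE hE i j)
  refine ((F.O_K_EE hE i j).add
    (h1.mono' (a' := 3) (b' := 1) (by norm_num) (by norm_num))).neg.congr fun k z hz => ?_
  have h0 := F.pos hz
  rw [errEE₀, CoordData.errEE, CoordData.bil_formC h0 _ (vecS_eq h0 _) (vecS_eq h0 _)]
  ring

omit hnd in
theorem O_errEE₁ (hE : ∀ i j, O y F.V N 1 0 fun k z => F.E k z i j) (i j : Fin d) :
    O y F.V N 4 1 fun k z => errEE₁ (F.c k) (F.E k z) i j z := by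
  have h1 := ((O_rho.mulO O_rho).mulO O_f).mulO (F.O_hatG_EE hE i j)
  refine (h1.mono' (a' := 4) (b' := 1) (by norm_num) (by norm_num)).neg.congr fun k z hz => ?_
  rw [errEE₁]
  ring

section Normalized

variable (hE : ∀ i j, O y F.V N 1 0 fun k z => F.E k z i j)
  (hn : ∀ k, ∀ z ∈ F.V k, 1 / 2 ≤ (F.c k).nn z (F.E k z))

include hE hn

omit hnd in
theorem O_inv_sqrt_nn :
    O y F.V N 0 0 (fun k z => (Real.sqrt ((F.c k).nn z (F.E k z)))⁻¹) ∧
    O y F.V N 0 2 fun k z => (Real.sqrt ((F.c k).nn z (F.E k z)))⁻¹ - 1 := by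
  have h1 : O y F.V N 0 0 fun k z => (F.c k).nn z (F.E k z) :=
    (((F.O_nn hE).mono' (a' := 0) (b' := 0) (by norm_num) (by norm_num)).add (O_const 1)).congr
      fun k z _ => by ring
  rw [O, mono_zero_zero] at h1 ⊢
  exact ⟨(h1.inv_sqrt hn).1, h1.inv_sqrt_sub_one (F.O_nn hE) hn⟩

/-- The function `ζ` drops out, because `g(T, E_i)` and `g̊(∂_t, E_i)` vanish. -/
theorem O_errTE (s : κ → (Fin (d + 2) → ℝ) → ℝ) (i : Fin d) :
    O y F.V N 2 2 fun k z => (F.c k).errTE (s k z) (F.E k z) i z := by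
  obtain ⟨hp, hp1⟩ := F.O_inv_sqrt_nn hE hn
  have h1 := hp1.mulO (F.O_K_tth_eh' hE i)
  refine ((h1.mono' (a' := 2) (b' := 2) (by norm_num) (by norm_num)).add
    (F.O_K_tth_eh hE i)).neg.congr fun k z hz => ?_
  have h0 := F.pos hz
  have hpos : 0 < (F.c k).nn z (F.E k z) := by linarith [hn k z hz]
  have e : bil ((F.c k).grz z) Segment.dtI (Segment.rE z (F.E k z i)) = 0 := by
    simp only [bil_dtI_left, CoordData.grz_zero, neg_mul, Finset.sum_neg_distrib,
      sum_dtI_mul_rE, neg_zero]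
  rw [CoordData.errTE, CoordData.bil_formC h0 _ (CoordData.tvec_eq h0 hpos) (vecS_eq h0 _),
    bil_smul_left, bil_smul_left, (F.orth k z hz).bil_tth_eh h0, e]
  ring

/-- The function `ζ` drops out, because `g(T, T)` and `g̊(∂_t, ∂_t)` are both equal to `-1`. -/
theorem ord_errTT (s : κ → (Fin (d + 2) → ℝ) → ℝ) :
    Ord F.V N (wTT y) fun k z => (F.c k).errTT (s k z) (F.E k z) z := by
  obtain ⟨hp, hp1⟩ := F.O_inv_sqrt_nn hE hn
  have h1 := (hp1.mulO ((hp.add (O_const 1)))).mulO (F.O_K_tth_tth hE)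
  refine ((ord_wTT' (h1.mono' (a' := 2) (b' := 3) (by norm_num) (by norm_num))).add
    (F.ord_K_tth_tth hE)).neg.congr fun k z hz => ?_
  have h0 := F.pos hz
  have hpos : 0 < (F.c k).nn z (F.E k z) := by linarith [hn k z hz]
  have hT := CoordData.tvec_eq h0 hpos
  have e : bil ((F.c k).grz z) Segment.dtI Segment.dtI = -1 := by
    rw [bil_dtI_dtI, CoordData.grz_zero, dtI_zero]
  have e2 : bil (hat z ((F.c k).G z)) ((F.c k).tth z (F.E k z)) ((F.c k).tth z (F.E k z))
      = -(F.c k).nn z (F.E k z) := by rw [CoordData.nn, neg_neg]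
  have e3 : (Real.sqrt ((F.c k).nn z (F.E k z)))⁻¹ * (Real.sqrt ((F.c k).nn z (F.E k z)))⁻¹ *
      (F.c k).nn z (F.E k z) = 1 := by
    rw [← mul_inv, Real.mul_self_sqrt hpos.le, inv_mul_cancel₀ hpos.ne']
  rw [CoordData.errTT, CoordData.bil_formC h0 _ hT hT,
    bil_smul_left, bil_smul_left, bil_smul_right, bil_smul_right, e, e2, bil_dtI_dtI]
  linear_combination (fC y z * (z 0)⁻¹ ^ 2 * (1 + s k z)) * e3

end Normalized

end FrameFamily


/-! ### Orthonormal frames at a point -/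

section PointFrames

open Matrix
open scoped MatrixOrder Matrix.Norms.L2Operator

theorem bil_nonneg_of_posDef {m : ℕ} {M : Matrix (Fin m) (Fin m) ℝ} (hM : M.PosDef)
    (v : Fin m → ℝ) : 0 ≤ bil M v v := by
  rw [bil_eq_dotProduct]
  simpa using hM.posSemidef.dotProduct_mulVec_nonneg v

theorem bil_pos_of_posDef {m : ℕ} {M : Matrix (Fin m) (Fin m) ℝ} (hM : M.PosDef)
    {v : Fin m → ℝ} (hv : v ≠ 0) : 0 < bil M v v := by
  rw [bil_eq_dotProduct]
  simpa using hM.dotProduct_mulVec_pos hv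

theorem posDef_of_bil_pos {m : ℕ} {M : Matrix (Fin m) (Fin m) ℝ} (hs : ∀ i j, M i j = M j i)
    (h : ∀ v ≠ 0, 0 < bil M v v) : M.PosDef := by
  refine Matrix.PosDef.of_dotProduct_mulVec_pos ?_ fun v hv => ?_
  · ext i j
    simpa using hs j i
  · have := h v hv
    rw [bil_eq_dotProduct] at this
    simpa using this

/-- Bounds on the inverse of a positive definite matrix bound its form from below. This is the
Cauchy–Schwarz inequality for `v` and `M⁻¹ e_i`. -/
theorem sq_le_mul_bil_of_inv_le {m : ℕ} {M : Matrix (Fin m) (Fin m) ℝ} (hM : M.PosDef) {b : ℝ}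
    (hb : 0 ≤ b) {i : Fin m} (h : M⁻¹ i i ≤ b) (v : Fin m → ℝ) :
    v i ^ 2 ≤ (b + 1) * bil M v v := by
  set u : Fin m → ℝ := M⁻¹ *ᵥ Pi.single i 1 with hu
  have hdet : IsUnit M.det := isUnit_iff_ne_zero.2 hM.det_pos.ne'
  have hMu : M *ᵥ u = Pi.single i 1 := by
    rw [hu, mulVec_mulVec, mul_nonsing_inv _ hdet, one_mulVec]
  have hvu : bil M v u = v i := by rw [bil_eq_dotProduct, hMu]; simp
  have huv : bil M u v = v i := by
    rw [← hvu]
    exact bil_symm _ _ _ fun i j => by simpa using hM.isHermitian.apply j i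
  have huu : bil M u u = M⁻¹ i i := by rw [bil_eq_dotProduct, hMu, hu]; simp
  have hp := bil_nonneg_of_posDef hM (v - (v i / (b + 1)) • u)
  rw [bil_sub_left, bil_sub_right, bil_sub_right, bil_smul_left, bil_smul_right, bil_smul_left,
    bil_smul_right, hvu, huv, huu] at hp
  have hb1 : 0 < b + 1 := by linarith
  have e : v i ^ 2 / (b + 1) ≤ bil M v v := by
    have h2 : v i / (b + 1) * (v i / (b + 1) * M⁻¹ i i) ≤ v i / (b + 1) * v i := by
      have : v i / (b + 1) * (v i / (b + 1) * M⁻¹ i i)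
          = (v i / (b + 1)) ^ 2 * M⁻¹ i i := by ring
      rw [this]
      calc (v i / (b + 1)) ^ 2 * M⁻¹ i i ≤ (v i / (b + 1)) ^ 2 * (b + 1) := by
            gcongr; linarith
        _ = _ := by field_simp
    have e2 : v i ^ 2 / (b + 1) = v i / (b + 1) * v i := by ring
    linarith
  rw [div_le_iff₀ hb1] at e
  linarith

theorem abs_bil_le {m : ℕ} {M : Matrix (Fin m) (Fin m) ℝ} {u v : Fin m → ℝ} {K p q : ℝ}
    (hK : 0 ≤ K) (hp : 0 ≤ p)
    (hM : ∀ i j, |M i j| ≤ K) (hu : ∀ i, |u i| ≤ p) (hv : ∀ i, |v i| ≤ q) :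
    |bil M u v| ≤ m ^ 2 * (K * p * q) := by
  calc |bil M u v| ≤ ∑ i : Fin m, ∑ j : Fin m, K * p * q := by
        refine (Finset.abs_sum_le_sum_abs _ _).trans (Finset.sum_le_sum fun i _ => ?_)
        refine (Finset.abs_sum_le_sum_abs _ _).trans (Finset.sum_le_sum fun j _ => ?_)
        rw [abs_mul, abs_mul]
        have := hM i j
        have := hu i
        have := hv j
        gcongr
    _ = _ := by simp; ring

/-- Every positive definite form has an orthonormal basis. -/
theorem exists_orthonormal {m : ℕ} {M : Matrix (Fin m) (Fin m) ℝ} (hM : M.PosDef) :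
    ∃ E : Matrix (Fin m) (Fin m) ℝ, IsUnit E.det ∧
      ∀ i j, bil M (E i) (E j) = if i = j then 1 else 0 := by
  obtain ⟨P, hP⟩ := CStarAlgebra.nonneg_iff_eq_star_mul_self.mp hM.posSemidef.nonneg
  rw [star_eq_conjTranspose] at hP
  have hdet : IsUnit P.det := by
    rw [isUnit_iff_ne_zero]
    intro h
    have := hM.det_pos
    rw [hP, det_mul, h, mul_zero] at this
    exact lt_irrefl _ this
  have hdet' : IsUnit (P⁻¹ᵀ).det := by
    rw [det_transpose]
    exact Matrix.isUnit_nonsing_inv_det P hdet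
  refine ⟨P⁻¹ᵀ, hdet', fun i j => ?_⟩
  have h1 : P⁻¹ᵀ * M * P⁻¹ = 1 := by
    rw [hP, conjTranspose_eq_transpose_of_trivial, ← Matrix.mul_assoc, ← transpose_mul,
      mul_nonsing_inv _ hdet, transpose_one, Matrix.one_mul, mul_nonsing_inv _ hdet]
  have h2 : bil M (P⁻¹ᵀ i) (P⁻¹ᵀ j) = (P⁻¹ᵀ * M * P⁻¹) i j := by
    rw [bil_eq_dotProduct, Matrix.mul_assoc]
    simp only [Matrix.mul_apply (M := P⁻¹ᵀ), Matrix.mul_apply (M := M), dotProduct, mulVec,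
      transpose_apply]
  rw [h2, h1, one_apply]

end PointFrames

namespace CoordData

variable {d : ℕ} {y : ℝ} {B : ℕ → ℕ → ℝ}

theorem bil_grz_rE (c : CoordData d y B) (z : Fin (d + 2) → ℝ) (u v : Fin d → ℝ) :
    bil (c.grz z) (Segment.rE z u) (Segment.rE z v)
      = bil (c.γ fun k => z (Fin.succ (Fin.succ k))) (z 0 • u) (z 0 • v) := by
  simp only [bil, Fin.sum_univ_succ (n := d), Segment.rE, Fin.cons_zero, Fin.cons_succ]
  simp [grz, gr]

theorem bil_grz_rE_nonneg (c : CoordData d y B) {z : Fin (d + 2) → ℝ} (hz : z ∈ c.dom)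
    (v : Fin d → ℝ) : 0 ≤ bil (c.grz z) (Segment.rE z v) (Segment.rE z v) := by
  rw [bil_grz_rE]
  exact bil_nonneg_of_posDef (c.γ_posDef _ (c.x_mem z hz)) _

theorem rE_sq_le (c : CoordData d y B) {z : Fin (d + 2) → ℝ} (hz : z ∈ c.dom) (v : Fin d → ℝ)
    (a : Fin (d + 1)) : Segment.rE z v a ^ 2 ≤
      (|B 0 0| + 1) * bil (c.grz z) (Segment.rE z v) (Segment.rE z v) := by
  refine Fin.cases ?_ (fun i => ?_) a
  · have := c.bil_grz_rE_nonneg hz v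
    have e : Segment.rE z v 0 = 0 := rfl
    rw [e, zero_pow two_ne_zero]
    positivity
  · rw [bil_grz_rE]
    exact sq_le_mul_bil_of_inv_le (i := i) (v := z 0 • v) (c.γ_posDef _ (c.x_mem z hz))
      (abs_nonneg _) ((le_abs_self _).trans ((c.γ_inv_bdd i i _ (c.x_mem z hz)).trans (le_abs_self _)))

/-- For small `δ`, the metric is comparable to `r² γ` on vectors tangent to `S`. -/
def Comparable (d : ℕ) (y : ℝ) (B : ℕ → ℕ → ℝ) (δ : ℝ) : Prop :=
  ∀ c : CoordData d y B, ∀ z ∈ c.small δ, ∀ v : Fin d → ℝ,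
    1 / 2 * bil (c.grz z) (Segment.rE z v) (Segment.rE z v)
      ≤ bil (c.G z) (Segment.vecS v) (Segment.vecS v) ∧
    bil (c.G z) (Segment.vecS v) (Segment.vecS v)
      ≤ 2 * bil (c.grz z) (Segment.rE z v) (Segment.rE z v)

theorem mono_le_of_lt {δ : ℝ} [Fact (δ ≤ 1)] {c : CoordData d y B} {z : Fin (d + 2) → ℝ}
    (hz : z ∈ c.small δ) {a b : ℤ} (ha : 0 ≤ a) (hab : 1 ≤ a + b) : mono y a b z ≤ fC y z := by
  have := mono_le_mono (y := y) (U := small (d := d) (y := y) (B := B) δ) (a := a) (b := b) (a' := 0)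
    (b' := 1) ha (by omega) hz
  simpa [mono] using this

/-- The difference of the two forms is of relative size `ρ² ≤ f`. -/
theorem exists_comparable (d : ℕ) (y : ℝ) (B : ℕ → ℕ → ℝ) :
    ∃ δ : ℝ, 0 < δ ∧ δ ≤ 1 ∧ Comparable d y B δ := by
  have : Fact ((1 : ℝ) ≤ 1) := ⟨le_rfl⟩
  choose C hC0 hC using fun a b => (O_hatG_ab' (d := d) (y := y) (B := B) (δ := 1) (N := 0)
    a b).bound
  set C' := ∑ a, ∑ b, C a b with hC'
  have hle : ∀ a b, C a b ≤ C' := fun a b =>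
    (Finset.single_le_sum (f := fun b => C a b) (fun b _ => hC0 a b) (Finset.mem_univ b)).trans
      (Finset.single_le_sum (f := fun a => ∑ b, C a b)
        (fun a _ => Finset.sum_nonneg fun b _ => hC0 a b) (Finset.mem_univ a))
  have hC'0 : 0 ≤ C' := Finset.sum_nonneg fun a _ => Finset.sum_nonneg fun b _ => hC0 a b
  set L : ℝ := ((d + 1 : ℕ) : ℝ) ^ 2 * (C' * (|B 0 0| + 1)) with hL
  have hL0 : 0 ≤ L := by positivity
  refine ⟨min 1 (1 / (2 * (L + 1))), by positivity, min_le_left _ _, fun c z hz v => ?_⟩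
  have hz1 := c.small_mono (min_le_left _ _) hz
  have h0 := c.pos z hz.1
  set Q := bil (c.grz z) (Segment.rE z v) (Segment.rE z v) with hQ
  have hQ0 : 0 ≤ Q := c.bil_grz_rE_nonneg hz.1 v
  have hw : ∀ a, |Segment.rE z v a| ≤ Real.sqrt ((|B 0 0| + 1) * Q) := fun a =>
    Real.abs_le_sqrt (c.rE_sq_le hz.1 v a)
  have hf0 : 0 ≤ fC y z := (fC_pos h0 (c.sin_pos z hz.1)).le
  have hM : ∀ a b, |((hat z (c.G z)).submatrix Fin.succ Fin.succ + (-1 : ℝ) • c.grz z) a b|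
      ≤ C' * fC y z := fun a b => by
    have h1 := hC a b c z hz1
    have e : ((hat z (c.G z)).submatrix Fin.succ Fin.succ + (-1 : ℝ) • c.grz z) a b
        = hat z (c.G z) a.succ b.succ - c.grz z a b := by simp; ring
    rw [e]
    have h3 : mono y 2 0 z ≤ fC y z := mono_le_of_lt (δ := 1) hz1 (by norm_num) (by norm_num)
    have h4 := (mono_pos (U := small (d := d) (y := y) (B := B) 1) (y := y) 2 0 hz1).le
    calc _ ≤ C a b * mono y 2 0 z := h1
      _ ≤ C' * fC y z := mul_le_mul (hle a b) h3 h4 hC'0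
  have hb := abs_bil_le (mul_nonneg hC'0 hf0) (Real.sqrt_nonneg _) hM hw hw
  rw [mul_assoc (C' * fC y z), Real.mul_self_sqrt (by positivity)] at hb
  have e : bil (c.G z) (Segment.vecS v) (Segment.vecS v)
      = bil ((hat z (c.G z)).submatrix Fin.succ Fin.succ + (-1 : ℝ) • c.grz z)
        (Segment.rE z v) (Segment.rE z v) + Q := by
    rw [bil_eq_bil_hat h0 _ (vecS_eq h0 v) (vecS_eq h0 v), FrameFamily.bil_eh_eh, bil_add_matrix,
      bil_smul_matrix]
    ring
  have hfd : fC y z ≤ 1 / (2 * (L + 1)) := hz.2.le.trans (min_le_right _ _)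
  have hb' : ((d + 1 : ℕ) : ℝ) ^ 2 * (C' * fC y z * ((|B 0 0| + 1) * Q)) ≤ 1 / 2 * Q := by
    calc _ = L * fC y z * Q := by rw [hL]; ring
      _ ≤ (L + 1) * (1 / (2 * (L + 1))) * Q := by gcongr; linarith
      _ = 1 / 2 * Q := by field_simp
  have hb2 := abs_le.1 (hb.trans hb')
  rw [e]
  constructor <;> linarith [hb2.1, hb2.2]

theorem Comparable.mono {δ δ' : ℝ} (h : δ ≤ δ') (hc : Comparable d y B δ') :
    Comparable d y B δ := fun c z hz v => hc c z (c.small_mono h hz) v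

/-- Orthonormal vectors are of size `ρ`. -/
theorem Comparable.abs_le {δ : ℝ} (hc : Comparable d y B δ) {c : CoordData d y B}
    {z : Fin (d + 2) → ℝ} (hz : z ∈ c.small δ) {E : Fin d → Fin d → ℝ} (hE : c.Orth z E)
    (i j : Fin d) : |E i j| ≤ Real.sqrt ((|B 0 0| + 1) * 2) * (z 0)⁻¹ := by
  have h0 := c.pos z hz.1
  have h1 := (hc c z hz (E i)).1
  rw [hE i i, if_pos rfl] at h1
  have h2 := c.rE_sq_le hz.1 (E i) j.succ
  have h3 : |z 0 * E i j| ≤ Real.sqrt ((|B 0 0| + 1) * 2) := by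
    refine Real.abs_le_sqrt ?_
    have e : Segment.rE z (E i) j.succ = z 0 * E i j := rfl
    rw [e] at h2
    refine h2.trans ?_
    gcongr
    linarith
  rw [abs_mul, abs_of_pos h0] at h3
  rw [← div_eq_mul_inv, le_div_iff₀ h0]
  linarith

theorem Comparable.exists_orth {δ : ℝ} (hc : Comparable d y B δ) {c : CoordData d y B}
    {z : Fin (d + 2) → ℝ} (hz : z ∈ c.small δ) :
    ∃ E : Matrix (Fin d) (Fin d) ℝ, IsUnit E.det ∧ c.Orth z E := by
  have h0 := c.pos z hz.1
  set M := (c.G z).submatrix (fun i : Fin d => i.succ.succ) (fun i : Fin d => i.succ.succ) with hM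
  have hb : ∀ u v, bil (c.G z) (Segment.vecS u) (Segment.vecS v) = bil M u v := by
    intro u v
    simp only [bil, Fin.sum_univ_succ (n := d + 1), Fin.sum_univ_succ (n := d), Segment.vecS,
      Fin.cons_zero, Fin.cons_succ]
    simp [hM]
  have hpd : M.PosDef := by
    refine posDef_of_bil_pos (fun i j => c.G_symm z hz.1 _ _) fun v hv => ?_
    have h1 := (hc c z hz v).1
    rw [hb, bil_grz_rE] at h1
    have := bil_pos_of_posDef (c.γ_posDef _ (c.x_mem z hz.1)) (smul_ne_zero h0.ne' hv)
    linarith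
  obtain ⟨E, hE, h⟩ := exists_orthonormal hpd
  exact ⟨E, hE, fun i j => by rw [hb, h]⟩

end CoordData


/-! ### Uniform constants -/

theorem IsO.mono_const {d : ℕ} {C C' : ℕ → ℕ → ℝ} {U : Set (Fin (d + 2) → ℝ)}
    {w ξ : (Fin (d + 2) → ℝ) → ℝ} (h : IsO C U w ξ) (hC : ∀ k m, C k m ≤ C' k m)
    (hpos : ∀ z ∈ U, 0 < z 0) (hw : ∀ z ∈ U, 0 ≤ w z) : IsO C' U w ξ := by
  refine ⟨h.1, fun k l z hz => (h.2 k l z hz).trans ?_⟩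
  have h0 := hpos z hz
  have := hw z hz
  have := hC k l.length
  gcongr

namespace CoordData

variable {d : ℕ} {y : ℝ} {B : ℕ → ℕ → ℝ} {δ : ℝ}

/-- An orthonormal frame at a point of `{f < δ}`, with a value `s` of the function `ζ`. -/
structure PointFrame (d : ℕ) (y : ℝ) (B : ℕ → ℕ → ℝ) (δ : ℝ) where
  c : CoordData d y B
  z : Fin (d + 2) → ℝ
  E : Fin d → Fin d → ℝ
  s : ℝ
  mem : z ∈ c.small δ
  orth : c.Orth z E

/-- The family of all orthonormal frames at single points. -/
def pointFamily (d : ℕ) (y : ℝ) (B : ℕ → ℕ → ℝ) (δ : ℝ) :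
    FrameFamily (PointFrame d y B δ) d y B δ where
  c k := k.c
  V k := {k.z}
  sub k := singleton_subset_iff.2 k.mem
  E k _ := k.E
  orth k z hz := by rw [mem_singleton_iff.1 hz]; exact k.orth

instance : Region (pointFamily d y B δ).V 0 where
  isOpen := Or.inl rfl
  pos _ _ hz := (pointFamily d y B δ).pos hz

theorem Comparable.O_E (hc : Comparable d y B δ) (i j : Fin d) :
    O y (pointFamily d y B δ).V 0 1 0 fun k z => (pointFamily d y B δ).E k z i j := by
  refine ⟨Real.sqrt ((|B 0 0| + 1) * 2), Real.sqrt_nonneg _, fun k z hz => ?_⟩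
  have e : z = k.z := hz
  have e' : AAdS.mono y 1 0 k.z = (k.z 0)⁻¹ := by simp [AAdS.mono]
  rw [e, e']
  exact hc.abs_le k.mem k.orth i j

/-- Smallness of `δ`: on `{f < δ}` the metric is uniformly nondegenerate, its restriction to `S` is
comparable to `r² γ`, and `T̃` is timelike, being of square about `-r²`. -/
structure Good (d : ℕ) (y : ℝ) (B : ℕ → ℕ → ℝ) (δ : ℝ) : Prop where
  le_one : δ ≤ 1
  nondeg : Nondeg d y B δ
  comparable : Comparable d y B δ
  half_le_nn : ∀ c : CoordData d y B, ∀ z ∈ c.small δ, ∀ E, c.Orth z E → 1 / 2 ≤ c.nn z E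

theorem exists_good (d : ℕ) (y : ℝ) (B : ℕ → ℕ → ℝ) : ∃ δ : ℝ, 0 < δ ∧ Good d y B δ := by
  obtain ⟨δ₁, h1, h1', hn⟩ := exists_nondeg d y B
  obtain ⟨δ₂, h2, h2', hc⟩ := exists_comparable d y B
  have : Fact (δ₂ ≤ 1) := ⟨h2'⟩
  obtain ⟨C, hC, hb⟩ := (pointFamily d y B δ₂).O_nn (N := 0) hc.O_E
  refine ⟨min (min δ₁ δ₂) (1 / (2 * (C + 1))), by positivity,
    (min_le_left _ _).trans ((min_le_left _ _).trans h1'), ?_, ?_, fun c z hz E hE => ?_⟩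
  · exact hn.mono ((min_le_left _ _).trans (min_le_left _ _))
  · exact hc.mono ((min_le_left _ _).trans (min_le_right _ _))
  · have hz2 := c.small_mono ((min_le_left _ _).trans (min_le_right _ _)) hz
    have h3 := hb ⟨c, z, E, 0, hz2, hE⟩ z rfl
    have h4 : mono y 0 2 z ≤ fC y z := mono_le_of_lt hz2 (by norm_num) (by norm_num)
    have h5 : fC y z ≤ 1 / (2 * (C + 1)) := hz.2.le.trans (min_le_right _ _)
    have h6 : C * mono y 0 2 z ≤ 1 / 2 := by
      calc C * mono y 0 2 z ≤ C * (1 / (2 * (C + 1))) := by gcongr; exact h4.trans h5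
        _ ≤ (C + 1) * (1 / (2 * (C + 1))) := by gcongr; linarith
        _ = 1 / 2 := by field_simp
    have h7 := (abs_le.1 (h3.trans h6)).1
    change -(1 / 2) ≤ c.nn z E - 1 at h7
    linarith

theorem mono_three_one (z : Fin (d + 2) → ℝ) : mono y 3 1 z = fC y z * (z 0)⁻¹ ^ 3 := by
  rw [mono, zpow_one]; norm_cast; ring

theorem mono_four_one (z : Fin (d + 2) → ℝ) : mono y 4 1 z = fC y z * (z 0)⁻¹ ^ 4 := by
  rw [mono, zpow_one]; norm_cast; ring

theorem mono_two_two (z : Fin (d + 2) → ℝ) : mono y 2 2 z = fC y z ^ 2 * (z 0)⁻¹ ^ 2 := by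
  rw [mono]; norm_cast; ring

theorem wTT_eq (z : Fin (d + 2) → ℝ) :
    FrameFamily.wTT y z = fC y z * (z 0)⁻¹ ^ 3 + fC y z ^ 3 * (z 0)⁻¹ ^ 2 := by
  rw [FrameFamily.wTT, mono_three_one, mono]; norm_cast; ring

/-- The pointwise bounds of the error terms. -/
theorem exists_pointwise_bound (d : ℕ) (y : ℝ) (B : ℕ → ℕ → ℝ) {δ : ℝ} (hG : Good d y B δ) :
    ∃ k : ℝ, 0 ≤ k ∧ ∀ c : CoordData d y B, ∀ z ∈ c.small δ, ∀ E, c.Orth z E → ∀ s : ℝ,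
      (∀ i j, |c.errEE s E i j z| ≤ k * (fC y z * (z 0)⁻¹ ^ 3 * (1 + (z 0)⁻¹ * |s|))) ∧
      (∀ i, |c.errTE s E i z| ≤ k * (fC y z ^ 2 * (z 0)⁻¹ ^ 2)) ∧
      |c.errTT s E z| ≤ k * (fC y z * (z 0)⁻¹ ^ 3 + fC y z ^ 3 * (z 0)⁻¹ ^ 2) := by
  have : Fact (δ ≤ 1) := ⟨hG.le_one⟩
  have := hG.nondeg
  set F := pointFamily d y B δ with hF
  have hE := hG.comparable.O_E
  have hn : ∀ k, ∀ z ∈ F.V k, 1 / 2 ≤ (F.c k).nn z (F.E k z) := fun k z hz =>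
    hG.half_le_nn k.c z (F.sub k hz) k.E (F.orth k z hz)
  choose C₀ hC₀ h₀ using fun i j => (F.O_errEE₀ (N := 0) hE i j).bound
  choose C₁ hC₁ h₁ using fun i j => (F.O_errEE₁ (N := 0) hE i j).bound
  choose C₂ hC₂ h₂ using fun i => (F.O_errTE (N := 0) hE hn (fun k _ => k.s) i).bound
  obtain ⟨C₃, hC₃, h₃⟩ := (F.ord_errTT (N := 0) hE hn (fun k _ => k.s)).bound
  have hle : ∀ {C : Fin d → Fin d → ℝ}, (∀ i j, 0 ≤ C i j) → ∀ i j, C i j ≤ ∑ i, ∑ j, C i j :=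
    fun {C} h i j =>
      (Finset.single_le_sum (f := fun j => C i j) (fun j _ => h i j) (Finset.mem_univ j)).trans
        (Finset.single_le_sum (f := fun i => ∑ j, C i j)
          (fun i _ => Finset.sum_nonneg fun j _ => h i j) (Finset.mem_univ i))
  have hs0 : 0 ≤ ∑ i, ∑ j, C₀ i j := Finset.sum_nonneg fun i _ => Finset.sum_nonneg fun j _ => hC₀ i j
  have hs1 : 0 ≤ ∑ i, ∑ j, C₁ i j := Finset.sum_nonneg fun i _ => Finset.sum_nonneg fun j _ => hC₁ i j
  have hs2 : 0 ≤ ∑ i, C₂ i := Finset.sum_nonneg fun i _ => hC₂ i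
  refine ⟨∑ i, ∑ j, C₀ i j + ∑ i, ∑ j, C₁ i j + ∑ i, C₂ i + C₃, by positivity,
    fun c z hz E hE s => ?_⟩
  have h0 := c.pos z hz.1
  have hf := fC_pos h0 (c.sin_pos z hz.1)
  have hρ : 0 < (z 0)⁻¹ := by positivity
  set p : PointFrame d y B δ := ⟨c, z, E, s, hz, hE⟩
  refine ⟨fun i j => ?_, fun i => ?_, ?_⟩
  · have a0 := h₀ i j p z rfl
    have a1 := h₁ i j p z rfl
    change |FrameFamily.errEE₀ c E i j z| ≤ _ at a0
    change |FrameFamily.errEE₁ c E i j z| ≤ _ at a1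
    rw [mono_three_one] at a0
    rw [mono_four_one] at a1
    rw [FrameFamily.errEE_eq c s E i j h0]
    have b0 : C₀ i j ≤ ∑ i, ∑ j, C₀ i j + ∑ i, ∑ j, C₁ i j + ∑ i, C₂ i + C₃ := by
      linarith [hle hC₀ i j]
    have b1 : C₁ i j ≤ ∑ i, ∑ j, C₀ i j + ∑ i, ∑ j, C₁ i j + ∑ i, C₂ i + C₃ := by
      linarith [hle hC₁ i j]
    generalize ∑ i, ∑ j, C₀ i j + ∑ i, ∑ j, C₁ i j + ∑ i, C₂ i + C₃ = k at b0 b1 ⊢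
    calc _ ≤ |FrameFamily.errEE₀ c E i j z| + |s| * |FrameFamily.errEE₁ c E i j z| := by
          rw [← abs_mul]; exact abs_add_le _ _
      _ ≤ k * (fC y z * (z 0)⁻¹ ^ 3) + |s| * (k * (fC y z * (z 0)⁻¹ ^ 4)) := by
          refine add_le_add (a0.trans ?_) (mul_le_mul_of_nonneg_left (a1.trans ?_) (abs_nonneg s))
          · gcongr
          · gcongr
      _ = _ := by ring
  · have a := h₂ i p z rfl
    rw [mono_two_two] at a
    refine a.trans ?_
    gcongr
    have := Finset.single_le_sum (f := C₂) (fun i _ => hC₂ i) (Finset.mem_univ i)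
    linarith
  · have a := h₃ p z rfl
    rw [wTT_eq] at a
    refine a.trans ?_
    gcongr
    linarith

/-- A frame on an open subset of `{f < δ}` with components `𝒪(ρ)`, the constants being `D`, and a
function `s`, the coordinate expression of `ζ`. -/
structure SmoothFrame (d : ℕ) (y : ℝ) (B : ℕ → ℕ → ℝ) (δ : ℝ) (D : ℕ → ℕ → ℝ) where
  c : CoordData d y B
  W : Set (Fin (d + 2) → ℝ)
  isOpen : IsOpen W
  sub : W ⊆ c.small δ
  E : (Fin (d + 2) → ℝ) → Fin d → Fin d → ℝ
  orth : ∀ z ∈ W, c.Orth z (E z)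
  isO : ∀ i j, IsO D W (fun z => (z 0)⁻¹) fun z => E z i j
  s : (Fin (d + 2) → ℝ) → ℝ

/-- The family of all frames with components `𝒪(ρ)`, with given constants. -/
def smoothFamily (d : ℕ) (y : ℝ) (B : ℕ → ℕ → ℝ) (δ : ℝ) (D : ℕ → ℕ → ℝ) :
    FrameFamily (SmoothFrame d y B δ D) d y B δ where
  c k := k.c
  V k := k.W
  sub k := k.sub
  E k := k.E
  orth k := k.orth

variable {D : ℕ → ℕ → ℝ}

instance (N : ℕ) : Region (smoothFamily d y B δ D).V N where
  isOpen := Or.inr fun k => k.isOpen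
  pos _ _ hz := (smoothFamily d y B δ D).pos hz

theorem O_E_smoothFamily (N : ℕ) (i j : Fin d) :
    O y (smoothFamily d y B δ D).V N 1 0 fun k z => (smoothFamily d y B δ D).E k z i j := by
  have h := ord_of_isO (U := (smoothFamily d y B δ D).V) (C := D) (w := fun z => (z 0)⁻¹)
    (ξ := fun k z => (smoothFamily d y B δ D).E k z i j)
    (fun k => k.isOpen) (fun k z hz => (smoothFamily d y B δ D).pos hz)
    (fun k z hz => (inv_pos.2 ((smoothFamily d y B δ D).pos hz)).le) (fun k => k.isO i j) N
  exact h.weight_eq fun z => by simp [mono]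

/-- The bounds of the derivatives of the error terms for frames with components `𝒪(ρ)`. -/
theorem exists_isO_bound (d : ℕ) (y : ℝ) (B : ℕ → ℕ → ℝ) {δ : ℝ} (hG : Good d y B δ)
    (D : ℕ → ℕ → ℝ) : ∃ (C : ℕ → ℕ → ℝ) (C' : (ℕ → ℕ → ℝ) → ℕ → ℕ → ℝ),
      ∀ k : SmoothFrame d y B δ D,
        (∀ Z, IsO Z k.W (fun _ => 1) k.s → ∀ i j, IsO (C' Z) k.W
          (fun z => fC y z * (z 0)⁻¹ ^ 3) fun z => k.c.errEE (k.s z) (k.E z) i j z) ∧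
        (∀ i, IsO C k.W (fun z => fC y z ^ 2 * (z 0)⁻¹ ^ 2)
          fun z => k.c.errTE (k.s z) (k.E z) i z) ∧
        IsO C k.W (fun z => fC y z * (z 0)⁻¹ ^ 3 + fC y z ^ 3 * (z 0)⁻¹ ^ 2)
          fun z => k.c.errTT (k.s z) (k.E z) z := by
  have : Fact (δ ≤ 1) := ⟨hG.le_one⟩
  have := hG.nondeg
  set F := smoothFamily d y B δ D with hF
  have hpos : ∀ k, ∀ z ∈ F.V k, 0 < z 0 := fun k z hz => F.pos hz
  have hfpos : ∀ k, ∀ z ∈ F.V k, 0 < fC y z := fun k z hz =>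
    fC_pos (F.pos hz) ((F.c k).sin_pos z (F.sub k hz).1)
  have hn : ∀ k, ∀ z ∈ F.V k, 1 / 2 ≤ (F.c k).nn z (F.E k z) := fun k z hz =>
    hG.half_le_nn k.c z (F.sub k hz) (k.E z) (F.orth k z hz)
  have hw3 : ∀ k, ∀ z ∈ F.V k, 0 ≤ fC y z * (z 0)⁻¹ ^ 3 := fun k z hz => by
    have := hpos k z hz; have := hfpos k z hz; positivity
  have hw2 : ∀ k, ∀ z ∈ F.V k, 0 ≤ fC y z ^ 2 * (z 0)⁻¹ ^ 2 := fun k z hz => by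
    have := hpos k z hz; have := hfpos k z hz; positivity
  have hwT : ∀ k, ∀ z ∈ F.V k, 0 ≤ fC y z * (z 0)⁻¹ ^ 3 + fC y z ^ 3 * (z 0)⁻¹ ^ 2 :=
    fun k z hz => by have := hpos k z hz; have := hfpos k z hz; positivity
  choose C₂ h₂ using fun i => exists_isO_of_ord (U := F.V) (fun k => k.isOpen) hpos hw2 fun N =>
    (F.O_errTE (N := N) (O_E_smoothFamily N) hn (fun k => k.s) i).weight_eq
      fun z => (mono_two_two z).symm
  obtain ⟨C₃, h₃⟩ := exists_isO_of_ord (U := F.V) (fun k => k.isOpen) hpos hwT fun N =>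
    (F.ord_errTT (N := N) (O_E_smoothFamily N) hn (fun k => k.s)).weight_eq
      fun z => (wTT_eq z).symm
  have hEE : ∀ Z : ℕ → ℕ → ℝ, ∀ i j, ∃ C : ℕ → ℕ → ℝ,
      ∀ k : {k : SmoothFrame d y B δ D // IsO Z k.W (fun _ => 1) k.s},
        IsO C (F.V k) (fun z => fC y z * (z 0)⁻¹ ^ 3)
          fun z => (F.c k).errEE (k.1.s z) (F.E k z) i j z := by
    intro Z i j
    let V : {k : SmoothFrame d y B δ D // IsO Z k.W (fun _ => 1) k.s} → Set (Fin (d + 2) → ℝ) :=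
      fun k => F.V k
    have hR : ∀ N, Region V N := fun N => ⟨Or.inr fun k => k.1.isOpen, fun k => hpos k⟩
    have hI : Inside y V :=
      ⟨fun k => F.inside.pos k, fun k => F.inside.sin_pos k, fun k => F.inside.lt_one k⟩
    refine exists_isO_of_ord (U := V) (fun k => k.1.isOpen) (fun k => hpos k) (fun k => hw3 k)
      fun N => ?_
    have h0 := (F.O_errEE₀ (N := N) (O_E_smoothFamily N) i j).comap (V := V) (fun k => k.1)
      (fun k => subset_rfl)
    have h1 := (F.O_errEE₁ (N := N) (O_E_smoothFamily N) i j).comap (V := V) (fun k => k.1)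
      (fun k => subset_rfl)
    have hs := ord_of_isO (U := V) (fun k => k.1.isOpen) (fun k => hpos k)
      (fun k z hz => zero_le_one) (fun k => k.2) N
    have h2 : O y V N 3 1 _ := Ord.mono' (a := 4) (b := 1)
      ((hs.mul h1).weight_eq fun z => (one_mul _).symm) (by norm_num) (by norm_num)
    refine ((h0.add h2).weight_eq fun z => (mono_three_one z).symm).congr fun k z hz => ?_
    exact FrameFamily.errEE_eq _ _ _ _ _ (hpos _ z hz)
  choose C₁ h₁ using hEE
  refine ⟨fun k m => ∑ i, |C₂ i k m| + |C₃ k m|, fun Z k m => ∑ i, ∑ j, |C₁ Z i j k m|,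
    fun k => ⟨fun Z hZ i j => ?_, fun i => ?_, ?_⟩⟩
  · refine (h₁ Z i j ⟨k, hZ⟩).mono_const (fun p m => ?_) (hpos k) (hw3 k)
    exact (le_abs_self _).trans ((Finset.single_le_sum (f := fun j => |C₁ Z i j p m|)
      (fun j _ => abs_nonneg _) (Finset.mem_univ j)).trans
      (Finset.single_le_sum (f := fun i => ∑ j, |C₁ Z i j p m|)
        (fun i _ => Finset.sum_nonneg fun j _ => abs_nonneg _) (Finset.mem_univ i)))
  · refine (h₂ i k).mono_const (fun p m => ?_) (hpos k) (hw2 k)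
    have := Finset.single_le_sum (f := fun i => |C₂ i p m|) (fun i _ => abs_nonneg _)
      (Finset.mem_univ i)
    linarith [le_abs_self (C₂ i p m), abs_nonneg (C₃ p m)]
  · refine (h₃ k).mono_const (fun p m => ?_) (hpos k) (hwT k)
    have : 0 ≤ ∑ i, |C₂ i p m| := Finset.sum_nonneg fun i _ => abs_nonneg _
    linarith [le_abs_self (C₃ p m)]

end CoordData


/-! ### Pseudoconvexity in coordinates -/

/-- The value of a quadratic form on a linear combination. -/
theorem bil_comb {m d : ℕ} (M : Matrix (Fin m) (Fin m) ℝ) (x₀ : ℝ) (x : Fin d → ℝ)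
    (T : Fin m → ℝ) (e : Fin d → Fin m → ℝ) (h : ∀ i, bil M (e i) T = bil M T (e i)) :
    bil M (x₀ • T + ∑ i, x i • e i) (x₀ • T + ∑ i, x i • e i) =
      x₀ ^ 2 * bil M T T + 2 * x₀ * ∑ i, x i * bil M T (e i)
        + ∑ i, ∑ j, x i * x j * bil M (e i) (e j) := by
  simp only [bil_add_left, bil_add_right, bil_sum_left, bil_sum_right, bil_smul_left,
    bil_smul_right, h]
  have e1 : ∑ i, x i * (x₀ * bil M T (e i)) = x₀ * ∑ i, x i * bil M T (e i) := by
    rw [Finset.mul_sum]; exact Finset.sum_congr rfl fun i _ => by ring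
  have e2 : ∑ j, ∑ i, x j * (x i * bil M (e i) (e j))
      = ∑ i, ∑ j, x i * x j * bil M (e i) (e j) := by
    rw [Finset.sum_comm]
    exact Finset.sum_congr rfl fun i _ => Finset.sum_congr rfl fun j _ => by ring
  simp only [Finset.mul_sum] at e1 e2
  simp only [mul_add, Finset.sum_add_distrib, Finset.mul_sum, e1, e2]
  simp only [mul_assoc, ← Finset.mul_sum]
  ring

theorem abs_comb_le {d : ℕ} {a₀ p q s k₀ : ℝ} {x p' : Fin d → ℝ} {q' : Fin d → Fin d → ℝ}
    (hx : ∀ i, |x i| ≤ |a₀|) (hp : |k₀| ≤ p) (hp' : ∀ i, |p' i| ≤ q) (hq : ∀ i j, |q' i j| ≤ s) :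
    |a₀ ^ 2 * k₀ + 2 * a₀ * ∑ i, x i * p' i + ∑ i, ∑ j, x i * x j * q' i j|
      ≤ a₀ ^ 2 * (p + 2 * d * q + d ^ 2 * s) := by
  have h1 : |a₀ ^ 2 * k₀| ≤ a₀ ^ 2 * p := by
    rw [abs_mul, abs_of_nonneg (sq_nonneg a₀)]; gcongr
  have h2 : |2 * a₀ * ∑ i, x i * p' i| ≤ a₀ ^ 2 * (2 * d * q) := by
    have : |∑ i, x i * p' i| ≤ ∑ _i : Fin d, |a₀| * q := by
      refine (Finset.abs_sum_le_sum_abs _ _).trans (Finset.sum_le_sum fun i _ => ?_)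
      rw [abs_mul]
      exact mul_le_mul (hx i) (hp' i) (abs_nonneg _) (abs_nonneg _)
    rw [Finset.sum_const, Finset.card_univ, Fintype.card_fin, nsmul_eq_mul] at this
    rw [abs_mul, abs_mul, abs_two]
    calc 2 * |a₀| * |∑ i, x i * p' i| ≤ 2 * |a₀| * (d * (|a₀| * q)) := by gcongr
      _ = |a₀| ^ 2 * (2 * d * q) := by ring
      _ = _ := by rw [sq_abs]
  have h3 : |∑ i, ∑ j, x i * x j * q' i j| ≤ a₀ ^ 2 * (d ^ 2 * s) := by
    have : |∑ i, ∑ j, x i * x j * q' i j| ≤ ∑ _i : Fin d, ∑ _j : Fin d, |a₀| * |a₀| * s := by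
      refine (Finset.abs_sum_le_sum_abs _ _).trans (Finset.sum_le_sum fun i _ => ?_)
      refine (Finset.abs_sum_le_sum_abs _ _).trans (Finset.sum_le_sum fun j _ => ?_)
      rw [abs_mul, abs_mul]
      have := hx i
      have := hx j
      have := hq i j
      gcongr
    refine this.trans (le_of_eq ?_)
    simp only [Finset.sum_const, Finset.card_univ, Fintype.card_fin, nsmul_eq_mul,
      abs_mul_abs_self]
    ring
  calc _ ≤ |a₀ ^ 2 * k₀| + |2 * a₀ * ∑ i, x i * p' i| + |∑ i, ∑ j, x i * x j * q' i j| :=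
        abs_add_three _ _ _
    _ ≤ _ := by linarith

namespace CoordData

variable {d : ℕ} {y : ℝ} {B : ℕ → ℕ → ℝ} {δ : ℝ} {c : CoordData d y B} {z : Fin (d + 2) → ℝ}
  {E : Fin d → Fin d → ℝ}

theorem Orth.bil_tvec_vecS (h : c.Orth z E) (hz : 0 < z 0) (hn : 0 < c.nn z E) (j : Fin d) :
    bil (c.G z) (c.tvec z E) (Segment.vecS (E j)) = 0 := by
  rw [bil_eq_bil_hat hz _ (tvec_eq hz hn) (vecS_eq hz (E j)), bil_smul_left, h.bil_tth_eh hz,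
    mul_zero]

theorem bil_tvec_tvec (hz : 0 < z 0) (hn : 0 < c.nn z E) :
    bil (c.G z) (c.tvec z E) (c.tvec z E) = -1 := by
  rw [bil_eq_bil_hat hz _ (tvec_eq hz hn) (tvec_eq hz hn), bil_smul_left, bil_smul_right]
  have e : bil (AAdS.hat z (c.G z)) (c.tth z E) (c.tth z E) = -c.nn z E := by rw [nn, neg_neg]
  rw [e]
  have h1 := Real.sqrt_pos.2 hn
  have h2 := Real.mul_self_sqrt hn.le
  field_simp
  linarith

/-- Vectors tangent to the level sets of `f` are combinations of `T` and the `E_i`. -/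
theorem exists_eq_comb (hz : z ∈ c.dom) (hn : 0 < c.nn z E) (hE : IsUnit (Matrix.of E).det)
    {X : Fin (d + 2) → ℝ} (hX : ∑ α, pd α (fC y) z * X α = 0) :
    ∃ (x₀ : ℝ) (x : Fin d → ℝ), X = x₀ • c.tvec z E + ∑ i, x i • Segment.vecS (E i) := by
  have h0 := c.pos z hz
  have hf := fC_pos h0 (c.sin_pos z hz)
  have hreg : z ∈ region d y := ⟨h0, c.sin_pos z hz⟩
  rw [Fin.sum_univ_succ, pd_fC_zero hreg] at hX
  have hX' : ∑ a : Fin (d + 1), pd a.succ (fC y) z * X a.succ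
      = -(y * Real.cos (y * z 1) * (fC y z * fC y z) * z 0) * X 1 := by
    rw [Fin.sum_univ_succ]
    simp only [pd_fC_succ hreg, dtI_zero, dtI_succ]
    simp
  rw [hX'] at hX
  have hX0 : X 0 = X 1 * (y * fC y z * Real.cos (y * z 1) * (-(z 0) ^ 2)) := by
    have : (z 0)⁻¹ * fC y z * (X 0 - X 1 * (y * fC y z * Real.cos (y * z 1) * (-(z 0) ^ 2))) = 0 := by
      rw [mul_sub]
      have e : (z 0)⁻¹ * fC y z * (X 1 * (y * fC y z * Real.cos (y * z 1) * (-(z 0) ^ 2)))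
          = -(y * Real.cos (y * z 1) * (fC y z * fC y z) * z 0) * X 1 := by field_simp
      rw [e]; linarith
    have h2 := (mul_eq_zero.1 this).resolve_left (by positivity)
    linarith
  set u : Fin d → ℝ := fun j => X j.succ.succ with hu
  set a : Fin d → ℝ := Matrix.vecMul u (Matrix.of E)⁻¹ with ha
  have hua : ∀ j, u j = ∑ i, a i * E i j := by
    intro j
    have : Matrix.vecMul a (Matrix.of E) = u := by
      rw [ha, Matrix.vecMul_vecMul, Matrix.nonsing_inv_mul _ hE, Matrix.vecMul_one]
    rw [← this]; rfl
  have hXt : X = X 1 • tbar y z + ∑ i, a i • Segment.vecS (E i) := by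
    funext α
    simp only [Pi.add_apply, Finset.sum_apply, Pi.smul_apply, smul_eq_mul]
    refine Fin.cases ?_ (fun b => Fin.cases ?_ (fun j => ?_) b) α
    · simp [Segment.vecS, tbar, hX0]
    · simp [Segment.vecS, tbar]
    · simpa [Segment.vecS, tbar] using hua j
  set N := Real.sqrt |bil (c.G z) (c.ttilde z E) (c.ttilde z E)| with hN
  have hN0 : N ≠ 0 := by
    intro h
    have := bil_tvec_tvec h0 hn
    rw [tvec, ← hN, h] at this
    simp [bil] at this
  have hT : c.ttilde z E = N • c.tvec z E := by rw [tvec, ← hN, smul_inv_smul₀ hN0]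
  have htb : tbar y z = N • c.tvec z E
      + ∑ i, bil (c.G z) (tbar y z) (Segment.vecS (E i)) • Segment.vecS (E i) := by
    rw [← hT, ttilde, sub_add_cancel]
  refine ⟨X 1 * N, fun i => X 1 * bil (c.G z) (tbar y z) (Segment.vecS (E i)) + a i, ?_⟩
  nth_rw 1 [hXt]
  nth_rw 1 [htb]
  simp only [smul_add, add_smul, mul_smul, Finset.smul_sum, Finset.sum_add_distrib, add_assoc]

theorem abs_gbz_le (c : CoordData d y B) (hz : z ∈ c.dom) (a b : Fin (d + 1)) :
    |c.gbz z a b| ≤ |B 0 0| :=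
  ((c.gb_bdd a b).2 [] _ (c.q_mem z hz)).trans (le_abs_self _)

/-- The components of `Π_ζ` at a point where `ζ` has the value `s`. -/
def piz (c : CoordData d y B) (s : ℝ) (z : Fin (d + 2) → ℝ) :
    Matrix (Fin (d + 1)) (Fin (d + 1)) ℝ :=
  -(c.gbz z + y ^ 2 • Matrix.of (fun a b => Segment.dtI a * Segment.dtI b) + s • c.grz z)

theorem bil_piz (c : CoordData d y B) (s : ℝ) (z : Fin (d + 2) → ℝ) (u v : Fin (d + 1) → ℝ) :
    bil (c.piz s z) u v
      = -(bil (c.gbz z) u v + y ^ 2 * (u 0 * v 0) + s * bil (c.grz z) u v) := by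
  rw [piz, bil_neg_matrix, bil_add_matrix, bil_add_matrix, bil_smul_matrix, bil_smul_matrix]
  have e : bil (Matrix.of fun a b : Fin (d + 1) => Segment.dtI a * Segment.dtI b) u v
      = u 0 * v 0 := by
    rw [← sum_dtI_mul u, ← sum_dtI_mul v, Finset.sum_mul_sum]
    exact Finset.sum_congr rfl fun a _ => Finset.sum_congr rfl fun b _ => by
      rw [Matrix.of_apply]; ring
  rw [e]

/-- The lower bound for `Π_ζ` bounds `ζ`: from below by the value on `∂_t`, and from above by the
value on a unit vector tangent to `S`. -/
theorem abs_le_of_nonneg_piz (hc : Comparable d y B δ) (hz : z ∈ c.small δ) (hE : c.Orth z E)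
    (i : Fin d) {s : ℝ} (h : ∀ X, 0 ≤ bil (c.piz s z) X X) :
    |s| ≤ 2 * ((d + 1 : ℕ) ^ 2 * (|B 0 0| * ((|B 0 0| + 1) * 2))) + |B 0 0| := by
  have hP : 0 ≤ ((d + 1 : ℕ) : ℝ) ^ 2 * (|B 0 0| * ((|B 0 0| + 1) * 2)) := by positivity
  rw [abs_le]
  constructor
  · have h1 := h Segment.dtI
    rw [bil_piz, bil_dtI_dtI, bil_dtI_dtI] at h1
    have h2 : c.grz z 0 0 = -1 := rfl
    have h3 : (Segment.dtI (d := d)) 0 = 1 := rfl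
    rw [h2, h3] at h1
    have h4 := (abs_le.1 (c.abs_gbz_le hz.1 0 0)).1
    nlinarith [sq_nonneg y]
  · have h1 := h (Segment.rE z (E i))
    set q := bil (c.grz z) (Segment.rE z (E i)) (Segment.rE z (E i)) with hq
    have h2 := hc c z hz (E i)
    rw [hE i i, if_pos rfl, ← hq] at h2
    have hw : ∀ a, |Segment.rE z (E i) a| ≤ Real.sqrt ((|B 0 0| + 1) * 2) := fun a => by
      refine Real.abs_le_sqrt ((c.rE_sq_le hz.1 (E i) a).trans ?_)
      rw [← hq]
      gcongr
      linarith
    have h3 := abs_bil_le (abs_nonneg _) (Real.sqrt_nonneg _) (c.abs_gbz_le hz.1) hw hw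
    rw [mul_assoc |B 0 0|, Real.mul_self_sqrt (by positivity)] at h3
    have h4 := (abs_le.1 h3).1
    rw [bil_piz, FrameFamily.rE_zero, ← hq] at h1
    have h5 : s * q ≤ ((d + 1 : ℕ) : ℝ) ^ 2 * (|B 0 0| * ((|B 0 0| + 1) * 2)) := by linarith
    rcases le_or_gt s 0 with hs | hs
    · linarith [abs_nonneg (B 0 0)]
    · have : s * (1 / 2) ≤ s * q := by gcongr; linarith
      linarith [abs_nonneg (B 0 0)]

theorem formC_symm (hz : z ∈ c.dom) (s : ℝ) (u v : Fin (d + 2) → ℝ) :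
    bil (c.formC s z) u v = bil (c.formC s z) v u := by
  have h0 := c.pos z hz
  refine bil_symm _ _ _ fun α β => ?_
  have h1 := c.H_symm hz α β
  simp only [H, AAdS.hat, Matrix.of_apply, mul_comm (scale z β) (scale z α)] at h1
  have h2 := mul_left_cancel₀ (mul_ne_zero (scale_ne_zero h0 α) (scale_ne_zero h0 β)) h1
  simp only [formC, Matrix.neg_apply, Matrix.add_apply, Matrix.smul_apply, h2, c.G_symm z hz α β]

/-- Positivity of `Π_ζ` makes the level sets of `f` pseudoconvex where `f` is small. The symmetry of
`ḡ` is a hypothesis because `CoordData` does not contain it. -/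
theorem exists_pseudoconvex (d : ℕ) (y : ℝ) (B : ℕ → ℕ → ℝ) {δ : ℝ} (hδ : 0 < δ)
    (hG : Good d y B δ) :
    ∃ ε₀ : ℝ → ℝ, (∀ K, 0 < K → 0 < ε₀ K) ∧ ∀ K, 0 < K → ∀ c : CoordData d y B, ∀ z ∈ c.dom,
      fC y z < ε₀ K → (∀ a b, c.gbz z a b = c.gbz z b a) → ∀ s : ℝ, (∀ X, K * X 0 ^ 2 ≤ bil (c.piz s z) X X) →
      ∀ X : Fin (d + 2) → ℝ, X ≠ 0 → bil (c.G z) X X = 0 → ∑ α, pd α (fC y) z * X α = 0 →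
      bil (hessian c.G (fC y) z) X X < 0 := by
  obtain ⟨k, hk, hb⟩ := exists_pointwise_bound d y B hG
  set Z : ℝ := 2 * ((d + 1 : ℕ) ^ 2 * (|B 0 0| * ((|B 0 0| + 1) * 2))) + |B 0 0| with hZ
  have hZ0 : 0 ≤ Z := by positivity
  set L : ℝ := k * (2 + 2 * d + d ^ 2 * (1 + Z)) with hL
  have hL0 : 0 ≤ L := by positivity
  -- the errors are at most `f ρ² x₀² (f L)`, to be compared with the main term `f ρ² x₀² K`
  refine ⟨fun K => min δ (K / (L + 1)), fun K hK => by positivity,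
    fun K hK c z hz hzK hgb s hs X hX0 hXn hXt => ?_⟩
  have hzs : z ∈ c.small δ := ⟨hz, hzK.trans_le (min_le_left _ _)⟩
  have hfK : fC y z * (L + 1) < K := by
    have := hzK.trans_le (min_le_right _ _)
    rwa [lt_div_iff₀ (by positivity)] at this
  have h0 := c.pos z hz
  have hρ : 0 < (z 0)⁻¹ := by positivity
  have hf := fC_pos h0 (c.sin_pos z hz)
  have hρf := inv_le_fC h0 (c.sin_pos z hz)
  have hf1 : fC y z ≤ 1 := hzs.2.le.trans hG.le_one
  obtain ⟨E, hEdet, hE⟩ := hG.comparable.exists_orth hzs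
  have hn : 0 < c.nn z E := by linarith [hG.half_le_nn c z hzs E hE]
  obtain ⟨x₀, x, hXx⟩ := exists_eq_comb hz hn hEdet hXt
  -- the vector `X` is null
  have hnull : ∑ i, x i ^ 2 = x₀ ^ 2 := by
    have h1 := bil_comb (c.G z) x₀ x (c.tvec z E) (fun i => Segment.vecS (E i))
      fun i => bil_symm _ _ _ (c.G_symm z hz)
    rw [← hXx, hXn, bil_tvec_tvec h0 hn] at h1
    simp only [hE.bil_tvec_vecS h0 hn, hE _ _] at h1
    simp at h1
    have : ∑ i, x i ^ 2 = ∑ i, x i * x i := Finset.sum_congr rfl fun i _ => sq _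
    linarith
  have hx₀ : x₀ ≠ 0 := by
    rintro rfl
    have : ∀ i, x i = 0 := fun i => by
      have h1 := Finset.single_le_sum (f := fun i => x i ^ 2) (fun i _ => sq_nonneg _)
        (Finset.mem_univ i)
      rw [hnull] at h1
      have : x i ^ 2 ≤ 0 := by simpa using h1
      exact pow_eq_zero_iff two_ne_zero |>.1 (le_antisymm this (sq_nonneg _))
    exact hX0 (by rw [hXx]; simp [this])
  have hxle : ∀ i, |x i| ≤ |x₀| := fun i => by
    rw [← sq_le_sq, ← hnull]
    exact Finset.single_le_sum (f := fun i => x i ^ 2) (fun i _ => sq_nonneg _)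
      (Finset.mem_univ i)
  -- for `d = 0` no nonzero null vector is tangent to the level set
  obtain ⟨i₀⟩ : Nonempty (Fin d) := by
    by_contra h
    rw [not_nonempty_iff] at h
    rw [Finset.univ_eq_empty, Finset.sum_empty] at hnull
    exact hx₀ (pow_eq_zero_iff two_ne_zero |>.1 hnull.symm)
  have hsZ : |s| ≤ Z := abs_le_of_nonneg_piz hG.comparable hzs hE i₀ fun X =>
    (by positivity : 0 ≤ K * X 0 ^ 2).trans (hs X)
  obtain ⟨bEE, bTE, bTT⟩ := hb c z hzs E hE s
  -- `Y` corresponds to `X` under `T ↦ ∂_t`, `E_i ↦ r E_i`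
  set Y : Fin (d + 1) → ℝ := x₀ • Segment.dtI + ∑ i, x i • Segment.rE z (E i) with hY
  have hYsymm : ∀ i, bil (c.piz s z) (Segment.rE z (E i)) Segment.dtI
      = bil (c.piz s z) Segment.dtI (Segment.rE z (E i)) := fun i => by
    rw [bil_piz, bil_piz, bil_symm _ _ _ hgb, bil_symm _ _ _ (c.grz_symm hz)]
    ring
  have hPi := bil_comb (c.piz s z) x₀ x Segment.dtI (fun i => Segment.rE z (E i)) hYsymm
  rw [← hY] at hPi
  have hForm := bil_comb (c.formC s z) x₀ x (c.tvec z E) (fun i => Segment.vecS (E i))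
    fun i => formC_symm hz s _ _
  rw [← hXx] at hForm
  have hTT : bil (c.formC s z) (c.tvec z E) (c.tvec z E) = c.errTT s E z
      + fC y z * (z 0)⁻¹ ^ 2 * bil (c.piz s z) Segment.dtI Segment.dtI := by
    have h3 : (Segment.dtI (d := d)) 0 = 1 := rfl
    rw [bil_piz, h3]; unfold CoordData.errTT; ring
  have hTE : ∀ i, bil (c.formC s z) (c.tvec z E) (Segment.vecS (E i)) = c.errTE s E i z
      + fC y z * (z 0)⁻¹ ^ 2 * bil (c.piz s z) Segment.dtI (Segment.rE z (E i)) := fun i => by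
    rw [bil_piz, FrameFamily.rE_zero]; unfold CoordData.errTE; ring
  have hEE : ∀ i j, bil (c.formC s z) (Segment.vecS (E i)) (Segment.vecS (E j))
      = c.errEE s E i j z
      + fC y z * (z 0)⁻¹ ^ 2 * bil (c.piz s z) (Segment.rE z (E i)) (Segment.rE z (E j)) :=
    fun i j => by rw [bil_piz, FrameFamily.rE_zero]; unfold CoordData.errEE; ring
  have hsplit : bil (c.formC s z) X X = fC y z * (z 0)⁻¹ ^ 2 * bil (c.piz s z) Y Y
      + (x₀ ^ 2 * c.errTT s E z + 2 * x₀ * ∑ i, x i * c.errTE s E i z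
        + ∑ i, ∑ j, x i * x j * c.errEE s E i j z) := by
    rw [hForm, hPi, hTT]
    simp only [hTE, hEE, mul_add, Finset.sum_add_distrib, Finset.mul_sum]
    have e1 : ∀ i, x i * (fC y z * (z 0)⁻¹ ^ 2 * bil (c.piz s z) Segment.dtI (Segment.rE z (E i)))
      = fC y z * (z 0)⁻¹ ^ 2 * (x i * bil (c.piz s z) Segment.dtI (Segment.rE z (E i))) :=
      fun i => by ring
    have e2 : ∀ i j, x i * x j * (fC y z * (z 0)⁻¹ ^ 2 *
        bil (c.piz s z) (Segment.rE z (E i)) (Segment.rE z (E j)))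
      = fC y z * (z 0)⁻¹ ^ 2 * (x i * x j *
        bil (c.piz s z) (Segment.rE z (E i)) (Segment.rE z (E j))) := fun i j => by ring
    simp only [e1, e2, ← Finset.mul_sum]
    ring
  have herr := abs_comb_le hxle bTT bTE fun i j => (bEE i j).trans
    (show _ ≤ k * (fC y z * (z 0)⁻¹ ^ 3 * (1 + Z)) by
      gcongr
      calc (z 0)⁻¹ * |s| ≤ 1 * |s| := by gcongr; exact hρf.trans hf1
        _ ≤ Z := by rwa [one_mul])
  have hbnd : k * (fC y z * (z 0)⁻¹ ^ 3 + fC y z ^ 3 * (z 0)⁻¹ ^ 2)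
      + 2 * d * (k * (fC y z ^ 2 * (z 0)⁻¹ ^ 2))
      + d ^ 2 * (k * (fC y z * (z 0)⁻¹ ^ 3 * (1 + Z))) ≤ fC y z * (z 0)⁻¹ ^ 2 * (fC y z * L) := by
    have e1 : fC y z * (z 0)⁻¹ ^ 3 ≤ fC y z ^ 2 * (z 0)⁻¹ ^ 2 := by
      calc fC y z * (z 0)⁻¹ ^ 3 = fC y z * (z 0)⁻¹ ^ 2 * (z 0)⁻¹ := by ring
        _ ≤ fC y z * (z 0)⁻¹ ^ 2 * fC y z := by gcongr
        _ = _ := by ring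
    have e2 : fC y z ^ 3 * (z 0)⁻¹ ^ 2 ≤ fC y z ^ 2 * (z 0)⁻¹ ^ 2 := by
      gcongr ?_ * _
      exact pow_le_pow_of_le_one hf.le hf1 (by norm_num)
    calc _ ≤ k * (fC y z ^ 2 * (z 0)⁻¹ ^ 2 + fC y z ^ 2 * (z 0)⁻¹ ^ 2)
          + 2 * d * (k * (fC y z ^ 2 * (z 0)⁻¹ ^ 2))
          + d ^ 2 * (k * (fC y z ^ 2 * (z 0)⁻¹ ^ 2 * (1 + Z))) := by gcongr
      _ = _ := by rw [hL]; ring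
  have hPiY := hs Y
  have hY0 : Y 0 = x₀ := by
    simp [hY, FrameFamily.rE_zero, Segment.dtI]
  rw [hY0] at hPiY
  have hform : 0 < bil (c.formC s z) X X := by
    have h1 := (abs_le.1 (herr.trans (mul_le_mul_of_nonneg_left hbnd (sq_nonneg x₀)))).1
    have hx2 : 0 < x₀ ^ 2 := by positivity
    have h2 : fC y z * (z 0)⁻¹ ^ 2 * (K * x₀ ^ 2) ≤ fC y z * (z 0)⁻¹ ^ 2 * bil (c.piz s z) Y Y := by
      gcongr
    have h3 : 0 < fC y z * (z 0)⁻¹ ^ 2 * x₀ ^ 2 * (K - fC y z * L) := by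
      have : 0 < K - fC y z * L := by linarith
      positivity
    rw [hsplit]
    linarith
  rw [formC, bil_neg_matrix, bil_add_matrix, bil_smul_matrix, hXn] at hform
  linarith

end CoordData


/-! ### Admissible segments in bounded coordinates -/

theorem bil_of_bilinForm {m : ℕ} {V : Type*} [AddCommGroup V] [Module ℝ V]
    (β : V →ₗ[ℝ] V →ₗ[ℝ] ℝ) (b : Fin m → V) (u v : Fin m → ℝ) :
    bil (Matrix.of fun i j => β (b i) (b j)) u v = β (∑ i, u i • b i) (∑ j, v j • b j) := by
  simp only [map_sum, map_smul, LinearMap.sum_apply, LinearMap.smul_apply, smul_eq_mul, bil,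
    Matrix.of_apply, Finset.mul_sum]
  rw [Finset.sum_comm]
  exact Finset.sum_congr rfl fun i _ => Finset.sum_congr rfl fun j _ => by ring

namespace Segment

variable {d : ℕ} {y r₀ : ℝ} {S : Type*} [TopologicalSpace S]
  [ChartedSpace (EuclideanSpace ℝ (Fin d)) S]
  [IsManifold 𝓘(ℝ, EuclideanSpace ℝ (Fin d)) ∞ S]
  (A : Segment d y r₀ S) {e : OpenPartialHomeomorph S (EuclideanSpace ℝ (Fin d))}

theorem mdifferentiable_of_mem_charts (he : e ∈ A.charts) :
    e.MDifferentiable 𝓘(ℝ, EuclideanSpace ℝ (Fin d)) 𝓘(ℝ, EuclideanSpace ℝ (Fin d)) :=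
  ⟨(contMDiffOn_of_mem_maximalAtlas (A.charts_smooth he)).mdifferentiableOn (by simp),
    (contMDiffOn_symm_of_mem_maximalAtlas (A.charts_smooth he)).mdifferentiableOn (by simp)⟩

/-- The tangent vector of `S` with components `v`. -/
def xComb (e : OpenPartialHomeomorph S (EuclideanSpace ℝ (Fin d))) (x v : Fin d → ℝ) :
    TangentSpace 𝓘(ℝ, EuclideanSpace ℝ (Fin d)) (xPt e x) := ∑ i, v i • xVec e x i

omit [IsManifold 𝓘(ℝ, EuclideanSpace ℝ (Fin d)) ∞ S] in
theorem xComb_eq (e : OpenPartialHomeomorph S (EuclideanSpace ℝ (Fin d))) (x v : Fin d → ℝ) :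
    xComb e x v = mfderiv 𝓘(ℝ, EuclideanSpace ℝ (Fin d)) 𝓘(ℝ, EuclideanSpace ℝ (Fin d)) e.symm
      (WithLp.toLp 2 x) (WithLp.toLp 2 v) := by
  have h : (WithLp.toLp 2 v : EuclideanSpace ℝ (Fin d))
      = ∑ i, v i • EuclideanSpace.single i (1 : ℝ) := by
    ext j
    simp [Finset.sum_apply, Pi.single_apply]
  have h2 := congrArg (mfderiv 𝓘(ℝ, EuclideanSpace ℝ (Fin d)) 𝓘(ℝ, EuclideanSpace ℝ (Fin d))
    e.symm (WithLp.toLp 2 x)) h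
  refine Eq.trans ?_ h2.symm
  refine Eq.trans ?_ (map_sum _ _ _).symm
  exact Finset.sum_congr rfl fun i _ => (map_smul _ _ _).symm

theorem xComb_injective (he : e ∈ A.charts) {x : Fin d → ℝ} (hx : x ∈ xDom e) :
    Function.Injective (xComb e x) := by
  intro u v h
  rw [xComb_eq, xComb_eq] at h
  exact (WithLp.toLp_injective 2)
    ((A.mdifferentiable_of_mem_charts he).symm.mfderiv_injective hx h)

theorem xComb_surjective (he : e ∈ A.charts) {x : Fin d → ℝ} (hx : x ∈ xDom e)
    (V : TangentSpace 𝓘(ℝ, EuclideanSpace ℝ (Fin d)) (xPt e x)) : ∃ v, xComb e x v = V := by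
  obtain ⟨w, hw⟩ := (A.mdifferentiable_of_mem_charts he).symm.mfderiv_surjective hx V
  refine ⟨WithLp.ofLp w, ?_⟩
  rw [xComb_eq]
  exact hw

theorem bil_γC (x u v : Fin d → ℝ) :
    bil (A.γC e x) u v = A.γ.inner (xPt e x) (xComb e x u) (xComb e x v) :=
  bil_of_bilinForm (V := TangentSpace 𝓘(ℝ, EuclideanSpace ℝ (Fin d)) (xPt e x))
    (((ContinuousLinearMap.coeLM ℝ).comp (A.γ.inner (xPt e x)).toLinearMap)) (xVec e x) u v

theorem γC_posDef (he : e ∈ A.charts) {x : Fin d → ℝ} (hx : x ∈ xDom e) : (A.γC e x).PosDef := by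
  refine posDef_of_bil_pos (fun i j => A.γ.symm _ _ _) fun v hv => ?_
  rw [A.bil_γC]
  refine A.γ.pos _ _ fun h => hv (A.xComb_injective he hx (h.trans ?_))
  simp [xComb]

omit [IsManifold 𝓘(ℝ, EuclideanSpace ℝ (Fin d)) ∞ S] in
theorem sum_qVec (q X : Fin (d + 1) → ℝ) :
    ∑ a, X a • qVec e q a = (X 0, xComb e (Fin.tail q) (Fin.tail X)) := by
  rw [Fin.sum_univ_succ]
  refine Prod.ext ?_ ?_
  · simp [qVec, Prod.fst_sum]
  · simp [qVec, Prod.snd_sum, xComb, Fin.tail]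
    rfl

theorem bil_gbarC (q X Y : Fin (d + 1) → ℝ) : bil (A.gbarC e q) X Y =
    A.gbar (qPt e q) (X 0, xComb e (Fin.tail q) (Fin.tail X))
      (Y 0, xComb e (Fin.tail q) (Fin.tail Y)) := by
  have h := bil_of_bilinForm (A.gbar (qPt e q)) (qVec e q) X Y
  rw [sum_qVec, sum_qVec] at h
  exact h

theorem gringC_eq (q : Fin (d + 1) → ℝ) : A.gringC e q = gr (A.γC e (Fin.tail q)) := by
  ext a b
  refine Fin.cases (Fin.cases ?_ (fun l => ?_) b) (fun i => Fin.cases ?_ (fun l => ?_) b) a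
  · simp [gringC, gring, qVec, gr]
  · simp [gringC, gring, qVec, gr]
    rfl
  · simp [gringC, gring, qVec, gr]
  · simp [gringC, gring, qVec, gr, γC]
    rfl

theorem bil_gr (γ : Matrix (Fin d) (Fin d) ℝ) (X Y : Fin (d + 1) → ℝ) :
    bil (gr γ) X Y = -(X 0 * Y 0) + bil γ (Fin.tail X) (Fin.tail Y) := by
  simp [bil, Fin.sum_univ_succ (n := d), gr, Fin.tail]

theorem continuous_toLp_coords :
    Continuous fun x : Fin d → ℝ => (WithLp.toLp 2 x : EuclideanSpace ℝ (Fin d)) :=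
  PiLp.continuous_toLp 2 _

omit [ChartedSpace (EuclideanSpace ℝ (Fin d)) S]
  [IsManifold 𝓘(ℝ, EuclideanSpace ℝ (Fin d)) ∞ S] in
theorem isOpen_xDom : IsOpen (xDom e) := e.open_target.preimage continuous_toLp_coords

omit [ChartedSpace (EuclideanSpace ℝ (Fin d)) S]
  [IsManifold 𝓘(ℝ, EuclideanSpace ℝ (Fin d)) ∞ S] in
theorem isOpen_qDom : IsOpen (qDom (y := y) e) := by
  have h : qDom (y := y) e = (fun q => q 0) ⁻¹' Ioo 0 (Real.pi / y) ∩ Fin.tail ⁻¹' xDom e := rfl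
  rw [h]
  exact (isOpen_Ioo.preimage (continuous_apply 0)).inter
    (isOpen_xDom.preimage (continuous_pi fun _ => continuous_apply _))

omit [ChartedSpace (EuclideanSpace ℝ (Fin d)) S]
  [IsManifold 𝓘(ℝ, EuclideanSpace ℝ (Fin d)) ∞ S] in
theorem isOpen_zDom : IsOpen (zDom (y := y) (r₀ := r₀) e) := by
  have h : zDom (y := y) (r₀ := r₀) e
      = (fun z => z 0) ⁻¹' Ioi r₀ ∩ Fin.tail ⁻¹' qDom (y := y) e := rfl
  rw [h]
  exact (isOpen_Ioi.preimage (continuous_apply 0)).inter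
    (isOpen_qDom.preimage (continuous_pi fun _ => continuous_apply _))

/-- The coordinate expression of an admissible segment. -/
def coordData {B : ℕ → ℕ → ℝ} (hA : A.Admissible B) (hr : 0 < r₀) (hy : 0 < y)
    (he : e ∈ A.charts) : CoordData d y B where
  dom := zDom (y := y) (r₀ := r₀) e
  qdom := qDom (y := y) e
  xdom := xDom e
  isOpen_dom := isOpen_zDom
  isOpen_qdom := isOpen_qDom
  isOpen_xdom := isOpen_xDom
  pos z hz := hr.trans hz.1
  sin_pos z hz := by
    have h : Fin.tail z 0 ∈ Ioo 0 (Real.pi / y) := hz.2.1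
    refine Real.sin_pos_of_pos_of_lt_pi (mul_pos hy h.1) ?_
    have := (lt_div_iff₀ hy).1 h.2
    rw [mul_comm]
    exact this
  q_mem z hz := hz.2
  x_mem z hz := hz.2.2
  γ := A.γC e
  gb := A.gbarC e
  G := A.gC e
  γ_posDef x hx := A.γC_posDef he hx
  G_symm z hz α β := A.g_symm _ hz.1 hz.2.1 _ _
  γ_bdd := hA.γ_bdd e he
  γ_inv_bdd := hA.γ_inv_bdd e he
  gb_bdd := hA.gbar_bdd e he
  G_rr := hA.g_rr e he
  G_ra := hA.g_ra e he
  G_ab a b := by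
    have h := hA.g_ab e he a b
    simp only [A.gringC_eq] at h
    exact h

variable {B : ℕ → ℕ → ℝ} {hA : A.Admissible B} {hr : 0 < r₀} {hy : 0 < y} {he : e ∈ A.charts}

theorem f_zPt (z : Fin (d + 2) → ℝ) : A.f (zPt e z) = fC y z := rfl

theorem grz_coordData (z : Fin (d + 2) → ℝ) :
    (A.coordData hA hr hy he).grz z = A.gringC e (Fin.tail z) := by
  rw [gringC_eq]; rfl

theorem errEE_coordData (ζ : ℝ × ℝ × S → ℝ) (E : Fin d → Fin d → ℝ) (i j : Fin d)
    (z : Fin (d + 2) → ℝ) :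
    A.errEE e ζ E i j z = (A.coordData hA hr hy he).errEE (ζ (zPt e z)) E i j z := by
  rw [CoordData.errEE, grz_coordData]; rfl

theorem errTE_coordData (ζ : ℝ × ℝ × S → ℝ) (E : Fin d → Fin d → ℝ) (i : Fin d)
    (z : Fin (d + 2) → ℝ) :
    A.errTE e ζ E i z = (A.coordData hA hr hy he).errTE (ζ (zPt e z)) E i z := by
  rw [CoordData.errTE, grz_coordData]; rfl

theorem errTT_coordData (ζ : ℝ × ℝ × S → ℝ) (E : Fin d → Fin d → ℝ)
    (z : Fin (d + 2) → ℝ) :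
    A.errTT e ζ E z = (A.coordData hA hr hy he).errTT (ζ (zPt e z)) E z := by
  rw [CoordData.errTT, grz_coordData]; rfl

theorem bil_piz_coordData (ζ : ℝ × ℝ × S → ℝ) (z : Fin (d + 2) → ℝ) (X : Fin (d + 1) → ℝ) :
    bil ((A.coordData hA hr hy he).piz (ζ (zPt e z)) z) X X
      = A.Pi ζ (zPt e z) (X 0, xComb e (Fin.tail (Fin.tail z)) (Fin.tail X))
        (X 0, xComb e (Fin.tail (Fin.tail z)) (Fin.tail X)) := by
  rw [CoordData.bil_piz]
  have h1 := A.bil_gbarC (e := e) (Fin.tail z) X X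
  have h2 : bil ((A.coordData hA hr hy he).grz z) X X = _ :=
    bil_gr (A.γC e (Fin.tail (Fin.tail z))) X X
  rw [A.bil_γC] at h2
  rw [h2]
  change -(bil (A.gbarC e (Fin.tail z)) X X + _ + _) = _
  rw [h1]
  rfl

theorem gbz_coordData_symm {z : Fin (d + 2) → ℝ} (hz : z ∈ zDom (y := y) (r₀ := r₀) e)
    (a b : Fin (d + 1)) : (A.coordData hA hr hy he).gbz z a b = (A.coordData hA hr hy he).gbz z b a :=
  A.gbar_symm _ hz.2.1 _ _

omit [ChartedSpace (EuclideanSpace ℝ (Fin d)) S]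
  [IsManifold 𝓘(ℝ, EuclideanSpace ℝ (Fin d)) ∞ S] in
theorem pd_sub_const (H : ℝ × ℝ × S → ℝ) (ε : ℝ) (j : Fin (d + 2)) :
    pd j (fun x => H (zPt e x) - ε) = pd j fun x => H (zPt e x) := by
  funext x; rw [pd, pd, fderiv_sub_const]

theorem hessC_sub_const (H : ℝ × ℝ × S → ℝ) (ε : ℝ) :
    A.hessC e (fun p => H p - ε) = A.hessC e H := by
  funext z
  simp only [hessC, hessian, pd_sub_const]

end Segment


/-! ### Uniform positivity over compact sets -/

namespace Segment

open Filter Topology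

variable {d : ℕ} {y r₀ : ℝ} {S : Type*} [TopologicalSpace S]
  [ChartedSpace (EuclideanSpace ℝ (Fin d)) S]
  [IsManifold 𝓘(ℝ, EuclideanSpace ℝ (Fin d)) ∞ S]
  (A : Segment d y r₀ S) {e : OpenPartialHomeomorph S (EuclideanSpace ℝ (Fin d))}
  {B : ℕ → ℕ → ℝ}

theorem inner_nonneg (s : S) (v : TangentSpace 𝓘(ℝ, EuclideanSpace ℝ (Fin d)) s) :
    0 ≤ A.γ.inner s v v := by
  rcases eq_or_ne v 0 with rfl | h
  · simp
  · exact (A.γ.pos s v h).le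

theorem continuousAt_bil {X : Type*} [TopologicalSpace X] {m : ℕ} {x : X}
    {M : X → Matrix (Fin m) (Fin m) ℝ} {u : X → Fin m → ℝ}
    (hM : ∀ i j, ContinuousAt (fun x => M x i j) x) (hu : ContinuousAt u x) :
    ContinuousAt (fun x => bil (M x) (u x) (u x)) x := by
  have hu' : ∀ i, ContinuousAt (fun x => u x i) x := fun i => (continuousAt_pi.1 hu) i
  exact tendsto_finsetSum _ fun i _ => tendsto_finsetSum _ fun j _ =>
    ((hM i j).mul (hu' i)).mul (hu' j)

/-- The coordinates `(t, x)` on `(0, π/y) × S`. -/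
def qCoord (e : OpenPartialHomeomorph S (EuclideanSpace ℝ (Fin d))) (q : ℝ × S) :
    Fin (d + 1) → ℝ := Fin.cons q.1 (WithLp.ofLp (e q.2))

omit [ChartedSpace (EuclideanSpace ℝ (Fin d)) S]
  [IsManifold 𝓘(ℝ, EuclideanSpace ℝ (Fin d)) ∞ S] in
theorem qPt_qCoord {q : ℝ × S} (hq : q.2 ∈ e.source) : qPt e (qCoord e q) = q := by
  refine Prod.ext rfl ?_
  exact e.left_inv hq

omit [ChartedSpace (EuclideanSpace ℝ (Fin d)) S]
  [IsManifold 𝓘(ℝ, EuclideanSpace ℝ (Fin d)) ∞ S] in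
theorem qCoord_mem {q : ℝ × S} (hq : q.2 ∈ e.source) (ht : q.1 ∈ Ioo 0 (Real.pi / y)) :
    qCoord e q ∈ qDom (y := y) e := ⟨ht, e.map_source hq⟩

omit [ChartedSpace (EuclideanSpace ℝ (Fin d)) S]
  [IsManifold 𝓘(ℝ, EuclideanSpace ℝ (Fin d)) ∞ S] in
theorem continuousAt_qCoord {q : ℝ × S} (hq : q.2 ∈ e.source) : ContinuousAt (qCoord e) q := by
  refine continuousAt_pi.2 fun a => Fin.cases ?_ (fun i => ?_) a
  · exact continuousAt_fst
  · have h1 : ContinuousAt (fun q : ℝ × S => e q.2) q :=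
      ContinuousAt.comp (f := Prod.snd) (e.continuousAt hq) continuousAt_snd
    exact ((EuclideanSpace.proj (𝕜 := ℝ) i).continuous.continuousAt).comp h1

omit [ChartedSpace (EuclideanSpace ℝ (Fin d)) S]
  [IsManifold 𝓘(ℝ, EuclideanSpace ℝ (Fin d)) ∞ S] in
theorem continuousAt_qPt {q : Fin (d + 1) → ℝ} (hq : q ∈ qDom (y := y) e) :
    ContinuousAt (qPt e) q := by
  have h1 : ContinuousAt (fun q : Fin (d + 1) → ℝ =>
      (WithLp.toLp 2 (Fin.tail q) : EuclideanSpace ℝ (Fin d))) q :=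
    (continuous_toLp_coords.comp (continuous_pi fun _ => continuous_apply _)).continuousAt
  exact (continuous_apply 0).continuousAt.prodMk
    (ContinuousAt.comp (f := fun q : Fin (d + 1) → ℝ =>
      (WithLp.toLp 2 (Fin.tail q) : EuclideanSpace ℝ (Fin d))) (e.continuousAt_symm hq.2) h1)

/-- The point over `q` at a fixed radius. -/
def zAt (r : ℝ) (q : Fin (d + 1) → ℝ) : Fin (d + 2) → ℝ := Fin.cons r q

variable {hA : A.Admissible B} {hr : 0 < r₀} {hy : 0 < y} {he : e ∈ A.charts}

theorem continuousAt_piz {ζ : ℝ × ℝ × S → ℝ} (hζ : A.SmoothOnM ζ) {r : ℝ} (hr' : r₀ < r)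
    {q : Fin (d + 1) → ℝ} (hq : q ∈ qDom (y := y) e) (a b : Fin (d + 1)) :
    ContinuousAt (fun q => (A.coordData hA hr hy he).piz (ζ (zPt e (zAt r q))) (zAt r q) a b) q := by
  have hz : ContinuousAt (fun q => ζ (zPt e (zAt r q))) q := by
    have hM : A.M ∈ 𝓝 (zPt e (zAt r q)) := by
      refine IsOpen.mem_nhds ?_ ⟨hr', hq.1, mem_univ _⟩
      exact isOpen_Ioi.prod (isOpen_Ioo.prod isOpen_univ)
    have h1 : ContinuousAt ζ (zPt e (zAt r q)) := hζ.continuousOn.continuousAt hM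
    exact ContinuousAt.comp (f := fun q => zPt e (zAt r q)) h1
      (continuousAt_const.prodMk (continuousAt_qPt hq))
  have hgb : ContinuousAt (fun q => A.gbarC e q a b) q :=
    ((hA.gbar_bdd e he a b).1.continuousOn).continuousAt (isOpen_qDom.mem_nhds hq)
  have hgr : ContinuousAt (fun q : Fin (d + 1) → ℝ => gr (A.γC e (Fin.tail q)) a b) q := by
    refine Fin.cases (Fin.cases ?_ (fun l => ?_) b) (fun i => Fin.cases ?_ (fun l => ?_) b) a
    · exact continuousAt_const
    · exact continuousAt_const
    · exact continuousAt_const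
    · have h1 : ContinuousAt (fun x => A.γC e x i l) (Fin.tail q) :=
        ((hA.γ_bdd e he i l).1.continuousOn).continuousAt (isOpen_xDom.mem_nhds hq.2)
      exact ContinuousAt.comp (f := Fin.tail) h1
        (continuous_pi fun _ => continuous_apply _).continuousAt
  exact ((hgb.add continuousAt_const).add (hz.mul hgr)).neg

/-- Positivity of `Π_ζ` at a point is uniform near that point, because the unit sphere is
compact. -/
theorem exists_pos_le_Pi_nhds (hA : A.Admissible B) (hr : 0 < r₀) (hy : 0 < y)
    {ζ : ℝ × ℝ × S → ℝ} (hζ : A.SmoothOnM ζ)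
    (hpos : ∀ p ∈ A.M, ∀ X, X ≠ 0 → 0 < A.Pi ζ p X X) {r : ℝ} (hr' : r₀ < r) {q₀ : ℝ × S}
    (ht : q₀.1 ∈ Ioo 0 (Real.pi / y)) :
    ∃ t ∈ 𝓝 q₀, ∃ K, 0 < K ∧ ∀ q ∈ t, ∀ X : ℝ × TangentSpace 𝓘(ℝ, EuclideanSpace ℝ (Fin d)) q.2,
      K * (X.1 ^ 2 + A.γ.inner q.2 X.2 X.2) ≤ A.Pi ζ (r, q) X X := by
  obtain ⟨e, he, hs⟩ := A.charts_cover q₀.2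
  set c := A.coordData hA hr hy he with hc
  set x₀ := qCoord e q₀ with hx₀
  have hx₀m : x₀ ∈ qDom (y := y) e := qCoord_mem hs ht
  set Φ : (Fin (d + 1) → ℝ) → (Fin (d + 1) → ℝ) → ℝ := fun q X =>
    bil (c.piz (ζ (zPt e (zAt r q))) (zAt r q)) X X with hΦ
  set Ψ : (Fin (d + 1) → ℝ) → (Fin (d + 1) → ℝ) → ℝ := fun q X =>
    X 0 ^ 2 + bil (A.γC e (Fin.tail q)) (Fin.tail X) (Fin.tail X) with hΨ
  have hΦpos : ∀ q ∈ qDom (y := y) e, ∀ X, X ≠ 0 → 0 < Φ q X := by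
    intro q hq X hX
    rw [hΦ]
    dsimp only
    rw [hc, A.bil_piz_coordData]
    refine hpos (zPt e (zAt r q)) ⟨hr', hq.1, mem_univ _⟩ _ fun h => hX ?_
    have h1 : X 0 = 0 := congrArg Prod.fst h
    have h2 : xComb e (Fin.tail q) (Fin.tail X) = 0 := congrArg Prod.snd h
    have h3 : Fin.tail X = 0 := A.xComb_injective he hq.2 (h2.trans (by simp [xComb]))
    funext a
    exact Fin.cases h1 (fun i => congrFun h3 i) a
  -- `K` is treated as a variable near `0`, where the inequality holds on the unit sphere
  have hev : ∀ᶠ p : ℝ × (Fin (d + 1) → ℝ) in 𝓝 (0, x₀),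
      ∀ X ∈ Metric.sphere (0 : Fin (d + 1) → ℝ) 1, p.1 * Ψ p.2 X < Φ p.2 X := by
    refine (isCompact_sphere _ _).eventually_forall_of_forall_eventually fun X hX => ?_
    have hX0 : X ≠ 0 := by
      rintro rfl
      simp at hX
    have hq : ContinuousAt (fun w : (ℝ × (Fin (d + 1) → ℝ)) × (Fin (d + 1) → ℝ) => w.1.2)
        ((0, x₀), X) := by fun_prop
    have hX' : ContinuousAt (fun w : (ℝ × (Fin (d + 1) → ℝ)) × (Fin (d + 1) → ℝ) => w.2)
        ((0, x₀), X) := by fun_prop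
    have cΦ : ContinuousAt (fun w : (ℝ × (Fin (d + 1) → ℝ)) × (Fin (d + 1) → ℝ) => Φ w.1.2 w.2)
        ((0, x₀), X) := by
      refine continuousAt_bil (fun a b => ?_) hX'
      exact ContinuousAt.comp (f := fun w : (ℝ × (Fin (d + 1) → ℝ)) × (Fin (d + 1) → ℝ) => w.1.2)
        (A.continuousAt_piz hζ hr' hx₀m a b) hq
    have cΨ : ContinuousAt (fun w : (ℝ × (Fin (d + 1) → ℝ)) × (Fin (d + 1) → ℝ) => Ψ w.1.2 w.2)
        ((0, x₀), X) := by
      refine ContinuousAt.add (by fun_prop) (continuousAt_bil (fun i j => ?_) ?_)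
      · have h1 : ContinuousAt (fun x => A.γC e x i j) (Fin.tail x₀) :=
          ((hA.γ_bdd e he i j).1.continuousOn).continuousAt (isOpen_xDom.mem_nhds hx₀m.2)
        exact ContinuousAt.comp (x := ((0, x₀), X))
          (f := fun w : (ℝ × (Fin (d + 1) → ℝ)) × (Fin (d + 1) → ℝ) => Fin.tail w.1.2) h1
          (Continuous.continuousAt (continuous_pi fun i => by simp only [Fin.tail]; fun_prop))
      · exact continuousAt_pi.2 fun i => by simp only [Fin.tail]; fun_prop
    have cl : ContinuousAt (fun w : (ℝ × (Fin (d + 1) → ℝ)) × (Fin (d + 1) → ℝ) =>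
        w.1.1 * Ψ w.1.2 w.2) ((0, x₀), X) := ContinuousAt.mul (by fun_prop) cΨ
    refine cl.eventually_lt cΦ ?_
    simpa using hΦpos x₀ hx₀m X hX0
  have h2 := (hev.curry_nhds.filter_mono nhdsWithin_le_nhds).and
    (self_mem_nhdsWithin : Ioi (0 : ℝ) ∈ 𝓝[>] 0)
  obtain ⟨K, hK, hK0⟩ := h2.exists
  have hsrc : ∀ᶠ q : ℝ × S in 𝓝 q₀, q.2 ∈ e.source ∧ q.1 ∈ Ioo 0 (Real.pi / y) :=
    (continuousAt_snd.eventually (e.open_source.mem_nhds hs)).and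
      (continuousAt_fst.eventually (isOpen_Ioo.mem_nhds ht))
  refine ⟨_, hsrc.and ((continuousAt_qCoord hs).eventually hK), K, hK0, ?_⟩
  rintro q ⟨⟨hqs, hqt⟩, hq⟩
  have hqd : qCoord e q ∈ qDom (y := y) e := qCoord_mem hqs hqt
  -- stated at the point of `S` given by the coordinates of `q`, whose tangent space is only
  -- propositionally the one at `q`
  have key : ∀ X : ℝ × TangentSpace 𝓘(ℝ, EuclideanSpace ℝ (Fin d)) (qPt e (qCoord e q)).2,
      K * (X.1 ^ 2 + A.γ.inner (qPt e (qCoord e q)).2 X.2 X.2)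
        ≤ A.Pi ζ (r, qPt e (qCoord e q)) X X := by
    intro X
    obtain ⟨v, hv⟩ := A.xComb_surjective he hqd.2 X.2
    set V : Fin (d + 1) → ℝ := Fin.cons X.1 v with hV
    have e1 : Φ (qCoord e q) V = A.Pi ζ (r, qPt e (qCoord e q)) X X := by
      rw [hΦ]
      dsimp only
      rw [hc, A.bil_piz_coordData]
      have h1 : ((V 0, xComb e (Fin.tail (qCoord e q)) (Fin.tail V)) :
        ℝ × TangentSpace 𝓘(ℝ, EuclideanSpace ℝ (Fin d)) (qPt e (qCoord e q)).2) = X :=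
        Prod.ext rfl hv
      exact congrArg (fun Y => A.Pi ζ (r, qPt e (qCoord e q)) Y Y) h1
    have e2 : Ψ (qCoord e q) V = X.1 ^ 2 + A.γ.inner (qPt e (qCoord e q)).2 X.2 X.2 := by
      rw [hΨ]
      dsimp only
      rw [A.bil_γC, ← hv]
      rfl
    rw [← e1, ← e2]
    rcases eq_or_ne V 0 with h0 | h0
    · rw [h0]
      simp [hΦ, hΨ, bil, Fin.tail]
    · have hn : 0 < ‖V‖ := norm_pos_iff.2 h0
      have h3 := hq (‖V‖⁻¹ • V) (by simp [norm_smul, hn.ne'])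
      have s1 : Φ (qCoord e q) (‖V‖⁻¹ • V) = ‖V‖⁻¹ ^ 2 * Φ (qCoord e q) V := by
        rw [hΦ]; dsimp only
        rw [bil_smul_left, bil_smul_right]; ring
      have s2 : Ψ (qCoord e q) (‖V‖⁻¹ • V) = ‖V‖⁻¹ ^ 2 * Ψ (qCoord e q) V := by
        have : Fin.tail (‖V‖⁻¹ • V) = ‖V‖⁻¹ • Fin.tail V := rfl
        rw [hΨ]; dsimp only
        rw [this, bil_smul_left, bil_smul_right, Pi.smul_apply, smul_eq_mul]; ring
      rw [s1, s2, mul_left_comm] at h3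
      exact (lt_of_mul_lt_mul_left h3 (by positivity)).le
  rw [qPt_qCoord hqs] at key
  exact key

/-- If `ζ` does not depend on `r`, positivity of `Π_ζ` is uniform over compact sets. -/
theorem exists_pseudoconvexProperty (hA : A.Admissible B) (hr : 0 < r₀) (hy : 0 < y)
    {ζ : ℝ × ℝ × S → ℝ} (hζ : A.SmoothOnM ζ)
    (hind : ∀ r r' t s, (r, t, s) ∈ A.M → (r', t, s) ∈ A.M → ζ (r, t, s) = ζ (r', t, s))
    (hpos : ∀ p ∈ A.M, ∀ X, X ≠ 0 → 0 < A.Pi ζ p X X) {Q : Set (ℝ × S)}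
    (hQ : Q ⊆ Ioo 0 (Real.pi / y) ×ˢ univ) (hQc : IsCompact Q) :
    ∃ K, 0 < K ∧ A.PseudoconvexProperty ζ K (A.M ∩ {p | p.2 ∈ Q}) := by
  have h : ∃ K, 0 < K ∧ ∀ q ∈ Q, ∀ X : ℝ × TangentSpace 𝓘(ℝ, EuclideanSpace ℝ (Fin d)) q.2,
      K * (X.1 ^ 2 + A.γ.inner q.2 X.2 X.2) ≤ A.Pi ζ (r₀ + 1, q) X X := by
    refine hQc.induction_on (p := fun s => ∃ K, 0 < K ∧ ∀ q ∈ s,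
      ∀ X : ℝ × TangentSpace 𝓘(ℝ, EuclideanSpace ℝ (Fin d)) q.2,
        K * (X.1 ^ 2 + A.γ.inner q.2 X.2 X.2) ≤ A.Pi ζ (r₀ + 1, q) X X) ?_ ?_ ?_ ?_
    · exact ⟨1, one_pos, fun q hq => hq.elim⟩
    · rintro s t hst ⟨K, hK, h⟩
      exact ⟨K, hK, fun q hq => h q (hst hq)⟩
    · rintro s t ⟨K, hK, h⟩ ⟨K', hK', h'⟩
      refine ⟨min K K', lt_min hK hK', fun q hq X => ?_⟩
      have hnn : 0 ≤ X.1 ^ 2 + A.γ.inner q.2 X.2 X.2 :=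
        add_nonneg (sq_nonneg _) (A.inner_nonneg _ _)
      rcases hq with hq | hq
      · exact (mul_le_mul_of_nonneg_right (min_le_left _ _) hnn).trans (h q hq X)
      · exact (mul_le_mul_of_nonneg_right (min_le_right _ _) hnn).trans (h' q hq X)
    · intro q hq
      obtain ⟨t, ht, K, hK, h⟩ := A.exists_pos_le_Pi_nhds hA hr hy hζ hpos
        (lt_add_one r₀) (hQ hq).1
      exact ⟨t, mem_nhdsWithin_of_mem_nhds ht, K, hK, h⟩
  obtain ⟨K, hK, h⟩ := h
  refine ⟨K, hK, ?_⟩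
  rintro ⟨r, t, s⟩ ⟨hM, hq⟩ X
  have h1 := h (t, s) hq X
  rwa [Pi, hind (r₀ + 1) r t s ⟨lt_add_one r₀, hM.2⟩ hM] at h1

end Segment

end AAdS

end

theorem mainTheorem7 (d : ℕ) (y : ℝ) (hy : 0 < y) (B : ℕ → ℕ → ℝ) :
    -- constants depending only on `d = n - 1`, `y`, and the implied constants `B` of the metric
    ∃ (δ c : ℝ) (C : (ℕ → ℕ → ℝ) → ℕ → ℕ → ℝ)
      (C' : (ℕ → ℕ → ℝ) → (ℕ → ℕ → ℝ) → ℕ → ℕ → ℝ) (ε₀ : ℝ → ℝ),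
      0 < δ ∧ (∀ K, 0 < K → 0 < ε₀ K) ∧
      ∀ (S : Type*) [TopologicalSpace S] [ChartedSpace (EuclideanSpace ℝ (Fin d)) S]
        [IsManifold 𝓘(ℝ, EuclideanSpace ℝ (Fin d)) ∞ S]
        (r₀ : ℝ) (_ : 0 < r₀) (A : AAdS.Segment d y r₀ S) (_ : A.Admissible B)
        (ζ : ℝ × ℝ × S → ℝ) (_ : A.SmoothOnM ζ),
        -- the three expansions on `{f < δ}`, at each point and for every orthonormal frame
        (∀ e ∈ A.charts, ∀ z ∈ A.smallDom δ e, ∀ E : Fin d → Fin d → ℝ,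
          A.IsOrthonormalFrame e z E →
          (∀ i j, |A.errEE e ζ E i j z| ≤
            c * (A.f (AAdS.Segment.zPt e z) * A.rho (AAdS.Segment.zPt e z) ^ 3 *
              (1 + A.rho (AAdS.Segment.zPt e z) * |ζ (AAdS.Segment.zPt e z)|))) ∧
          (∀ i, |A.errTE e ζ E i z| ≤
            c * (A.f (AAdS.Segment.zPt e z) ^ 2 * A.rho (AAdS.Segment.zPt e z) ^ 2)) ∧
          |A.errTT e ζ E z| ≤
            c * (A.f (AAdS.Segment.zPt e z) * A.rho (AAdS.Segment.zPt e z) ^ 3 +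
              A.f (AAdS.Segment.zPt e z) ^ 3 * A.rho (AAdS.Segment.zPt e z) ^ 2)) ∧
        -- the three expansions on `{f < δ}` with the derivatives of the error terms, for
        -- orthonormal frames with coordinate components of class `𝒪(ρ)`
        (∀ e ∈ A.charts, ∀ W ⊆ A.smallDom δ e, IsOpen W →
          ∀ (E : (Fin (d + 2) → ℝ) → Fin d → Fin d → ℝ) (D : ℕ → ℕ → ℝ),
          (∀ z ∈ W, A.IsOrthonormalFrame e z (E z)) →
          (∀ i j, AAdS.IsO D W (fun z => A.rho (AAdS.Segment.zPt e z)) fun z => E z i j) →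
          (∀ Z, A.IsO1 Z ζ → ∀ i j,
            AAdS.IsO (C' D Z) W
              (fun z => A.f (AAdS.Segment.zPt e z) * A.rho (AAdS.Segment.zPt e z) ^ 3)
              fun z => A.errEE e ζ (E z) i j z) ∧
          (∀ i,
            AAdS.IsO (C D) W
              (fun z => A.f (AAdS.Segment.zPt e z) ^ 2 * A.rho (AAdS.Segment.zPt e z) ^ 2)
              fun z => A.errTE e ζ (E z) i z) ∧
          AAdS.IsO (C D) W
            (fun z => A.f (AAdS.Segment.zPt e z) * A.rho (AAdS.Segment.zPt e z) ^ 3 +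
              A.f (AAdS.Segment.zPt e z) ^ 3 * A.rho (AAdS.Segment.zPt e z) ^ 2)
            fun z => A.errTT e ζ (E z) z) ∧
        -- `Π_ζ` uniformly positive-definite on `Q` (for instance on `Q = M`)
        (∀ K, 0 < K → ∀ Q ⊆ A.M, A.PseudoconvexProperty ζ K Q →
          ∀ ε, 0 < ε → ε < ε₀ K → A.PseudoconvexOn (fun p => A.f p - ε) Q) ∧
        -- `ζ` independent of `r` and `Π_ζ` positive-definite at each point
        ((∀ r r' t s, (r, t, s) ∈ A.M → (r', t, s) ∈ A.M → ζ (r, t, s) = ζ (r', t, s)) →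
          (∀ p ∈ A.M, ∀ X, X ≠ 0 → 0 < A.Pi ζ p X X) →
          ∀ Q ⊆ Set.Ioo 0 (Real.pi / y) ×ˢ (Set.univ : Set S), IsCompact Q →
            ∃ ε₁, 0 < ε₁ ∧ ∀ ε, 0 < ε → ε < ε₁ →
              A.PseudoconvexOn (fun p => A.f p - ε) {p | p.2 ∈ Q}) := by
  obtain ⟨δ, hδ, hG⟩ := AAdS.CoordData.exists_good d y B
  obtain ⟨c, _, hc⟩ := AAdS.CoordData.exists_pointwise_bound d y B hG
  choose C C' hC using AAdS.CoordData.exists_isO_bound d y B hG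
  obtain ⟨ε₀, hε₀, hε⟩ := AAdS.CoordData.exists_pseudoconvex d y B hδ hG
  refine ⟨δ, c, C, C', ε₀, hδ, hε₀, ?_⟩
  intro S _ _ _ r₀ hr A hA ζ hζ
  -- pseudoconvexity under uniform positivity, which is used for compact sets as well
  have hpc : ∀ K, 0 < K → ∀ Q ⊆ A.M, A.PseudoconvexProperty ζ K Q →
      ∀ ε, 0 < ε → ε < ε₀ K → A.PseudoconvexOn (fun p => A.f p - ε) Q := by
    intro K hK Q _ hP ε _ hlt e he z hz hzQ hH X hX hnull htan
    rw [A.hessC_sub_const]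
    have hf : AAdS.fC y z < ε₀ K := by
      have h : A.f (AAdS.Segment.zPt e z) = ε := sub_eq_zero.1 hH
      exact (A.f_zPt z).symm.trans_lt (h.trans_lt hlt)
    refine hε K hK (A.coordData hA hr hy he) z hz hf (A.gbz_coordData_symm hz)
      (ζ (AAdS.Segment.zPt e z)) (fun Y => ?_) X hX hnull ?_
    · rw [A.bil_piz_coordData]
      refine le_trans ?_ (hP _ hzQ _)
      have := A.inner_nonneg _ (AAdS.Segment.xComb e (Fin.tail (Fin.tail z)) (Fin.tail Y))
      exact mul_le_mul_of_nonneg_left (le_add_of_nonneg_right this) hK.le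
    · refine Eq.trans (Finset.sum_congr rfl fun α _ => ?_) htan
      rw [AAdS.Segment.pd_sub_const]
      rfl
  refine ⟨fun e he z hz E hE => ?_, fun e he W hW hWo E D hE hED => ?_, hpc,
    fun hind hpos Q hQ hQc => ?_⟩
  · simp only [A.errEE_coordData (hA := hA) (hr := hr) (hy := hy) (he := he),
      A.errTE_coordData (hA := hA) (hr := hr) (hy := hy) (he := he),
      A.errTT_coordData (hA := hA) (hr := hr) (hy := hy) (he := he)]
    exact hc (A.coordData hA hr hy he) z hz E hE _
  · simp only [A.errEE_coordData (hA := hA) (hr := hr) (hy := hy) (he := he),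
      A.errTE_coordData (hA := hA) (hr := hr) (hy := hy) (he := he),
      A.errTT_coordData (hA := hA) (hr := hr) (hy := hy) (he := he)]
    have h := hC D ⟨A.coordData hA hr hy he, W, hWo, hW, E, hE, hED,
      fun z => ζ (AAdS.Segment.zPt e z)⟩
    refine ⟨fun Z hZ => h.1 Z ⟨?_, fun k l z hz => ?_⟩, h.2.1, h.2.2⟩
    · exact (hZ e he).1.mono fun z hz => (hW hz).1
    · exact (hZ e he).2 k l z (hW hz).1
  · -- points over `Q` given by coordinates lie in `M`
    obtain ⟨K, hK, hP⟩ := A.exists_pseudoconvexProperty hA hr hy hζ hind hpos hQ hQc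
    refine ⟨ε₀ K, hε₀ K hK, fun ε h0 hlt e he z hz hzQ => ?_⟩
    exact hpc K hK _ Set.inter_subset_left hP ε h0 hlt e he z hz
      ⟨⟨hz.1, hz.2.1, Set.mem_univ _⟩, hzQ⟩
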